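/- Let $K$ be a field of characteristic $0$ and $V$ a finite-dimensional $K$-vector space. Let $A=S(V)$ be the symmetric algebra of $V$ with its standard bialgebra structure, in which every $v\in V$ is primitive: $\Delta(v)=v\otimes 1+1\otimes v$, $\varepsilon(v)=0$. For a bialgebra $A$ over $K$, the Gerstenhaber–Schack complex is $$C^k_{GS}(A)=\bigoplus_{m+n=k,\ m,n\ge 0}\mathrm{Hom}_K(A^{\otimes m},A^{\otimes n}),$$ with differential equal to $d_1+(-1)^m d_2$ on $\mathrm{Hom}_K(A^{\otimes m},A^{\otimes n})$. For $\Psi\colon A^{\otimes m}\to A^{\otimes n}$, $$(d_1\Psi)(a_0\otimes\dots\otimes a_m)=\Delta^{n-1}(a_0)\,\Psi(a_1\otimes\dots\otimes a_m)+\sum_{i=0}^{m-1}(-1)^{i+1}\Psi(a_0\otimes\dots\otimes a_ia_{i+1}\otimes\dots\otimes a_m)+(-1)^{m+1}\Psi(a_0\otimes\dots\otimes a_{m-1})\,\Delta^{n-1}(a_m),$$ $$(d_2\Psi)(a_1\otimes\dots\otimes a_m)=\bigl(a_1^{(1)}\cdots a_m^{(1)}\bigr)\otimes\Psi\bigl(a_1^{(2)}\otimes\dots\otimes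 a_m^{(2)}\bigr)+\sum_{i=1}^{n}(-1)^i\Delta_i\Psi(a_1\otimes\dots\otimes a_m)+(-1)^{n+1}\Psi\bigl(a_1^{(1)}\otimes\dots\otimes a_m^{(1)}\bigr)\otimes\bigl(a_1^{(2)}\cdots a_m^{(2)}\bigr).$$ Here $\Delta(a)=a^{(1)}\otimes a^{(2)}$ is the coproduct in Sweedler notation, $\Delta_i$ applies $\Delta$ to the $i$-th tensor factor, and $\Delta^{n-1}\colon A\to A^{\otimes n}$ is the iterated coproduct, with $\Delta^{0}=\mathrm{id}$ and $\Delta^{-1}=\varepsilon$. The empty product is $1$, and $A^{\otimes 0}=K$. Let $H^k_{GS}(A)$ be the $k$-th cohomology of this complex. **Proposition.** For every $k\ge 0$ there is an isomorphism of $K$-vector spaces $$H^k_{GS}(S(V))\;\cong\;\bigoplus_{i+j=k,\ i,j\ge 0}\Lambda^iV\otimes_K\Lambda^j(V^*).$$ -/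

import Mathlib

open scoped TensorProduct

namespace GerstenhaberSchack

noncomputable section

/-! ### Tensor powers `A^{⊗ n}`, realised as `⨂[K]^n A` -/

section TensorPowers

/-- The canonical isomorphism `A ⊗ A^{⊗ n} ≃ A^{⊗ (n+1)}`,
`a ⊗ (a₁ ⊗ ⋯ ⊗ aₙ) ↦ a ⊗ a₁ ⊗ ⋯ ⊗ aₙ`. -/
def consEquiv (K A : Type*) [CommRing K] [AddCommMonoid A] [Module K A] (n : ℕ) :
    A ⊗[K] (⨂[K]^n A) ≃ₗ[K] ⨂[K]^(n + 1) A :=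
  TensorProduct.congr
      (PiTensorProduct.subsingletonEquiv (R := K) (s := fun _ : Fin 1 => A) 0).symm
      (LinearEquiv.refl K (⨂[K]^n A)) ≪≫ₗ
    TensorPower.mulEquiv ≪≫ₗ TensorPower.cast K A (Nat.add_comm 1 n)

/-- The canonical isomorphism `A^{⊗ n} ⊗ A ≃ A^{⊗ (n+1)}`,
`(a₁ ⊗ ⋯ ⊗ aₙ) ⊗ a ↦ a₁ ⊗ ⋯ ⊗ aₙ ⊗ a`. -/
def snocEquiv (K A : Type*) [CommRing K] [AddCommMonoid A] [Module K A] (n : ℕ) :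
    (⨂[K]^n A) ⊗[K] A ≃ₗ[K] ⨂[K]^(n + 1) A :=
  TensorProduct.congr
      (LinearEquiv.refl K (⨂[K]^n A))
      (PiTensorProduct.subsingletonEquiv (R := K) (s := fun _ : Fin 1 => A) 0).symm ≪≫ₗ
    TensorPower.mulEquiv

theorem consEquiv_tmul_tprod (K A : Type*) [CommRing K] [AddCommMonoid A] [Module K A] (n : ℕ)
    (a : A) (f : Fin n → A) :
    consEquiv K A n (a ⊗ₜ[K] PiTensorProduct.tprod K f) =
      PiTensorProduct.tprod K (Fin.cons a f : Fin (n + 1) → A) := by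
  simp only [consEquiv, LinearEquiv.trans_apply, TensorProduct.congr_tmul,
    LinearEquiv.refl_apply, PiTensorProduct.subsingletonEquiv_symm_apply',
    ← TensorPower.gMul_def, TensorPower.tprod_mul_tprod, TensorPower.cast_tprod]
  congr 1
  funext i
  refine Fin.cases ?_ (fun j => ?_) i
  · simp [Fin.append, Fin.addCases]
  · simp [Fin.append, Fin.addCases, Fin.subNat, Fin.cons]

theorem snocEquiv_tprod_tmul (K A : Type*) [CommRing K] [AddCommMonoid A] [Module K A] (n : ℕ)
    (a : A) (f : Fin n → A) :
    snocEquiv K A n (PiTensorProduct.tprod K f ⊗ₜ[K] a) =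
      PiTensorProduct.tprod K (Fin.snoc f a : Fin (n + 1) → A) := by
  simp only [snocEquiv, LinearEquiv.trans_apply, TensorProduct.congr_tmul,
    LinearEquiv.refl_apply, PiTensorProduct.subsingletonEquiv_symm_apply',
    ← TensorPower.gMul_def, TensorPower.tprod_mul_tprod]
  congr 1
  exact Fin.append_right_eq_snoc f _

end TensorPowers

/-! ### Structure maps on the tensor powers of a bialgebra -/

section Maps

variable (K A : Type*) [CommRing K] [Ring A] [Bialgebra K A]

/-- Multiplication of two neighbouring tensor factors: `mulAt K A m i` is
`a₀ ⊗ ⋯ ⊗ aₘ ↦ a₀ ⊗ ⋯ ⊗ (aᵢ * aᵢ₊₁) ⊗ ⋯ ⊗ aₘ` (`0 ≤ i < m`). -/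
def mulAt : (m : ℕ) → Fin m → ((⨂[K]^(m + 1) A) →ₗ[K] ⨂[K]^m A)
  | 0 => fun i => i.elim0
  | m + 1 => Fin.cases
      ((consEquiv K A m).toLinearMap ∘ₗ
        (LinearMap.mul' K A).rTensor (⨂[K]^m A) ∘ₗ
        (TensorProduct.assoc K A A (⨂[K]^m A)).symm.toLinearMap ∘ₗ
        (consEquiv K A m).symm.toLinearMap.lTensor A ∘ₗ
        (consEquiv K A (m + 1)).symm.toLinearMap)
      (fun i => (consEquiv K A m).toLinearMap ∘ₗ
        (mulAt m i).lTensor A ∘ₗ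
        (consEquiv K A (m + 1)).symm.toLinearMap)

/-- Comultiplication of one tensor factor: `comulAt K A n i` is
`a₀ ⊗ ⋯ ⊗ aₙ₋₁ ↦ a₀ ⊗ ⋯ ⊗ Δ(aᵢ) ⊗ ⋯ ⊗ aₙ₋₁` (`0 ≤ i < n`). -/
def comulAt : (n : ℕ) → Fin n → ((⨂[K]^n A) →ₗ[K] ⨂[K]^(n + 1) A)
  | 0 => fun i => i.elim0
  | n + 1 => Fin.cases
      ((consEquiv K A (n + 1)).toLinearMap ∘ₗ
        (consEquiv K A n).toLinearMap.lTensor A ∘ₗ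
        (TensorProduct.assoc K A A (⨂[K]^n A)).toLinearMap ∘ₗ
        (Coalgebra.comul (R := K) (A := A)).rTensor (⨂[K]^n A) ∘ₗ
        (consEquiv K A n).symm.toLinearMap)
      (fun i => (consEquiv K A (n + 1)).toLinearMap ∘ₗ
        (comulAt n i).lTensor A ∘ₗ
        (consEquiv K A n).symm.toLinearMap)

/-- The iterated comultiplication `A → A^{⊗ n}`, `a ↦ a⁽¹⁾ ⊗ ⋯ ⊗ a⁽ⁿ⁾`
(the counit for `n = 0`, the identity for `n = 1`, the comultiplication for `n = 2`). -/
def iterComul : (n : ℕ) → (A →ₗ[K] ⨂[K]^n A)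
  | 0 => Algebra.linearMap K (⨂[K]^0 A) ∘ₗ Coalgebra.counit
  | n + 1 => (consEquiv K A n).toLinearMap ∘ₗ (iterComul n).lTensor A ∘ₗ Coalgebra.comul

/-- The left coaction of `A` on `A^{⊗ m}`:
`a₁ ⊗ ⋯ ⊗ aₘ ↦ (a₁⁽¹⁾ * ⋯ * aₘ⁽¹⁾) ⊗ (a₁⁽²⁾ ⊗ ⋯ ⊗ aₘ⁽²⁾)`. -/
def leftCoaction : (m : ℕ) → ((⨂[K]^m A) →ₗ[K] A ⊗[K] (⨂[K]^m A))
  | 0 => TensorProduct.mk K A (⨂[K]^0 A) 1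
  | m + 1 => TensorProduct.map (LinearMap.mul' K A) (consEquiv K A m).toLinearMap ∘ₗ
      (TensorProduct.tensorTensorTensorComm K A A A (⨂[K]^m A)).toLinearMap ∘ₗ
      TensorProduct.map Coalgebra.comul (leftCoaction m) ∘ₗ
      (consEquiv K A m).symm.toLinearMap

/-- The right coaction of `A` on `A^{⊗ m}`:
`a₁ ⊗ ⋯ ⊗ aₘ ↦ (a₁⁽¹⁾ ⊗ ⋯ ⊗ aₘ⁽¹⁾) ⊗ (a₁⁽²⁾ * ⋯ * aₘ⁽²⁾)`. -/
def rightCoaction : (m : ℕ) → ((⨂[K]^m A) →ₗ[K] (⨂[K]^m A) ⊗[K] A)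
  | 0 => (TensorProduct.mk K (⨂[K]^0 A) A).flip 1
  | m + 1 => TensorProduct.map (consEquiv K A m).toLinearMap (LinearMap.mul' K A) ∘ₗ
      (TensorProduct.tensorTensorTensorComm K A A (⨂[K]^m A) A).toLinearMap ∘ₗ
      TensorProduct.map Coalgebra.comul (rightCoaction m) ∘ₗ
      (consEquiv K A m).symm.toLinearMap

end Maps

/-! ### The Gerstenhaber–Schack complex and its cohomology -/

section Complex

variable (K A : Type*) [CommRing K] [Ring A] [Bialgebra K A]

/-- The first (Hochschild type) differential
`Hom(A^{⊗ m}, A^{⊗ n}) → Hom(A^{⊗ (m+1)}, A^{⊗ n})`,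
`(d₁ Ψ)(a₀ ⊗ ⋯ ⊗ aₘ) = Δⁿ⁻¹(a₀) * Ψ(a₁ ⊗ ⋯ ⊗ aₘ)
  + ∑_{0 ≤ i < m} (-1)^(i+1) Ψ(a₀ ⊗ ⋯ ⊗ aᵢ * aᵢ₊₁ ⊗ ⋯ ⊗ aₘ)
  + (-1)^(m+1) Ψ(a₀ ⊗ ⋯ ⊗ aₘ₋₁) * Δⁿ⁻¹(aₘ)`;
products are taken in the algebra `A^{⊗ n}`. -/
def d₁ (m n : ℕ) :
    ((⨂[K]^m A) →ₗ[K] ⨂[K]^n A) →ₗ[K] ((⨂[K]^(m + 1) A) →ₗ[K] ⨂[K]^n A) where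
  toFun Ψ :=
    LinearMap.mul' K (⨂[K]^n A) ∘ₗ TensorProduct.map (iterComul K A n) Ψ ∘ₗ
        (consEquiv K A m).symm.toLinearMap
      + ∑ i : Fin m, (-1 : K) ^ ((i : ℕ) + 1) • (Ψ ∘ₗ mulAt K A m i)
      + (-1 : K) ^ (m + 1) •
        (LinearMap.mul' K (⨂[K]^n A) ∘ₗ TensorProduct.map Ψ (iterComul K A n) ∘ₗ
          (snocEquiv K A m).symm.toLinearMap)
  map_add' Φ Ψ := by
    simp only [TensorProduct.map_add_left, TensorProduct.map_add_right, LinearMap.add_comp,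
      LinearMap.comp_add, smul_add, Finset.sum_add_distrib]
    abel
  map_smul' c Ψ := by
    simp only [TensorProduct.map_smul_left, TensorProduct.map_smul_right, LinearMap.smul_comp,
      LinearMap.comp_smul, smul_add, Finset.smul_sum, smul_comm c, RingHom.id_apply]

/-- The second (co-Hochschild type) differential
`Hom(A^{⊗ m}, A^{⊗ n}) → Hom(A^{⊗ m}, A^{⊗ (n+1)})`,
`(d₂ Ψ)(a₁ ⊗ ⋯ ⊗ aₘ) = (a₁⁽¹⁾ * ⋯ * aₘ⁽¹⁾) ⊗ Ψ(a₁⁽²⁾ ⊗ ⋯ ⊗ aₘ⁽²⁾)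
  + ∑_{1 ≤ i ≤ n} (-1)^i Δᵢ(Ψ(a₁ ⊗ ⋯ ⊗ aₘ))
  + (-1)^(n+1) Ψ(a₁⁽¹⁾ ⊗ ⋯ ⊗ aₘ⁽¹⁾) ⊗ (a₁⁽²⁾ * ⋯ * aₘ⁽²⁾)`,
where `Δᵢ` applies the comultiplication to the `i`-th tensor factor. -/
def d₂ (m n : ℕ) :
    ((⨂[K]^m A) →ₗ[K] ⨂[K]^n A) →ₗ[K] ((⨂[K]^m A) →ₗ[K] ⨂[K]^(n + 1) A) where
  toFun Ψ :=
    (consEquiv K A n).toLinearMap ∘ₗ Ψ.lTensor A ∘ₗ leftCoaction K A m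
      + ∑ i : Fin n, (-1 : K) ^ ((i : ℕ) + 1) • (comulAt K A n i ∘ₗ Ψ)
      + (-1 : K) ^ (n + 1) •
        ((snocEquiv K A n).toLinearMap ∘ₗ Ψ.rTensor A ∘ₗ rightCoaction K A m)
  map_add' Φ Ψ := by
    simp only [LinearMap.lTensor_add, LinearMap.rTensor_add, LinearMap.add_comp,
      LinearMap.comp_add, smul_add, Finset.sum_add_distrib]
    abel
  map_smul' c Ψ := by
    simp only [LinearMap.lTensor_smul, LinearMap.rTensor_smul, LinearMap.smul_comp,
      LinearMap.comp_smul, smul_add, Finset.smul_sum, smul_comm c, RingHom.id_apply]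

/-- The Gerstenhaber–Schack cochains of degree `k`:
the (finite) direct sum of the `Hom_K(A^{⊗ m}, A^{⊗ n})` over all `m, n ≥ 0` with `m + n = k`. -/
def Cochain (k : ℕ) : Type _ :=
  (p : Finset.HasAntidiagonal.antidiagonal k) →
    ((⨂[K]^(p : ℕ × ℕ).1 A) →ₗ[K] ⨂[K]^(p : ℕ × ℕ).2 A)

instance (k : ℕ) : AddCommGroup (Cochain K A k) :=
  inferInstanceAs (AddCommGroup ((p : Finset.HasAntidiagonal.antidiagonal k) →
    ((⨂[K]^(p : ℕ × ℕ).1 A) →ₗ[K] ⨂[K]^(p : ℕ × ℕ).2 A)))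

instance (k : ℕ) : Module K (Cochain K A k) :=
  inferInstanceAs (Module K ((p : Finset.HasAntidiagonal.antidiagonal k) →
    ((⨂[K]^(p : ℕ × ℕ).1 A) →ₗ[K] ⨂[K]^(p : ℕ × ℕ).2 A)))

/-- The `(m, n)`-component of a cochain of degree `k = m + n`. -/
def Cochain.proj (k m n : ℕ) (h : m + n = k) :
    Cochain K A k →ₗ[K] ((⨂[K]^m A) →ₗ[K] ⨂[K]^n A) where
  toFun Ψ := Ψ ⟨(m, n), Finset.HasAntidiagonal.mem_antidiagonal.2 h⟩
  map_add' _ _ := rfl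
  map_smul' _ _ := rfl

/-- The contribution of `d₁` to the `(m, n)`-component of the total differential. -/
def component₁ (k : ℕ) : (m n : ℕ) → m + n = k + 1 →
    (Cochain K A k →ₗ[K] ((⨂[K]^m A) →ₗ[K] ⨂[K]^n A))
  | 0, _, _ => 0
  | m + 1, n, h => d₁ K A m n ∘ₗ Cochain.proj K A k m n (by omega)

/-- The contribution of `d₂` to the `(m, n)`-component of the total differential. -/
def component₂ (k : ℕ) : (m n : ℕ) → m + n = k + 1 →
    (Cochain K A k →ₗ[K] ((⨂[K]^m A) →ₗ[K] ⨂[K]^n A))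
  | _, 0, _ => 0
  | m, n + 1, h => d₂ K A m n ∘ₗ Cochain.proj K A k m n (by omega)

/-- The Gerstenhaber–Schack differential: on `Hom(A^{⊗ m}, A^{⊗ n})` it is `d₁ + (-1)^m d₂`
(`d₁` and `d₂` commute, and the sign is the usual one of a total complex). -/
def d (k : ℕ) : Cochain K A k →ₗ[K] Cochain K A (k + 1) where
  toFun Ψ p :=
    component₁ K A k (p : ℕ × ℕ).1 (p : ℕ × ℕ).2
        (Finset.HasAntidiagonal.mem_antidiagonal.1 p.2) Ψ +
      (-1 : K) ^ (p : ℕ × ℕ).1 •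
        component₂ K A k (p : ℕ × ℕ).1 (p : ℕ × ℕ).2
          (Finset.HasAntidiagonal.mem_antidiagonal.1 p.2) Ψ
  map_add' Φ Ψ := by
    funext p
    simp only [map_add, smul_add]
    exact add_add_add_comm _ _ _ _
  map_smul' c Ψ := by
    funext p
    simp only [map_smul, smul_comm _ c, ← smul_add]
    rfl

/-- Coboundaries of degree `k` (there are none besides `0` in degree `0`). -/
def coboundaries : (k : ℕ) → Submodule K (Cochain K A k)
  | 0 => ⊥
  | k + 1 => LinearMap.range (d K A k)

/-- The Gerstenhaber–Schack cohomology `H^k_GS(A)`: cocycles modulo coboundaries. -/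
abbrev Cohomology (k : ℕ) : Type _ :=
  LinearMap.ker (d K A k) ⧸ (coboundaries K A k).submoduleOf (LinearMap.ker (d K A k))

end Complex

end

end GerstenhaberSchack

/-!
The Gerstenhaber–Schack double complex of `A = S(V)` splits into a bar and a cobar part, and both
parts are computed by a Koszul-type argument.

*Untwisting.* `A` is commutative, cocommutative and has an antipode. The automorphism
`f ↦ (y ↦ Δⁿ⁻¹(y⁽⁻¹⁾) f(y⁽⁰⁾))` of `Hom(A^{⊗ m}, A^{⊗ n})`, with `y ↦ y⁽⁻¹⁾ ⊗ y⁽⁰⁾` the left coaction,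
is invertible by `twist_twist_of_antipode`. It absorbs the outer actions in `d₁` and the outer
coactions in `d₂`: by `d₁_twist` and `d₂_twist` the differentials become `f ↦ f ∘ bar` and
`f ↦ cobar ∘ f`, where `bar` and `cobar` are the differentials with trivial coefficients. Over a field
both complexes split off their (co)homology, so the double complex splits in both directions, and the
cohomology of its total complex in degree `k` is the sum over `m + n = k` of
`Hom(H_m(bar), H^n(cobar))` (`DoubleSplitting.cohomologyEquivRange`,
`DoubleSplitting.rangeTotalEquiv`, `rangeDoubleSplittingEquiv`).

*The bar and cobar complexes.* The cobar complex is the subcomplex of the cobar resolution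
`A ⊗ A^{⊗ n}` killed by the partial derivatives `Dⱼ` of the first factor; dually, the functionals on
the bar complex are the functionals on the bar resolution killed by the transposes of multiplication
of the first factor by the coordinates `xⱼ`. The resolutions have the cohomology of a point. These
operators commute, are null-homotopic (`deletion_homotopy_succ`, `insertion_homotopy_succ`) and have
right inverses, namely integration and division by a coordinate. Passing to the kernel of such an
operator replaces the cohomology by its sum with a shifted copy of itself
(`rank_subCohomology_ker`), so after `dim V` steps the dimensions are binomial coefficients
(`rank_subCohomology_iInf_ker`). Characteristic zero is used for integration and for Euler's
identity, which says that the common kernel of the `Dⱼ` is `K` and that the `xⱼ` generate the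
augmentation ideal.

All spaces are therefore finite-dimensional, and both sides have dimension
`∑_{i + j = k} (dim V choose i) (dim V choose j)`.
-/

namespace GerstenhaberSchack

noncomputable section

/-! ### Tensor powers of a bialgebra, one factor at a time -/

section TensorCalculus

variable {K A : Type*} [Field K] [CommRing A] [Bialgebra K A]

theorem hom_ext_cons {m : ℕ} {M : Type*} [AddCommMonoid M] [Module K M]
    {f g : (⨂[K]^(m + 1) A) →ₗ[K] M}
    (h : ∀ (a : A) (y : ⨂[K]^m A),
      f (consEquiv K A m (a ⊗ₜ y)) = g (consEquiv K A m (a ⊗ₜ y))) : f = g := by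
  have : f ∘ₗ (consEquiv K A m).toLinearMap = g ∘ₗ (consEquiv K A m).toLinearMap :=
    TensorProduct.ext' fun a y => h a y
  ext1
  ext x
  simpa using LinearMap.congr_fun this ((consEquiv K A m).symm (PiTensorProduct.tprod K x))

theorem cons_induction {m : ℕ} {p : (⨂[K]^(m + 1) A) → Prop} (x : ⨂[K]^(m + 1) A)
    (zero : p 0) (add : ∀ x y, p x → p y → p (x + y))
    (cons : ∀ a y, p (consEquiv K A m (a ⊗ₜ y))) : p x := by
  obtain ⟨t, rfl⟩ := (consEquiv K A m).surjective x
  induction t with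
  | zero => simpa using zero
  | tmul a y => exact cons a y
  | add s t hs ht => simpa using add _ _ hs ht

theorem cons_mul_cons {m : ℕ} (a b : A) (y z : ⨂[K]^m A) :
    consEquiv K A m (a ⊗ₜ y) * consEquiv K A m (b ⊗ₜ z) =
      consEquiv K A m ((a * b) ⊗ₜ (y * z)) := by
  induction y using PiTensorProduct.induction_on with
  | add y y' hy hy' => simp only [TensorProduct.tmul_add, map_add, add_mul, hy, hy']
  | smul_tprod r f =>
    induction z using PiTensorProduct.induction_on with
    | add z z' hz hz' => simp only [TensorProduct.tmul_add, map_add, mul_add, hz, hz']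
    | smul_tprod s g =>
      simp only [TensorProduct.tmul_smul, map_smul, consEquiv_tmul_tprod, smul_mul_assoc,
        mul_smul_comm, PiTensorProduct.tprod_mul_tprod]
      congr 3
      funext i
      refine Fin.cases ?_ (fun j => ?_) i <;> simp

theorem cons_one_one (m : ℕ) : consEquiv K A m (1 ⊗ₜ 1) = 1 := by
  rw [PiTensorProduct.one_def, consEquiv_tmul_tprod, PiTensorProduct.one_def]
  congr 1
  funext i
  refine Fin.cases ?_ (fun j => ?_) i <;> simp

theorem snoc_cons {m : ℕ} (a b : A) (y : ⨂[K]^m A) :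
    snocEquiv K A (m + 1) (consEquiv K A m (b ⊗ₜ y) ⊗ₜ a) =
      consEquiv K A (m + 1) (b ⊗ₜ snocEquiv K A m (y ⊗ₜ a)) := by
  induction y using PiTensorProduct.induction_on with
  | add y y' hy hy' => simp only [TensorProduct.tmul_add, TensorProduct.add_tmul, map_add, hy, hy']
  | smul_tprod r f =>
    simp only [TensorProduct.tmul_smul, ← TensorProduct.smul_tmul', map_smul,
      consEquiv_tmul_tprod, snocEquiv_tprod_tmul, Fin.cons_snoc_eq_snoc_cons]

/-- `A^{⊗ 0}` is one-dimensional. -/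
theorem exists_smul_one (y : ⨂[K]^0 A) : ∃ r : K, y = r • 1 := by
  induction y using PiTensorProduct.induction_on with
  | add y y' hy hy' =>
    obtain ⟨r, rfl⟩ := hy
    obtain ⟨s, rfl⟩ := hy'
    exact ⟨r + s, (add_smul _ _ _).symm⟩
  | smul_tprod r f =>
    refine ⟨r, ?_⟩
    rw [PiTensorProduct.one_def]
    congr 2
    exact Subsingleton.elim _ _

theorem snoc_zero (a : A) (y : ⨂[K]^0 A) :
    snocEquiv K A 0 (y ⊗ₜ a) = consEquiv K A 0 (a ⊗ₜ y) := by
  obtain ⟨r, rfl⟩ := exists_smul_one y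
  simp only [TensorProduct.tmul_smul, ← TensorProduct.smul_tmul', map_smul,
    PiTensorProduct.one_def, consEquiv_tmul_tprod, snocEquiv_tprod_tmul]
  congr 2
  funext i
  refine Fin.cases ?_ (fun j => j.elim0) i
  simp [Fin.snoc]

theorem snoc_induction {m : ℕ} {p : (⨂[K]^(m + 1) A) → Prop} (x : ⨂[K]^(m + 1) A)
    (zero : p 0) (add : ∀ x y, p x → p y → p (x + y))
    (snoc : ∀ y a, p (snocEquiv K A m (y ⊗ₜ a))) : p x := by
  obtain ⟨t, rfl⟩ := (snocEquiv K A m).surjective x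
  induction t with
  | zero => simpa using zero
  | tmul a y => exact snoc a y
  | add s t hs ht => simpa using add _ _ hs ht

theorem snoc_mul_snoc {m : ℕ} (a b : A) (y z : ⨂[K]^m A) :
    snocEquiv K A m (y ⊗ₜ a) * snocEquiv K A m (z ⊗ₜ b) =
      snocEquiv K A m ((y * z) ⊗ₜ (a * b)) := by
  induction m with
  | zero => simp only [snoc_zero, cons_mul_cons]
  | succ m ih =>
    induction y using cons_induction with
    | zero => simp
    | add y y' hy hy' => simp only [TensorProduct.add_tmul, map_add, add_mul, hy, hy']
    | cons c y =>
      induction z using cons_induction with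
      | zero => simp
      | add z z' hz hz' => simp only [TensorProduct.add_tmul, map_add, mul_add, hz, hz']
      | cons d z => simp only [snoc_cons, cons_mul_cons, ih]

theorem mulAt_zero_cons {m : ℕ} (a b : A) (y : ⨂[K]^m A) :
    mulAt K A (m + 1) 0 (consEquiv K A (m + 1) (a ⊗ₜ consEquiv K A m (b ⊗ₜ y))) =
      consEquiv K A m ((a * b) ⊗ₜ y) := by
  simp [mulAt]

theorem mulAt_succ_cons {m : ℕ} (i : Fin m) (a : A) (y : ⨂[K]^(m + 1) A) :
    mulAt K A (m + 1) i.succ (consEquiv K A (m + 1) (a ⊗ₜ y)) =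
      consEquiv K A m (a ⊗ₜ mulAt K A m i y) := by
  simp [mulAt]

/-- `(a ⊗ b) ⊗ y ↦ a ⊗ b ⊗ y` -/
def consTwo (m : ℕ) : (A ⊗[K] A) ⊗[K] (⨂[K]^m A) →ₗ[K] ⨂[K]^(m + 2) A :=
  (consEquiv K A (m + 1)).toLinearMap ∘ₗ (consEquiv K A m).toLinearMap.lTensor A ∘ₗ
    (TensorProduct.assoc K A A (⨂[K]^m A)).toLinearMap

theorem consTwo_tmul {m : ℕ} (a b : A) (y : ⨂[K]^m A) :
    consTwo m ((a ⊗ₜ[K] b) ⊗ₜ y) = consEquiv K A (m + 1) (a ⊗ₜ consEquiv K A m (b ⊗ₜ y)) := by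
  simp [consTwo]

theorem comulAt_zero_cons {m : ℕ} (a : A) (y : ⨂[K]^m A) :
    comulAt K A (m + 1) 0 (consEquiv K A m (a ⊗ₜ y)) =
      consTwo m (Coalgebra.comul a ⊗ₜ y) := by
  simp [comulAt, consTwo]

theorem comulAt_succ_cons {m : ℕ} (i : Fin m) (a : A) (y : ⨂[K]^m A) :
    comulAt K A (m + 1) i.succ (consEquiv K A m (a ⊗ₜ y)) =
      consEquiv K A (m + 1) (a ⊗ₜ comulAt K A m i y) := by
  simp [comulAt]

theorem consTwo_mul {m : ℕ} (u v : A ⊗[K] A) (y z : ⨂[K]^m A) :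
    consTwo m (u ⊗ₜ y) * consTwo m (v ⊗ₜ z) = consTwo m ((u * v) ⊗ₜ (y * z)) := by
  induction u with
  | zero => simp
  | add u u' hu hu' => simp only [TensorProduct.add_tmul, map_add, add_mul, hu, hu']
  | tmul a b =>
    induction v with
    | zero => simp
    | add v v' hv hv' => simp only [TensorProduct.add_tmul, map_add, mul_add, hv, hv']
    | tmul c d =>
      simp only [consTwo_tmul, cons_mul_cons, Algebra.TensorProduct.tmul_mul_tmul]

theorem comulAt_mul {m : ℕ} (i : Fin m) (y z : ⨂[K]^m A) :
    comulAt K A m i (y * z) = comulAt K A m i y * comulAt K A m i z := by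
  induction m with
  | zero => exact i.elim0
  | succ m ih =>
    induction y using cons_induction with
    | zero => simp
    | add y y' hy hy' => simp only [map_add, add_mul, hy, hy']
    | cons a y =>
      induction z using cons_induction with
      | zero => simp
      | add z z' hz hz' => simp only [map_add, mul_add, hz, hz']
      | cons b z =>
        refine Fin.cases ?_ (fun j => ?_) i
        · simp only [comulAt_zero_cons, cons_mul_cons, Bialgebra.comul_mul, consTwo_mul]
        · simp only [comulAt_succ_cons, cons_mul_cons, ih]

theorem iterComul_zero_apply (a : A) :
    iterComul K A 0 a = Coalgebra.counit (R := K) a • 1 := by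
  simp [iterComul, Algebra.algebraMap_eq_smul_one]

theorem iterComul_succ_apply (n : ℕ) (a : A) :
    iterComul K A (n + 1) a =
      consEquiv K A n ((iterComul K A n).lTensor A (Coalgebra.comul a)) := rfl

theorem iterComul_mul (n : ℕ) (a b : A) :
    iterComul K A n (a * b) = iterComul K A n a * iterComul K A n b := by
  induction n generalizing a b with
  | zero => simp [iterComul_zero_apply, smul_smul, mul_comm]
  | succ n ih =>
    have key : ∀ u v : A ⊗[K] A, consEquiv K A n ((iterComul K A n).lTensor A (u * v)) =
        consEquiv K A n ((iterComul K A n).lTensor A u) *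
          consEquiv K A n ((iterComul K A n).lTensor A v) := by
      intro u v
      induction u with
      | zero => simp
      | add u u' hu hu' => simp only [map_add, add_mul, hu, hu']
      | tmul a b =>
        induction v with
        | zero => simp
        | add v v' hv hv' => simp only [map_add, mul_add, hv, hv']
        | tmul c d => simp [cons_mul_cons, ih]
    simp only [iterComul_succ_apply, Bialgebra.comul_mul, key]

theorem iterComul_one (n : ℕ) : iterComul K A n 1 = 1 := by
  induction n with
  | zero => simp [iterComul_zero_apply]
  | succ n ih =>
    simp [iterComul_succ_apply, Bialgebra.comul_one, Algebra.TensorProduct.one_def, ih,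
      cons_one_one]

/-- `Δᵢ ∘ Δⁿ⁻¹ = Δⁿ` -/
theorem comulAt_iterComul {n : ℕ} (i : Fin n) (a : A) :
    comulAt K A n i (iterComul K A n a) = iterComul K A (n + 1) a := by
  induction n generalizing a with
  | zero => exact i.elim0
  | succ n ih =>
    refine Fin.cases ?_ (fun j => ?_) i
    · have h1 : ∀ u : A ⊗[K] A, comulAt K A (n + 1) 0
          (consEquiv K A n ((iterComul K A n).lTensor A u)) =
          consTwo n ((iterComul K A n).lTensor (A ⊗[K] A)
            ((Coalgebra.comul (R := K) (A := A)).rTensor A u)) := by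
        intro u
        induction u with
        | zero => simp
        | add u u' hu hu' => simp only [map_add, hu, hu']
        | tmul a b => simp [comulAt_zero_cons]
      have h2 : ∀ u : A ⊗[K] (A ⊗[K] A), consTwo n ((iterComul K A n).lTensor (A ⊗[K] A)
            ((TensorProduct.assoc K A A A).symm u)) =
          consEquiv K A (n + 1) (((consEquiv K A n).toLinearMap ∘ₗ
            (iterComul K A n).lTensor A).lTensor A u) := by
        intro u
        induction u with
        | zero => simp
        | add u u' hu hu' => simp only [map_add, hu, hu']
        | tmul a u =>
          induction u with
          | zero => simp
          | add u u' hu hu' => simp only [TensorProduct.tmul_add, map_add, hu, hu']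
          | tmul b c => simp [consTwo_tmul]
      rw [iterComul_succ_apply, h1, ← Coalgebra.coassoc_symm_apply, h2, iterComul_succ_apply]
      congr 1
      rw [← LinearMap.comp_apply, ← LinearMap.lTensor_comp]
      rfl
    · have h1 : ∀ u : A ⊗[K] A, comulAt K A (n + 1) j.succ
          (consEquiv K A n ((iterComul K A n).lTensor A u)) =
          consEquiv K A (n + 1) ((iterComul K A (n + 1)).lTensor A u) := by
        intro u
        induction u with
        | zero => simp
        | add u u' hu hu' => simp only [map_add, hu, hu']
        | tmul a b => simp [comulAt_succ_cons, ih]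
      rw [iterComul_succ_apply, h1, ← iterComul_succ_apply]

/-- Iterated comultiplication splits off a last factor as well as a first one. -/
theorem iterComul_succ_eq_snoc (n : ℕ) (a : A) :
    iterComul K A (n + 1) a =
      snocEquiv K A n ((iterComul K A n).rTensor A (Coalgebra.comul a)) := by
  induction n generalizing a with
  | zero =>
    have h1 : ∀ u : A ⊗[K] A, consEquiv K A 0 ((iterComul K A 0).lTensor A u) =
        consEquiv K A 0 (TensorProduct.rid K A
          ((Coalgebra.counit (R := K) (A := A)).lTensor A u) ⊗ₜ 1) := by
      intro u
      induction u with
      | zero => simp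
      | add u u' hu hu' => simp only [map_add, TensorProduct.add_tmul, hu, hu']
      | tmul a b =>
        simp [iterComul_zero_apply, TensorProduct.smul_tmul]
    have h2 : ∀ u : A ⊗[K] A, snocEquiv K A 0 ((iterComul K A 0).rTensor A u) =
        consEquiv K A 0 (TensorProduct.lid K A
          ((Coalgebra.counit (R := K) (A := A)).rTensor A u) ⊗ₜ 1) := by
      intro u
      induction u with
      | zero => simp
      | add u u' hu hu' => simp only [map_add, TensorProduct.add_tmul, hu, hu']
      | tmul a b =>
        simp [iterComul_zero_apply, TensorProduct.smul_tmul, snoc_zero]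
    rw [iterComul_succ_apply, h1, h2, Coalgebra.lTensor_counit_comul,
      Coalgebra.rTensor_counit_comul]
    simp
  | succ n ih =>
    have h1 : ∀ u : A ⊗[K] A, consEquiv K A (n + 1) ((iterComul K A (n + 1)).lTensor A u) =
        consEquiv K A (n + 1) (((snocEquiv K A n).toLinearMap ∘ₗ
          (iterComul K A n).rTensor A).lTensor A
            ((Coalgebra.comul (R := K) (A := A)).lTensor A u)) := by
      intro u
      induction u with
      | zero => simp
      | add u u' hu hu' => simp only [map_add, hu, hu']
      | tmul a b => simp [ih]
    have h2 : ∀ u : (A ⊗[K] A) ⊗[K] A, consEquiv K A (n + 1) (((snocEquiv K A n).toLinearMap ∘ₗ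
          (iterComul K A n).rTensor A).lTensor A (TensorProduct.assoc K A A A u)) =
        snocEquiv K A (n + 1) (((consEquiv K A n).toLinearMap ∘ₗ
          (iterComul K A n).lTensor A).rTensor A u) := by
      intro u
      induction u with
      | zero => simp
      | add u u' hu hu' => simp only [map_add, hu, hu']
      | tmul u c =>
        induction u with
        | zero => simp
        | add u u' hu hu' => simp only [TensorProduct.add_tmul, map_add, hu, hu']
        | tmul a b => simp [snoc_cons]
    rw [iterComul_succ_apply, h1, ← Coalgebra.coassoc_apply, h2]
    congr 1
    rw [← LinearMap.comp_apply, ← LinearMap.rTensor_comp]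
    rfl

end TensorCalculus

/-! ### The coactions of `A` on its tensor powers -/

section Coaction

variable {K A : Type*} [Field K] [CommRing A] [Bialgebra K A]

/-- `(a ⊗ b) ⊗ (c ⊗ y) ↦ a * c ⊗ (b ⊗ y)`; the left coaction satisfies
`ρ (a ⊗ y) = Δ a ⋆ ρ y` for this product `⋆`. -/
def coactionMul (m : ℕ) :
    (A ⊗[K] A) ⊗[K] (A ⊗[K] (⨂[K]^m A)) →ₗ[K] A ⊗[K] (⨂[K]^(m + 1) A) :=
  TensorProduct.map (LinearMap.mul' K A) (consEquiv K A m).toLinearMap ∘ₗ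
    (TensorProduct.tensorTensorTensorComm K A A A (⨂[K]^m A)).toLinearMap

theorem coactionMul_tmul {m : ℕ} (a b c : A) (y : ⨂[K]^m A) :
    coactionMul m ((a ⊗ₜ[K] b) ⊗ₜ (c ⊗ₜ y)) = (a * c) ⊗ₜ consEquiv K A m (b ⊗ₜ y) := by
  simp [coactionMul]

theorem leftCoaction_zero_apply (y : ⨂[K]^0 A) : leftCoaction K A 0 y = 1 ⊗ₜ y := rfl

theorem leftCoaction_cons {m : ℕ} (a : A) (y : ⨂[K]^m A) :
    leftCoaction K A (m + 1) (consEquiv K A m (a ⊗ₜ y)) =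
      coactionMul m (Coalgebra.comul a ⊗ₜ leftCoaction K A m y) := by
  simp [leftCoaction, coactionMul]

/-- A linear map on a tensor product of two tensor products is determined by its values on pure
tensors. -/
theorem ext_four {B C D E M : Type*} [AddCommMonoid B] [AddCommMonoid C] [AddCommMonoid D]
    [AddCommMonoid E] [AddCommMonoid M] [Module K B] [Module K C] [Module K D] [Module K E]
    [Module K M] {f g : (B ⊗[K] C) ⊗[K] (D ⊗[K] E) →ₗ[K] M}
    (h : ∀ b c d e, f ((b ⊗ₜ c) ⊗ₜ (d ⊗ₜ e)) = g ((b ⊗ₜ c) ⊗ₜ (d ⊗ₜ e))) : f = g := by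
  ext b c d e
  exact h b c d e

theorem leftCoaction_mulAt {m : ℕ} (i : Fin m) (y : ⨂[K]^(m + 1) A) :
    leftCoaction K A m (mulAt K A m i y) =
      (mulAt K A m i).lTensor A (leftCoaction K A (m + 1) y) := by
  induction m with
  | zero => exact i.elim0
  | succ m ih =>
    induction y using cons_induction with
    | zero => simp
    | add y y' hy hy' => simp only [map_add, hy, hy']
    | cons a y =>
      refine Fin.cases ?_ (fun j => ?_) i
      · induction y using cons_induction with
        | zero => simp
        | add y y' hy hy' => simp only [TensorProduct.tmul_add, map_add, hy, hy']
        | cons b y =>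
          rw [mulAt_zero_cons]
          simp only [leftCoaction_cons, Bialgebra.comul_mul]
          generalize leftCoaction K A m y = w
          generalize (Coalgebra.comul b : A ⊗[K] A) = v
          generalize (Coalgebra.comul a : A ⊗[K] A) = u
          induction u with
          | zero => simp
          | add u u' hu hu' => simp only [add_mul, TensorProduct.add_tmul, map_add, hu, hu']
          | tmul a b =>
            induction v with
            | zero => simp
            | add v v' hv hv' =>
              simp only [mul_add, TensorProduct.add_tmul, TensorProduct.tmul_add, map_add, hv, hv']
            | tmul c d =>
              induction w with
              | zero => simp
              | add w w' hw hw' => simp only [TensorProduct.tmul_add, map_add, hw, hw']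
              | tmul e y =>
                simp [coactionMul_tmul, mulAt_zero_cons, mul_assoc]
      · rw [mulAt_succ_cons, leftCoaction_cons, leftCoaction_cons, ih]
        have : coactionMul m ∘ₗ ((mulAt K A m j).lTensor A).lTensor (A ⊗[K] A) =
            (mulAt K A (m + 1) j.succ).lTensor A ∘ₗ coactionMul (m + 1) := by
          apply ext_four
          intro b c d e
          simp [coactionMul_tmul, mulAt_succ_cons]
        exact LinearMap.congr_fun this (Coalgebra.comul a ⊗ₜ leftCoaction K A (m + 1) y)

set_option maxHeartbeats 1000000 in
set_option synthInstance.maxHeartbeats 200000 in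
/-- The left coaction is coassociative. -/
theorem leftCoaction_coassoc {m : ℕ} (y : ⨂[K]^m A) :
    TensorProduct.assoc K A A (⨂[K]^m A)
        ((Coalgebra.comul (R := K) (A := A)).rTensor _ (leftCoaction K A m y)) =
      (leftCoaction K A m).lTensor A (leftCoaction K A m y) := by
  induction m with
  | zero =>
    simp [leftCoaction_zero_apply, Bialgebra.comul_one, Algebra.TensorProduct.one_def]
  | succ m ih =>
    induction y using cons_induction with
    | zero => simp
    | add y y' hy hy' => simp only [map_add, hy, hy']
    | cons a y =>
      -- Both sides are `Δ⁽²⁾ a ⋆ ρ⁽²⁾ y` for the evident product of triple tensors.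
      let star3 : (A ⊗[K] (A ⊗[K] A)) ⊗[K] (A ⊗[K] (A ⊗[K] (⨂[K]^m A))) →ₗ[K]
          A ⊗[K] (A ⊗[K] (⨂[K]^(m + 1) A)) :=
        TensorProduct.map (LinearMap.mul' K A) (coactionMul m) ∘ₗ
          (TensorProduct.tensorTensorTensorComm K A (A ⊗[K] A) A (A ⊗[K] (⨂[K]^m A))).toLinearMap
      have h1 : (TensorProduct.assoc K A A (⨂[K]^(m + 1) A)).toLinearMap ∘ₗ
          (Coalgebra.comul (R := K) (A := A)).rTensor _ ∘ₗ coactionMul m =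
          star3 ∘ₗ TensorProduct.map
            ((TensorProduct.assoc K A A A).toLinearMap ∘ₗ
              (Coalgebra.comul (R := K) (A := A)).rTensor _)
            ((TensorProduct.assoc K A A _).toLinearMap ∘ₗ
              (Coalgebra.comul (R := K) (A := A)).rTensor _) := by
        apply ext_four
        intro a b c y
        simp only [LinearMap.comp_apply, coactionMul_tmul, LinearMap.rTensor_tmul,
          Bialgebra.comul_mul, TensorProduct.map_tmul]
        generalize (Coalgebra.comul a : A ⊗[K] A) = u
        generalize (Coalgebra.comul c : A ⊗[K] A) = v
        induction u with
        | zero => simp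
        | add u u' hu hu' => simp only [add_mul, TensorProduct.add_tmul, map_add, hu, hu']
        | tmul a b =>
          induction v with
          | zero => simp
          | add v v' hv hv' =>
            simp only [mul_add, TensorProduct.add_tmul, TensorProduct.tmul_add, map_add, hv, hv']
          | tmul c d => simp [star3, coactionMul_tmul]
      have h2 : (leftCoaction K A (m + 1)).lTensor A ∘ₗ coactionMul m =
          star3 ∘ₗ TensorProduct.map ((Coalgebra.comul (R := K) (A := A)).lTensor A)
            ((leftCoaction K A m).lTensor A) := by
        apply ext_four
        intro a b c y
        simp [star3, coactionMul_tmul, leftCoaction_cons]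
      rw [leftCoaction_cons]
      have e1 := LinearMap.congr_fun h1 (Coalgebra.comul a ⊗ₜ leftCoaction K A m y)
      have e2 := LinearMap.congr_fun h2 (Coalgebra.comul a ⊗ₜ leftCoaction K A m y)
      simp only [LinearMap.comp_apply, TensorProduct.map_tmul, LinearEquiv.coe_coe] at e1 e2
      rw [e1, e2, ih, Coalgebra.coassoc_apply]

theorem leftCoaction_counit {m : ℕ} (y : ⨂[K]^m A) :
    (Coalgebra.counit (R := K) (A := A)).rTensor _ (leftCoaction K A m y) = 1 ⊗ₜ y := by
  induction m with
  | zero => simp [leftCoaction_zero_apply]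
  | succ m ih =>
    induction y using cons_induction with
    | zero => simp
    | add y y' hy hy' => simp only [map_add, TensorProduct.tmul_add, hy, hy']
    | cons a y =>
      have h1 : (Coalgebra.counit (R := K) (A := A)).rTensor _ ∘ₗ coactionMul m =
          TensorProduct.map (LinearMap.mul' K K) (consEquiv K A m).toLinearMap ∘ₗ
            (TensorProduct.tensorTensorTensorComm K K A K (⨂[K]^m A)).toLinearMap ∘ₗ
            TensorProduct.map ((Coalgebra.counit (R := K) (A := A)).rTensor _)
              ((Coalgebra.counit (R := K) (A := A)).rTensor _) := by
        apply ext_four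
        intro a b c y
        simp [coactionMul_tmul]
      have e1 := LinearMap.congr_fun h1 (Coalgebra.comul a ⊗ₜ leftCoaction K A m y)
      rw [leftCoaction_cons]
      simp only [LinearMap.comp_apply, TensorProduct.map_tmul] at e1
      rw [e1, ih, Coalgebra.rTensor_counit_comul]
      simp

/-- `(c ⊗ y) ⊗ (a ⊗ b) ↦ c * a ⊗ (y ⊗ b)`, the analogue of `coactionMul` for a new last
factor. -/
def snocCoactionMul (m : ℕ) :
    (A ⊗[K] (⨂[K]^m A)) ⊗[K] (A ⊗[K] A) →ₗ[K] A ⊗[K] (⨂[K]^(m + 1) A) :=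
  TensorProduct.map (LinearMap.mul' K A) (snocEquiv K A m).toLinearMap ∘ₗ
    (TensorProduct.tensorTensorTensorComm K A (⨂[K]^m A) A A).toLinearMap

theorem snocCoactionMul_tmul {m : ℕ} (a b c : A) (y : ⨂[K]^m A) :
    snocCoactionMul m ((c ⊗ₜ y) ⊗ₜ (a ⊗ₜ[K] b)) = (c * a) ⊗ₜ snocEquiv K A m (y ⊗ₜ b) := by
  simp [snocCoactionMul]

theorem leftCoaction_snoc {m : ℕ} (y : ⨂[K]^m A) (a : A) :
    leftCoaction K A (m + 1) (snocEquiv K A m (y ⊗ₜ a)) =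
      snocCoactionMul m (leftCoaction K A m y ⊗ₜ Coalgebra.comul a) := by
  induction m with
  | zero =>
    rw [snoc_zero, leftCoaction_cons, leftCoaction_zero_apply]
    generalize (Coalgebra.comul a : A ⊗[K] A) = u
    induction u with
    | zero => simp only [TensorProduct.zero_tmul, TensorProduct.tmul_zero, map_zero]
    | add u u' hu hu' =>
      simp only [TensorProduct.add_tmul, TensorProduct.tmul_add, map_add, hu, hu']
    | tmul a b => simp only [coactionMul_tmul, snocCoactionMul_tmul, snoc_zero, mul_one, one_mul]
  | succ m ih =>
    induction y using cons_induction with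
    | zero => simp only [TensorProduct.zero_tmul, map_zero]
    | add y y' hy hy' => simp only [TensorProduct.add_tmul, map_add, hy, hy']
    | cons b y =>
      rw [snoc_cons, leftCoaction_cons, ih, leftCoaction_cons]
      generalize (Coalgebra.comul a : A ⊗[K] A) = u
      generalize (Coalgebra.comul b : A ⊗[K] A) = v
      generalize leftCoaction K A m y = w
      induction u with
      | zero => simp only [TensorProduct.tmul_zero, map_zero]
      | add u u' hu hu' => simp only [TensorProduct.tmul_add, map_add, hu, hu']
      | tmul a b =>
        induction v with
        | zero => simp only [TensorProduct.zero_tmul, map_zero]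
        | add v v' hv hv' => simp only [TensorProduct.add_tmul, map_add, hv, hv']
        | tmul c d =>
          induction w with
          | zero => simp only [TensorProduct.zero_tmul, TensorProduct.tmul_zero, map_zero]
          | add w w' hw hw' =>
            simp only [TensorProduct.add_tmul, TensorProduct.tmul_add, map_add, hw, hw']
          | tmul e y =>
            simp only [coactionMul_tmul, snocCoactionMul_tmul, snoc_cons, mul_assoc]

/-- By cocommutativity the right coaction is the flip of the left coaction. -/
theorem rightCoaction_eq [Coalgebra.IsCocomm K A] {m : ℕ} (y : ⨂[K]^m A) :
    rightCoaction K A m y = TensorProduct.comm K A (⨂[K]^m A) (leftCoaction K A m y) := by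
  induction m with
  | zero => simp [rightCoaction, leftCoaction_zero_apply]
  | succ m ih =>
    induction y using cons_induction with
    | zero => simp
    | add y y' hy hy' => simp only [map_add, hy, hy']
    | cons a y =>
      have h1 : rightCoaction K A (m + 1) (consEquiv K A m (a ⊗ₜ y)) =
          TensorProduct.map (consEquiv K A m).toLinearMap (LinearMap.mul' K A)
            (TensorProduct.tensorTensorTensorComm K A A (⨂[K]^m A) A
              (Coalgebra.comul a ⊗ₜ rightCoaction K A m y)) := by
        simp [rightCoaction]
      have h2 : TensorProduct.map (consEquiv K A m).toLinearMap (LinearMap.mul' K A) ∘ₗ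
            (TensorProduct.tensorTensorTensorComm K A A (⨂[K]^m A) A).toLinearMap ∘ₗ
            TensorProduct.map (TensorProduct.comm K A A).toLinearMap
              (TensorProduct.comm K A (⨂[K]^m A)).toLinearMap =
          (TensorProduct.comm K A (⨂[K]^(m + 1) A)).toLinearMap ∘ₗ coactionMul m := by
        apply ext_four
        intro a b c y
        simp [coactionMul_tmul]
      rw [h1, ih, ← Coalgebra.comm_comul K a, leftCoaction_cons]
      simpa [Coalgebra.comm_comul] using
        LinearMap.congr_fun h2 (Coalgebra.comul a ⊗ₜ leftCoaction K A m y)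

end Coaction

/-! ### Twisting the double complex into `Hom` of bar into cobar -/

section Twist

variable {K A : Type*} [Field K] [CommRing A] [Bialgebra K A]
variable {B : Type*} [CommRing B] [Algebra K B]

/-- The twist of `f : A^{⊗ m} → B` by a linear map `g : A → B`:
`a₁ ⊗ ⋯ ⊗ aₘ ↦ g (a₁⁽¹⁾ * ⋯ * aₘ⁽¹⁾) * f (a₁⁽²⁾ ⊗ ⋯ ⊗ aₘ⁽²⁾)`. -/
def twist (m : ℕ) (g : A →ₗ[K] B) :
    ((⨂[K]^m A) →ₗ[K] B) →ₗ[K] ((⨂[K]^m A) →ₗ[K] B) where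
  toFun f := LinearMap.mul' K B ∘ₗ TensorProduct.map g f ∘ₗ leftCoaction K A m
  map_add' f f' := by
    simp only [TensorProduct.map_add_right, LinearMap.add_comp, LinearMap.comp_add]
  map_smul' c f := by
    simp only [TensorProduct.map_smul_right, LinearMap.smul_comp, LinearMap.comp_smul,
      RingHom.id_apply]

theorem twist_apply {m : ℕ} (g : A →ₗ[K] B) (f : (⨂[K]^m A) →ₗ[K] B) (y : ⨂[K]^m A) :
    twist m g f y = LinearMap.mul' K B (TensorProduct.map g f (leftCoaction K A m y)) := rfl

/-- The coaction turns convolution of the twisting maps into composition of the twists. -/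
theorem twist_twist {m : ℕ} (g h : A →ₗ[K] B) (f : (⨂[K]^m A) →ₗ[K] B) :
    twist m g (twist m h f) =
      twist m (LinearMap.mul' K B ∘ₗ TensorProduct.map g h ∘ₗ Coalgebra.comul) f := by
  refine LinearMap.ext fun y => ?_
  have h1 : TensorProduct.map g (twist m h f) =
      TensorProduct.map g (LinearMap.mul' K B ∘ₗ TensorProduct.map h f) ∘ₗ
        (leftCoaction K A m).lTensor A := by
    apply TensorProduct.ext'
    intro a y
    simp [twist_apply]
  have h2 : TensorProduct.map
        (LinearMap.mul' K B ∘ₗ TensorProduct.map g h ∘ₗ Coalgebra.comul) f =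
      TensorProduct.map (LinearMap.mul' K B ∘ₗ TensorProduct.map g h) f ∘ₗ
        (Coalgebra.comul (R := K) (A := A)).rTensor _ := by
    apply TensorProduct.ext'
    intro a y
    simp
  have h3 : LinearMap.mul' K B ∘ₗ
        TensorProduct.map g (LinearMap.mul' K B ∘ₗ TensorProduct.map h f) ∘ₗ
        (TensorProduct.assoc K A A (⨂[K]^m A)).toLinearMap =
      LinearMap.mul' K B ∘ₗ TensorProduct.map (LinearMap.mul' K B ∘ₗ TensorProduct.map g h) f := by
    apply TensorProduct.ext_threefold
    intro a b y
    simp [mul_assoc]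
  have h4 := LinearMap.congr_fun h3
    ((Coalgebra.comul (R := K) (A := A)).rTensor _ (leftCoaction K A m y))
  simp only [LinearMap.comp_apply, LinearEquiv.coe_coe] at h4
  rw [leftCoaction_coassoc] at h4
  simp only [twist_apply, h1, h2, LinearMap.comp_apply, h4]

theorem twist_counit {m : ℕ} (f : (⨂[K]^m A) →ₗ[K] B) :
    twist m (Algebra.linearMap K B ∘ₗ Coalgebra.counit) f = f := by
  refine LinearMap.ext fun y => ?_
  have h1 : TensorProduct.map (Algebra.linearMap K B ∘ₗ Coalgebra.counit) f =
      TensorProduct.map (Algebra.linearMap K B) f ∘ₗ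
        (Coalgebra.counit (R := K) (A := A)).rTensor _ := by
    apply TensorProduct.ext'
    intro a y
    simp
  rw [twist_apply, h1, LinearMap.comp_apply, leftCoaction_counit]
  simp

/-- The face `a ⊗ y ↦ ε(a) y` of the bar complex with trivial coefficients. -/
def augFirst (m : ℕ) : (⨂[K]^(m + 1) A) →ₗ[K] ⨂[K]^m A :=
  (TensorProduct.lid K (⨂[K]^m A)).toLinearMap ∘ₗ
    (Coalgebra.counit (R := K) (A := A)).rTensor _ ∘ₗ (consEquiv K A m).symm.toLinearMap

/-- The face `y ⊗ a ↦ ε(a) y` of the bar complex with trivial coefficients. -/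
def augLast (m : ℕ) : (⨂[K]^(m + 1) A) →ₗ[K] ⨂[K]^m A :=
  (TensorProduct.rid K (⨂[K]^m A)).toLinearMap ∘ₗ
    (Coalgebra.counit (R := K) (A := A)).lTensor _ ∘ₗ (snocEquiv K A m).symm.toLinearMap

theorem augFirst_cons {m : ℕ} (a : A) (y : ⨂[K]^m A) :
    augFirst m (consEquiv K A m (a ⊗ₜ y)) = Coalgebra.counit (R := K) a • y := by
  simp [augFirst]

theorem augLast_snoc {m : ℕ} (a : A) (y : ⨂[K]^m A) :
    augLast m (snocEquiv K A m (y ⊗ₜ a)) = Coalgebra.counit (R := K) a • y := by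
  simp [augLast]

theorem twist_augFirst {m : ℕ} {g : A →ₗ[K] B} (hg : ∀ a b, g (a * b) = g a * g b)
    (f : (⨂[K]^m A) →ₗ[K] B) (a : A) (y : ⨂[K]^m A) :
    twist (m + 1) g (f ∘ₗ augFirst m) (consEquiv K A m (a ⊗ₜ y)) = g a * twist m g f y := by
  have key : ∀ (u : A ⊗[K] A) (w : A ⊗[K] (⨂[K]^m A)),
      LinearMap.mul' K B (TensorProduct.map g (f ∘ₗ augFirst m) (coactionMul m (u ⊗ₜ w))) =
        g (TensorProduct.rid K A ((Coalgebra.counit (R := K) (A := A)).lTensor A u)) *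
          LinearMap.mul' K B (TensorProduct.map g f w) := by
    intro u w
    induction u with
    | zero => simp
    | add u u' hu hu' => simp only [TensorProduct.add_tmul, map_add, add_mul, hu, hu']
    | tmul b c =>
      induction w with
      | zero => simp
      | add w w' hw hw' => simp only [TensorProduct.tmul_add, map_add, mul_add, hw, hw']
      | tmul d y => simp [coactionMul_tmul, augFirst_cons, hg, mul_assoc]
  rw [twist_apply, leftCoaction_cons, key, Coalgebra.lTensor_counit_comul, twist_apply]
  simp

theorem twist_augLast {m : ℕ} {g : A →ₗ[K] B} (hg : ∀ a b, g (a * b) = g a * g b)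
    (f : (⨂[K]^m A) →ₗ[K] B) (y : ⨂[K]^m A) (a : A) :
    twist (m + 1) g (f ∘ₗ augLast m) (snocEquiv K A m (y ⊗ₜ a)) = twist m g f y * g a := by
  have key : ∀ (u : A ⊗[K] A) (w : A ⊗[K] (⨂[K]^m A)),
      LinearMap.mul' K B (TensorProduct.map g (f ∘ₗ augLast m) (snocCoactionMul m (w ⊗ₜ u))) =
        LinearMap.mul' K B (TensorProduct.map g f w) *
          g (TensorProduct.rid K A ((Coalgebra.counit (R := K) (A := A)).lTensor A u)) := by
    intro u w
    induction u with
    | zero => simp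
    | add u u' hu hu' => simp only [TensorProduct.tmul_add, map_add, mul_add, hu, hu']
    | tmul b c =>
      induction w with
      | zero => simp
      | add w w' hw hw' => simp only [TensorProduct.add_tmul, map_add, add_mul, hw, hw']
      | tmul d y =>
        simp [snocCoactionMul_tmul, augLast_snoc, hg, mul_assoc, mul_comm (g b)]
  rw [twist_apply, leftCoaction_snoc, key, Coalgebra.lTensor_counit_comul, twist_apply]
  simp

theorem twist_comp_mulAt {m : ℕ} (i : Fin m) (g : A →ₗ[K] B) (f : (⨂[K]^m A) →ₗ[K] B) :
    twist (m + 1) g (f ∘ₗ mulAt K A m i) = twist m g f ∘ₗ mulAt K A m i := by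
  refine LinearMap.ext fun y => ?_
  have h1 : TensorProduct.map g (f ∘ₗ mulAt K A m i) =
      TensorProduct.map g f ∘ₗ (mulAt K A m i).lTensor A := by
    apply TensorProduct.ext'
    intro a y
    simp
  rw [LinearMap.comp_apply, twist_apply, twist_apply, leftCoaction_mulAt, h1,
    LinearMap.comp_apply]

/-- The signed sum of all faces of the bar complex but `augFirst`. With `A^{⊗ (m+1)}` read as
the free left `A`-module `A ⊗ A^{⊗ m}`, it is the differential of the bar resolution of the trivial
module `K`, augmented by `barRes 0`. -/
def barRes (m : ℕ) : (⨂[K]^(m + 1) A) →ₗ[K] ⨂[K]^m A :=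
  ∑ i : Fin m, (-1 : K) ^ (i : ℕ) • mulAt K A m i + (-1 : K) ^ m • augLast m

/-- The differential of the bar complex of `A` with trivial coefficients on both sides. -/
def bar (m : ℕ) : (⨂[K]^(m + 1) A) →ₗ[K] ⨂[K]^m A := augFirst m - barRes m

/-- The signed sum of all cofaces of the cobar complex but `consOne`. With `A^{⊗ (n+1)}` read as
the cofree left comodule `A ⊗ A^{⊗ n}`, it is the differential of the cobar resolution of the
trivial comodule `K`, coaugmented by `cobarRes 0`. -/
def cobarRes (n : ℕ) : (⨂[K]^n A) →ₗ[K] ⨂[K]^(n + 1) A :=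
  ∑ i : Fin n, (-1 : K) ^ (i : ℕ) • comulAt K A n i +
    (-1 : K) ^ n • ((snocEquiv K A n).toLinearMap ∘ₗ (TensorProduct.mk K _ A).flip 1)

/-- The coface `y ↦ 1 ⊗ y`. -/
def consOne (n : ℕ) : (⨂[K]^n A) →ₗ[K] ⨂[K]^(n + 1) A :=
  (consEquiv K A n).toLinearMap ∘ₗ TensorProduct.mk K A _ 1

theorem consOne_apply {n : ℕ} (y : ⨂[K]^n A) : consOne n y = consEquiv K A n (1 ⊗ₜ y) := rfl

/-- The differential of the cobar complex of `A` with trivial coefficients on both sides. -/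
def cobar (n : ℕ) : (⨂[K]^n A) →ₗ[K] ⨂[K]^(n + 1) A := consOne n - cobarRes n

/-- Twisting by the iterated comultiplication removes the outer actions of `A` from `d₁`: what
remains is precomposition with the bar differential with trivial coefficients. -/
theorem d₁_twist {m n : ℕ} (f : (⨂[K]^m A) →ₗ[K] ⨂[K]^n A) :
    d₁ K A m n (twist m (iterComul K A n) f) = twist (m + 1) (iterComul K A n) (f ∘ₗ bar m) := by
  have hg := iterComul_mul (K := K) (A := A) n
  have h1 : LinearMap.mul' K (⨂[K]^n A) ∘ₗ
      TensorProduct.map (iterComul K A n) (twist m (iterComul K A n) f) ∘ₗ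
        (consEquiv K A m).symm.toLinearMap =
      twist (m + 1) (iterComul K A n) (f ∘ₗ augFirst m) := by
    apply hom_ext_cons
    intro a y
    rw [twist_augFirst hg]
    simp
  have h2 : LinearMap.mul' K (⨂[K]^n A) ∘ₗ
      TensorProduct.map (twist m (iterComul K A n) f) (iterComul K A n) ∘ₗ
        (snocEquiv K A m).symm.toLinearMap =
      twist (m + 1) (iterComul K A n) (f ∘ₗ augLast m) := by
    refine LinearMap.ext fun y => ?_
    induction y using snoc_induction with
    | zero => simp only [map_zero]
    | add y y' hy hy' => simp only [map_add, hy, hy']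
    | snoc y a =>
      rw [twist_augLast hg]
      simp
  have h3 : f ∘ₗ bar m = f ∘ₗ augFirst m +
      ∑ i : Fin m, (-1 : K) ^ ((i : ℕ) + 1) • (f ∘ₗ mulAt K A m i) +
      (-1 : K) ^ (m + 1) • (f ∘ₗ augLast m) := by
    refine LinearMap.ext fun y => ?_
    simp only [bar, barRes, LinearMap.comp_apply, LinearMap.sub_apply, LinearMap.add_apply,
      LinearMap.sum_apply, LinearMap.smul_apply, map_sub, map_add, map_sum, map_smul, pow_succ,
      mul_neg, mul_one, neg_smul, Finset.sum_neg_distrib]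
    abel
  rw [h3]
  simp only [map_add, map_sum, map_smul, twist_comp_mulAt, ← h1, ← h2]
  rfl

/-- Twisting by the iterated comultiplication removes the outer coactions of `A` from `d₂`. Here
cocommutativity enters: it makes the right coaction agree with the left one. -/
theorem d₂_twist [Coalgebra.IsCocomm K A] {m n : ℕ} (f : (⨂[K]^m A) →ₗ[K] ⨂[K]^n A) :
    d₂ K A m n (twist m (iterComul K A n) f) =
      twist m (iterComul K A (n + 1)) (cobar n ∘ₗ f) := by
  have h1 : (consEquiv K A n).toLinearMap ∘ₗ
      (twist m (iterComul K A n) f).lTensor A ∘ₗ leftCoaction K A m =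
      twist m (iterComul K A (n + 1)) (consOne n ∘ₗ f) := by
    refine LinearMap.ext fun y => ?_
    have e1 : (twist m (iterComul K A n) f).lTensor A =
        (LinearMap.mul' K _ ∘ₗ TensorProduct.map (iterComul K A n) f).lTensor A ∘ₗ
          (leftCoaction K A m).lTensor A := by
      apply TensorProduct.ext'
      intro a y
      simp [twist_apply]
    have e2 : (consEquiv K A n).toLinearMap ∘ₗ
        (LinearMap.mul' K _ ∘ₗ TensorProduct.map (iterComul K A n) f).lTensor A ∘ₗ
        (TensorProduct.assoc K A A (⨂[K]^m A)).toLinearMap =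
        LinearMap.mul' K _ ∘ₗ TensorProduct.map ((consEquiv K A n).toLinearMap ∘ₗ
          (iterComul K A n).lTensor A) (consOne n ∘ₗ f) := by
      apply TensorProduct.ext_threefold
      intro a b y
      simp [consOne_apply, cons_mul_cons]
    have e3 : TensorProduct.map (iterComul K A (n + 1)) (consOne n ∘ₗ f) =
        TensorProduct.map ((consEquiv K A n).toLinearMap ∘ₗ
          (iterComul K A n).lTensor A) (consOne n ∘ₗ f) ∘ₗ
          (Coalgebra.comul (R := K) (A := A)).rTensor _ := by
      apply TensorProduct.ext'
      intro a y
      simp [iterComul_succ_apply]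
    have e4 := LinearMap.congr_fun e2
      ((Coalgebra.comul (R := K) (A := A)).rTensor _ (leftCoaction K A m y))
    simp only [LinearMap.comp_apply, LinearEquiv.coe_coe] at e4
    rw [leftCoaction_coassoc] at e4
    simp only [twist_apply, e1, e3, LinearMap.comp_apply, LinearEquiv.coe_coe, e4]
  have h2 : (snocEquiv K A n).toLinearMap ∘ₗ
      (twist m (iterComul K A n) f).rTensor A ∘ₗ rightCoaction K A m =
      twist m (iterComul K A (n + 1))
        (((snocEquiv K A n).toLinearMap ∘ₗ (TensorProduct.mk K _ A).flip 1) ∘ₗ f) := by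
    refine LinearMap.ext fun y => ?_
    have e1 : (twist m (iterComul K A n) f).rTensor A ∘ₗ
          (TensorProduct.comm K A (⨂[K]^m A)).toLinearMap =
        (TensorProduct.comm K A (⨂[K]^n A)).toLinearMap ∘ₗ
        (LinearMap.mul' K _ ∘ₗ TensorProduct.map (iterComul K A n) f).lTensor A ∘ₗ
          (leftCoaction K A m).lTensor A := by
      apply TensorProduct.ext'
      intro a y
      simp [twist_apply]
    have e2 : (snocEquiv K A n).toLinearMap ∘ₗ (TensorProduct.comm K A (⨂[K]^n A)).toLinearMap ∘ₗ
        (LinearMap.mul' K _ ∘ₗ TensorProduct.map (iterComul K A n) f).lTensor A ∘ₗ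
        (TensorProduct.assoc K A A (⨂[K]^m A)).toLinearMap =
        LinearMap.mul' K _ ∘ₗ TensorProduct.map ((snocEquiv K A n).toLinearMap ∘ₗ
          (iterComul K A n).rTensor A ∘ₗ (TensorProduct.comm K A A).toLinearMap)
          (((snocEquiv K A n).toLinearMap ∘ₗ (TensorProduct.mk K _ A).flip 1) ∘ₗ f) := by
      apply TensorProduct.ext_threefold
      intro a b y
      simp [snoc_mul_snoc]
    have e3 : TensorProduct.map (iterComul K A (n + 1))
          (((snocEquiv K A n).toLinearMap ∘ₗ (TensorProduct.mk K _ A).flip 1) ∘ₗ f) =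
        TensorProduct.map ((snocEquiv K A n).toLinearMap ∘ₗ
          (iterComul K A n).rTensor A ∘ₗ (TensorProduct.comm K A A).toLinearMap)
          (((snocEquiv K A n).toLinearMap ∘ₗ (TensorProduct.mk K _ A).flip 1) ∘ₗ f) ∘ₗ
          (Coalgebra.comul (R := K) (A := A)).rTensor _ := by
      apply TensorProduct.ext'
      intro a y
      simp [iterComul_succ_eq_snoc]
    have e4 := LinearMap.congr_fun e2
      ((Coalgebra.comul (R := K) (A := A)).rTensor _ (leftCoaction K A m y))
    simp only [LinearMap.comp_apply, LinearEquiv.coe_coe] at e4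
    rw [leftCoaction_coassoc] at e4
    have e5 := LinearMap.congr_fun e1 (leftCoaction K A m y)
    simp only [LinearMap.comp_apply, LinearEquiv.coe_coe] at e5
    rw [LinearMap.comp_apply, LinearMap.comp_apply, rightCoaction_eq, e5]
    rw [twist_apply, e3, LinearMap.comp_apply, ← e4]
    rfl
  have h3 : ∀ i : Fin n, comulAt K A n i ∘ₗ twist m (iterComul K A n) f =
      twist m (iterComul K A (n + 1)) (comulAt K A n i ∘ₗ f) := by
    intro i
    have e1 : comulAt K A n i ∘ₗ LinearMap.mul' K _ ∘ₗ TensorProduct.map (iterComul K A n) f =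
        LinearMap.mul' K _ ∘ₗ
          TensorProduct.map (iterComul K A (n + 1)) (comulAt K A n i ∘ₗ f) := by
      apply TensorProduct.ext'
      intro a y
      simp [comulAt_mul, comulAt_iterComul]
    refine LinearMap.ext fun y => ?_
    exact LinearMap.congr_fun e1 (leftCoaction K A m y)
  have h4 : cobar n ∘ₗ f = consOne n ∘ₗ f +
      ∑ i : Fin n, (-1 : K) ^ ((i : ℕ) + 1) • (comulAt K A n i ∘ₗ f) +
      (-1 : K) ^ (n + 1) •
        (((snocEquiv K A n).toLinearMap ∘ₗ (TensorProduct.mk K _ A).flip 1) ∘ₗ f) := by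
    refine LinearMap.ext fun y => ?_
    simp only [cobar, cobarRes, LinearMap.comp_apply, LinearMap.sub_apply, LinearMap.add_apply,
      LinearMap.sum_apply, LinearMap.smul_apply, pow_succ,
      mul_neg, mul_one, neg_smul, Finset.sum_neg_distrib]
    abel
  rw [h4]
  simp only [map_add, map_sum, map_smul, ← h1, ← h2, ← h3]
  rfl

/-- Twisting by the convolution inverse `g ∘ S` of an algebra map `g` undoes twisting by `g`. -/
theorem twist_twist_of_antipode [Coalgebra.IsCocomm K A] {m : ℕ} (S : A →ₗ[K] A)
    (hS : ∀ a, LinearMap.mul' K A (S.lTensor A (Coalgebra.comul a)) =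
      algebraMap K A (Coalgebra.counit a))
    {g : A →ₗ[K] B} (hg : ∀ a b, g (a * b) = g a * g b) (hg1 : g 1 = 1)
    (f : (⨂[K]^m A) →ₗ[K] B) :
    twist m g (twist m (g ∘ₗ S) f) = f ∧ twist m (g ∘ₗ S) (twist m g f) = f := by
  have h1 : LinearMap.mul' K B ∘ₗ TensorProduct.map g (g ∘ₗ S) ∘ₗ Coalgebra.comul =
      Algebra.linearMap K B ∘ₗ Coalgebra.counit := by
    have e : LinearMap.mul' K B ∘ₗ TensorProduct.map g (g ∘ₗ S) =
        g ∘ₗ LinearMap.mul' K A ∘ₗ S.lTensor A := by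
      apply TensorProduct.ext'
      intro a b
      simp [hg]
    refine LinearMap.ext fun a => ?_
    have := LinearMap.congr_fun e (Coalgebra.comul a)
    simp only [LinearMap.comp_apply] at this ⊢
    rw [this, hS, Algebra.algebraMap_eq_smul_one, map_smul, hg1, Algebra.linearMap_apply,
      Algebra.algebraMap_eq_smul_one]
  have h2 : LinearMap.mul' K B ∘ₗ TensorProduct.map (g ∘ₗ S) g ∘ₗ Coalgebra.comul =
      Algebra.linearMap K B ∘ₗ Coalgebra.counit := by
    have e : TensorProduct.map (g ∘ₗ S) g ∘ₗ (TensorProduct.comm K A A).toLinearMap =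
        (TensorProduct.comm K B B).toLinearMap ∘ₗ TensorProduct.map g (g ∘ₗ S) := by
      apply TensorProduct.ext'
      intro a b
      simp
    have e' : LinearMap.mul' K B ∘ₗ (TensorProduct.comm K B B).toLinearMap =
        LinearMap.mul' K B := by
      apply TensorProduct.ext'
      intro a b
      simp [mul_comm]
    rw [← h1]
    refine LinearMap.ext fun a => ?_
    have e1 := LinearMap.congr_fun e (Coalgebra.comul a)
    have e2 := LinearMap.congr_fun e' (TensorProduct.map g (g ∘ₗ S) (Coalgebra.comul a))
    simp only [LinearMap.comp_apply, LinearEquiv.coe_coe, Coalgebra.comm_comul] at e1 e2 ⊢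
    rw [e1, e2]
  exact ⟨by rw [twist_twist, h1, twist_counit], by rw [twist_twist, h2, twist_counit]⟩

end Twist

/-! ### Null-homotopies on the bar and cobar resolutions -/

section Resolutions

variable {K A : Type*} [Field K] [CommRing A] [Bialgebra K A]

/-- The map `id ⊗ f` on `A^{⊗ (m+1)} = A ⊗ A^{⊗ m}`. -/
def restMap {m n : ℕ} (f : (⨂[K]^m A) →ₗ[K] ⨂[K]^n A) :
    (⨂[K]^(m + 1) A) →ₗ[K] ⨂[K]^(n + 1) A :=
  (consEquiv K A n).toLinearMap ∘ₗ f.lTensor A ∘ₗ (consEquiv K A m).symm.toLinearMap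

theorem restMap_cons {m n : ℕ} (f : (⨂[K]^m A) →ₗ[K] ⨂[K]^n A) (a : A) (y : ⨂[K]^m A) :
    restMap f (consEquiv K A m (a ⊗ₜ y)) = consEquiv K A n (a ⊗ₜ f y) := by
  simp [restMap]

/-- The map `g ⊗ id` on `A^{⊗ (m+1)} = A ⊗ A^{⊗ m}`. -/
def firstMap (m : ℕ) (g : A →ₗ[K] A) : (⨂[K]^(m + 1) A) →ₗ[K] ⨂[K]^(m + 1) A :=
  (consEquiv K A m).toLinearMap ∘ₗ g.rTensor _ ∘ₗ (consEquiv K A m).symm.toLinearMap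

theorem firstMap_cons {m : ℕ} (g : A →ₗ[K] A) (a : A) (y : ⨂[K]^m A) :
    firstMap m g (consEquiv K A m (a ⊗ₜ y)) = consEquiv K A m (g a ⊗ₜ y) := by
  simp [firstMap]

theorem firstMap_comp {m : ℕ} (g h : A →ₗ[K] A) :
    firstMap m g ∘ₗ firstMap m h = firstMap m (g ∘ₗ h) :=
  hom_ext_cons fun a y => by simp [firstMap_cons]

theorem firstMap_id {m : ℕ} : firstMap (K := K) (A := A) m LinearMap.id = LinearMap.id :=
  hom_ext_cons fun a y => by simp [firstMap_cons]

theorem firstMap_restMap {m n : ℕ} (g : A →ₗ[K] A) (f : (⨂[K]^m A) →ₗ[K] ⨂[K]^n A) :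
    firstMap n g ∘ₗ restMap f = restMap f ∘ₗ firstMap m g :=
  hom_ext_cons fun a y => by simp [firstMap_cons, restMap_cons]

theorem restMap_comp {m n k : ℕ} (f : (⨂[K]^n A) →ₗ[K] ⨂[K]^k A)
    (g : (⨂[K]^m A) →ₗ[K] ⨂[K]^n A) : restMap f ∘ₗ restMap g = restMap (f ∘ₗ g) :=
  hom_ext_cons fun a y => by simp [restMap_cons]

theorem restMap_sub {m n : ℕ} (f g : (⨂[K]^m A) →ₗ[K] ⨂[K]^n A) :
    restMap (f - g) = restMap f - restMap g :=
  hom_ext_cons fun a y => by simp [restMap_cons, TensorProduct.tmul_sub]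

theorem restMap_zero {m n : ℕ} : restMap (0 : (⨂[K]^m A) →ₗ[K] ⨂[K]^n A) = 0 :=
  hom_ext_cons fun a y => by simp [restMap_cons]

theorem barRes_zero_cons (a : A) (y : ⨂[K]^0 A) :
    barRes 0 (consEquiv K A 0 (a ⊗ₜ y)) = Coalgebra.counit (R := K) a • y := by
  simp [barRes, ← snoc_zero, augLast_snoc]

theorem augLast_cons {m : ℕ} (a : A) (z : ⨂[K]^(m + 1) A) :
    augLast (m + 1) (consEquiv K A (m + 1) (a ⊗ₜ z)) = consEquiv K A m (a ⊗ₜ augLast m z) := by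
  induction z using snoc_induction with
  | zero => simp
  | add y y' hy hy' => simp only [TensorProduct.tmul_add, map_add, hy, hy']
  | snoc y b => simp [← snoc_cons, augLast_snoc]

theorem barRes_succ (m : ℕ) :
    barRes (K := K) (A := A) (m + 1) = mulAt K A (m + 1) 0 - restMap (barRes m) := by
  refine hom_ext_cons fun a z => ?_
  simp only [barRes, LinearMap.add_apply, LinearMap.sum_apply, LinearMap.smul_apply,
    LinearMap.sub_apply, restMap_cons,
    Fin.sum_univ_succ, mulAt_succ_cons, augLast_cons, Fin.val_zero, pow_zero, one_smul,
    Fin.val_succ, pow_succ, mul_neg, mul_one, neg_smul, Finset.sum_neg_distrib,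
    TensorProduct.tmul_add, map_add, TensorProduct.tmul_sum, map_sum, TensorProduct.tmul_smul,
    map_smul]
  abel

theorem mulAt_zero_cons_eq_firstMap {m : ℕ} (a : A) (z : ⨂[K]^(m + 1) A) :
    mulAt K A (m + 1) 0 (consEquiv K A (m + 1) (a ⊗ₜ z)) =
      firstMap m (LinearMap.mulLeft K a) z := by
  induction z using cons_induction with
  | zero => simp
  | add y y' hy hy' => simp only [TensorProduct.tmul_add, map_add, hy, hy']
  | cons b y => simp [mulAt_zero_cons, firstMap_cons]

theorem barRes_succ_cons {m : ℕ} (a : A) (z : ⨂[K]^(m + 1) A) :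
    barRes (m + 1) (consEquiv K A (m + 1) (a ⊗ₜ z)) =
      firstMap m (LinearMap.mulLeft K a) z - consEquiv K A m (a ⊗ₜ barRes m z) := by
  rw [barRes_succ, LinearMap.sub_apply, mulAt_zero_cons_eq_firstMap, restMap_cons]

theorem barRes_cons_cons {m : ℕ} (a b : A) (y : ⨂[K]^m A) :
    barRes (m + 1) (consEquiv K A (m + 1) (a ⊗ₜ consEquiv K A m (b ⊗ₜ y))) =
      consEquiv K A m ((a * b) ⊗ₜ y) -
        consEquiv K A m (a ⊗ₜ barRes m (consEquiv K A m (b ⊗ₜ y))) := by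
  rw [barRes_succ_cons, firstMap_cons, LinearMap.mulLeft_apply]

/-- `consOne` contracts the augmented bar resolution. -/
theorem barRes_consOne {m : ℕ} :
    barRes (m + 1) ∘ₗ consOne (m + 1) =
      LinearMap.id - consOne (K := K) (A := A) m ∘ₗ barRes m :=
  hom_ext_cons fun a y => by simp [consOne_apply, barRes_cons_cons]

theorem barRes_one_cons_cons (a b : A) (y : ⨂[K]^0 A) :
    barRes 1 (consEquiv K A 1 (a ⊗ₜ consEquiv K A 0 (b ⊗ₜ y))) =
      consEquiv K A 0 ((a * b) ⊗ₜ y) -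
        Coalgebra.counit (R := K) b • consEquiv K A 0 (a ⊗ₜ y) := by
  rw [barRes_cons_cons, barRes_zero_cons, TensorProduct.tmul_smul, map_smul]

theorem barRes_firstMap {m : ℕ} (x : A) :
    barRes (m + 1) ∘ₗ firstMap (m + 1) (LinearMap.mulLeft K x) =
      firstMap m (LinearMap.mulLeft K x) ∘ₗ barRes (m + 1) := by
  refine hom_ext_cons fun a z => ?_
  induction z using cons_induction with
  | zero => simp
  | add y y' hy hy' => simp only [TensorProduct.tmul_add, map_add, hy, hy']
  | cons b y => simp [firstMap_cons, barRes_cons_cons, mul_assoc]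

theorem barRes_comp_barRes (m : ℕ) :
    barRes m ∘ₗ barRes (m + 1) = (0 : (⨂[K]^(m + 2) A) →ₗ[K] ⨂[K]^m A) := by
  induction m with
  | zero =>
    refine hom_ext_cons fun a z => ?_
    induction z using cons_induction with
    | zero => simp
    | add y y' hy hy' => simp only [TensorProduct.tmul_add, map_add, hy, hy']
    | cons b y =>
      simp [barRes_one_cons_cons, barRes_zero_cons, smul_smul, mul_comm]
  | succ m ih =>
    refine hom_ext_cons fun a z => ?_
    have h1 := LinearMap.congr_fun (barRes_firstMap a) z
    have h2 := LinearMap.congr_fun ih z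
    simp only [LinearMap.comp_apply, LinearMap.zero_apply] at h1 h2
    simp [barRes_succ_cons (m := m + 1), barRes_succ_cons (m := m), h1, h2]

/-- The alternating insertion of `x` into `A^{⊗ m}`:
`a₁ ⊗ ⋯ ⊗ aₘ ↦ ∑ᵢ (-1)ⁱ a₁ ⊗ ⋯ ⊗ aᵢ ⊗ x ⊗ aᵢ₊₁ ⊗ ⋯ ⊗ aₘ`. -/
def insertion (x : A) : (m : ℕ) → (⨂[K]^m A) →ₗ[K] ⨂[K]^(m + 1) A
  | 0 => (consEquiv K A 0).toLinearMap ∘ₗ TensorProduct.mk K A _ x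
  | m + 1 => (consEquiv K A (m + 1)).toLinearMap ∘ₗ TensorProduct.mk K A _ x -
      restMap (insertion x m)

theorem insertion_zero (x : A) (y : ⨂[K]^0 A) :
    insertion x 0 y = consEquiv K A 0 (x ⊗ₜ y) := rfl

theorem insertion_succ (x : A) {m : ℕ} (y : ⨂[K]^(m + 1) A) :
    insertion x (m + 1) y = consEquiv K A (m + 1) (x ⊗ₜ y) - restMap (insertion x m) y := rfl

theorem insertion_homotopy_zero {x : A} (hx : Coalgebra.counit (R := K) x = 0) :
    barRes 1 ∘ₗ restMap (insertion x 0) = firstMap 0 (LinearMap.mulLeft K x) := by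
  refine hom_ext_cons fun a y => ?_
  simp [firstMap_cons, restMap_cons, insertion_zero, barRes_one_cons_cons, hx, mul_comm]

theorem barRes_insertion_zero {x : A} (hx : Coalgebra.counit (R := K) x = 0) :
    barRes 1 ∘ₗ insertion (K := K) x 1 = - (insertion x 0 ∘ₗ barRes 0) := by
  refine LinearMap.ext fun w => ?_
  have h := LinearMap.congr_fun (insertion_homotopy_zero hx) w
  simp only [LinearMap.comp_apply] at h
  simp [insertion_succ, barRes_succ_cons, h, insertion_zero]

/-- Multiplication of the first factor by an `x` with `ε(x) = 0` is null-homotopic on the bar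
resolution: in the homology of the trivial module `x` acts by `ε(x)`. -/
theorem insertion_homotopy_succ {x : A} (hx : Coalgebra.counit (R := K) x = 0) (m : ℕ) :
    barRes (m + 2) ∘ₗ restMap (insertion x (m + 1)) +
        restMap (insertion x m) ∘ₗ barRes (m + 1) =
      firstMap (m + 1) (LinearMap.mulLeft K x) := by
  -- The homotopy formula in one degree makes insertion anticommute with the differential in the
  -- next, and `key` leads back to the homotopy formula.
  have key : ∀ m : ℕ,
      barRes (m + 1) ∘ₗ insertion (K := K) x (m + 1) = - (insertion x m ∘ₗ barRes m) →
      barRes (m + 2) ∘ₗ restMap (insertion x (m + 1)) +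
        restMap (insertion x m) ∘ₗ barRes (m + 1) =
      firstMap (m + 1) (LinearMap.mulLeft K x) := by
    intro m hm
    refine hom_ext_cons fun a w => ?_
    have h := LinearMap.congr_fun hm w
    have h1 := LinearMap.congr_fun
      (firstMap_restMap (LinearMap.mulLeft K a) (insertion x m)) w
    simp only [LinearMap.comp_apply, LinearMap.neg_apply] at h h1
    rw [LinearMap.add_apply, LinearMap.comp_apply, LinearMap.comp_apply, restMap_cons,
      barRes_succ_cons, h, barRes_succ_cons, map_sub, restMap_cons, insertion_succ, map_sub,
      firstMap_cons, firstMap_cons, h1, TensorProduct.tmul_neg, map_neg,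
      LinearMap.mulLeft_apply, LinearMap.mulLeft_apply, mul_comm x a]
    abel
  induction m with
  | zero => exact key 0 (barRes_insertion_zero hx)
  | succ m ih =>
    refine key (m + 1) (LinearMap.ext fun w => ?_)
    have h := LinearMap.congr_fun ih w
    simp only [LinearMap.add_apply, LinearMap.comp_apply] at h
    have h := eq_sub_of_add_eq h
    simp only [LinearMap.comp_apply, insertion_succ x (m := m + 1), map_sub, barRes_succ_cons, h,
      LinearMap.neg_apply, insertion_succ x (m := m)]
    abel

/-- `augFirst` is the quotient map from the bar resolution to its coinvariants, the bar complex
with trivial coefficients. -/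
theorem augFirst_barRes (m : ℕ) :
    augFirst m ∘ₗ barRes (m + 1) = bar (K := K) (A := A) m ∘ₗ augFirst (m + 1) := by
  refine hom_ext_cons fun a z => ?_
  induction z using cons_induction with
  | zero => simp
  | add y y' hy hy' => simp only [TensorProduct.tmul_add, map_add, hy, hy']
  | cons b y =>
    simp [bar, barRes_cons_cons, augFirst_cons, mul_smul, smul_sub]

theorem augFirst_consOne (m : ℕ) :
    augFirst m ∘ₗ consOne m = (LinearMap.id : (⨂[K]^m A) →ₗ[K] _) :=
  LinearMap.ext fun y => by simp [consOne_apply, augFirst_cons]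

theorem bar_comp_bar (m : ℕ) :
    bar m ∘ₗ bar (m + 1) = (0 : (⨂[K]^(m + 2) A) →ₗ[K] ⨂[K]^m A) := by
  have h : (bar m ∘ₗ bar (m + 1)) ∘ₗ augFirst (m + 2) =
      (0 : (⨂[K]^(m + 3) A) →ₗ[K] ⨂[K]^m A) := by
    rw [LinearMap.comp_assoc, ← augFirst_barRes, ← LinearMap.comp_assoc, ← augFirst_barRes,
      LinearMap.comp_assoc, barRes_comp_barRes, LinearMap.comp_zero]
  calc bar m ∘ₗ bar (m + 1) = ((bar m ∘ₗ bar (m + 1)) ∘ₗ augFirst (m + 2)) ∘ₗ consOne (m + 2) := by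
        rw [LinearMap.comp_assoc, augFirst_consOne, LinearMap.comp_id]
    _ = 0 := by rw [h, LinearMap.zero_comp]

theorem cobarRes_zero (y : ⨂[K]^0 A) : cobarRes 0 y = consEquiv K A 0 (1 ⊗ₜ y) := by
  simp [cobarRes, snoc_zero]

theorem cobarRes_succ (n : ℕ) :
    cobarRes (K := K) (A := A) (n + 1) = comulAt K A (n + 1) 0 - restMap (cobarRes n) := by
  refine hom_ext_cons fun a y => ?_
  simp only [cobarRes, LinearMap.add_apply, LinearMap.sum_apply, LinearMap.smul_apply,
    LinearMap.sub_apply, restMap_cons,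
    Fin.sum_univ_succ, comulAt_succ_cons, Fin.val_zero, pow_zero, one_smul,
    Fin.val_succ, pow_succ, mul_neg, mul_one, neg_smul, Finset.sum_neg_distrib,
    TensorProduct.tmul_add, map_add, TensorProduct.tmul_sum, map_sum, TensorProduct.tmul_smul,
    map_smul, LinearMap.comp_apply, LinearMap.flip_apply, TensorProduct.mk_apply,
    LinearEquiv.coe_coe, snoc_cons]
  abel

theorem cobarRes_succ_cons {n : ℕ} (a : A) (y : ⨂[K]^n A) :
    cobarRes (n + 1) (consEquiv K A n (a ⊗ₜ y)) =
      consTwo n (Coalgebra.comul a ⊗ₜ y) - consEquiv K A (n + 1) (a ⊗ₜ cobarRes n y) := by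
  rw [cobarRes_succ, LinearMap.sub_apply, comulAt_zero_cons, restMap_cons]

theorem augFirst_consTwo {n : ℕ} (a : A) (y : ⨂[K]^n A) :
    augFirst (n + 1) (consTwo n (Coalgebra.comul a ⊗ₜ y)) = consEquiv K A n (a ⊗ₜ y) := by
  have key : ∀ u : A ⊗[K] A, augFirst (n + 1) (consTwo n (u ⊗ₜ y)) =
      consEquiv K A n (TensorProduct.lid K A
        ((Coalgebra.counit (R := K) (A := A)).rTensor A u) ⊗ₜ y) := by
    intro u
    induction u with
    | zero => simp
    | add u u' hu hu' => simp only [TensorProduct.add_tmul, map_add, hu, hu']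
    | tmul b c => simp [consTwo_tmul, augFirst_cons, ← TensorProduct.smul_tmul']
  rw [key, Coalgebra.rTensor_counit_comul]
  simp

/-- `augFirst` contracts the coaugmented cobar resolution. -/
theorem augFirst_cobarRes {n : ℕ} :
    augFirst (n + 1) ∘ₗ cobarRes (n + 1) =
      LinearMap.id - cobarRes (K := K) (A := A) n ∘ₗ augFirst n :=
  hom_ext_cons fun a y => by
    simp [cobarRes_succ_cons, augFirst_consTwo, augFirst_cons]

/-- Comultiplying the first factor commutes with maps of the remaining factors. -/
theorem restMap_restMap_comulAt {n k : ℕ} (f : (⨂[K]^n A) →ₗ[K] ⨂[K]^k A) :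
    restMap (restMap f) ∘ₗ comulAt K A (n + 1) 0 = comulAt K A (k + 1) 0 ∘ₗ restMap f := by
  refine hom_ext_cons fun a y => ?_
  simp only [LinearMap.comp_apply, comulAt_zero_cons, restMap_cons]
  generalize (Coalgebra.comul a : A ⊗[K] A) = u
  induction u with
  | zero => simp
  | add u u' hu hu' => simp only [TensorProduct.add_tmul, map_add, hu, hu']
  | tmul b c => simp [consTwo_tmul, restMap_cons]

theorem comulAt_coassoc (n : ℕ) :
    comulAt K A (n + 2) 0 ∘ₗ comulAt K A (n + 1) 0 =
      restMap (comulAt K A (n + 1) 0) ∘ₗ comulAt K A (n + 1) 0 := by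
  refine hom_ext_cons fun a y => ?_
  -- `a ⊗ b ⊗ c ↦ a ⊗ b ⊗ c ⊗ y`
  let F : A ⊗[K] (A ⊗[K] A) →ₗ[K] ⨂[K]^(n + 3) A :=
    (consEquiv K A (n + 2)).toLinearMap ∘ₗ
      (consTwo n ∘ₗ (TensorProduct.mk K _ _).flip y).lTensor A
  have h1 : ∀ u : A ⊗[K] A, comulAt K A (n + 2) 0 (consTwo n (u ⊗ₜ y)) =
      F (TensorProduct.assoc K A A A ((Coalgebra.comul (R := K) (A := A)).rTensor A u)) := by
    intro u
    induction u with
    | zero => simp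
    | add u u' hu hu' => simp only [TensorProduct.add_tmul, map_add, hu, hu']
    | tmul b c =>
      rw [consTwo_tmul, comulAt_zero_cons, LinearMap.rTensor_tmul]
      generalize (Coalgebra.comul b : A ⊗[K] A) = v
      induction v with
      | zero => simp
      | add v v' hv hv' => simp only [TensorProduct.add_tmul, map_add, hv, hv']
      | tmul d e => simp [F, consTwo_tmul]
  have h2 : ∀ u : A ⊗[K] A, restMap (comulAt K A (n + 1) 0) (consTwo n (u ⊗ₜ y)) =
      F ((Coalgebra.comul (R := K) (A := A)).lTensor A u) := by
    intro u
    induction u with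
    | zero => simp
    | add u u' hu hu' => simp only [TensorProduct.add_tmul, map_add, hu, hu']
    | tmul b c => simp [F, consTwo_tmul, restMap_cons, comulAt_zero_cons]
  simp only [LinearMap.comp_apply, comulAt_zero_cons, h1, h2, Coalgebra.coassoc_apply]

/-- `consOne` is the inclusion into the cobar resolution of its coinvariants, the cobar complex with
trivial coefficients. -/
theorem cobarRes_consOne {n : ℕ} :
    cobarRes (n + 1) ∘ₗ consOne n = consOne (K := K) (A := A) (n + 1) ∘ₗ cobar n :=
  LinearMap.ext fun y => by
    simp [consOne_apply, cobarRes_succ_cons, cobar, Bialgebra.comul_one,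
      Algebra.TensorProduct.one_def, consTwo_tmul, TensorProduct.tmul_sub]

theorem cobarRes_comp_cobarRes (n : ℕ) :
    cobarRes (n + 1) ∘ₗ cobarRes n = (0 : (⨂[K]^n A) →ₗ[K] ⨂[K]^(n + 2) A) := by
  induction n with
  | zero =>
    refine LinearMap.ext fun y => ?_
    simp [cobarRes_zero, cobarRes_succ_cons, Bialgebra.comul_one,
      Algebra.TensorProduct.one_def, consTwo_tmul]
  | succ n ih =>
    refine LinearMap.ext fun z => ?_
    have h1 := LinearMap.congr_fun (restMap_restMap_comulAt (cobarRes (K := K) (A := A) n)) z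
    have h2 := LinearMap.congr_fun (comulAt_coassoc (K := K) (A := A) n) z
    have h3 := LinearMap.congr_fun (congrArg restMap ih) z
    rw [restMap_zero, ← restMap_comp] at h3
    simp only [LinearMap.comp_apply, LinearMap.zero_apply] at h1 h2 h3
    have h4 : restMap (cobarRes (n + 1)) (comulAt K A (n + 1) 0 z) =
        restMap (comulAt K A (n + 1) 0) (comulAt K A (n + 1) 0 z) -
          restMap (restMap (cobarRes n)) (comulAt K A (n + 1) 0 z) := by
      rw [cobarRes_succ n, restMap_sub, LinearMap.sub_apply]
    rw [LinearMap.comp_apply, cobarRes_succ (n + 1), cobarRes_succ n, LinearMap.sub_apply,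
      LinearMap.sub_apply, map_sub, map_sub, ← cobarRes_succ n, h3, h4, h1, h2]
    simp

theorem cobarRes_firstMap {n : ℕ} {D : A →ₗ[K] A}
    (hD : ∀ a, Coalgebra.comul (R := K) (D a) = D.rTensor A (Coalgebra.comul a)) :
    cobarRes (n + 1) ∘ₗ firstMap n D = firstMap (K := K) (n + 1) D ∘ₗ cobarRes (n + 1) := by
  refine hom_ext_cons fun a y => ?_
  have h1 : ∀ u : A ⊗[K] A, firstMap (n + 1) D (consTwo n (u ⊗ₜ y)) =
      consTwo n (D.rTensor A u ⊗ₜ y) := by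
    intro u
    induction u with
    | zero => simp
    | add u u' hu hu' => simp only [TensorProduct.add_tmul, map_add, hu, hu']
    | tmul b c => simp [consTwo_tmul, firstMap_cons]
  simp [firstMap_cons, cobarRes_succ_cons, h1, hD]

/-- Evaluation of a functional on the first factor, `a ⊗ y ↦ l(a) y`. -/
def evalFirst (l : A →ₗ[K] K) (n : ℕ) : (⨂[K]^(n + 1) A) →ₗ[K] ⨂[K]^n A :=
  (TensorProduct.lid K (⨂[K]^n A)).toLinearMap ∘ₗ
    l.rTensor _ ∘ₗ (consEquiv K A n).symm.toLinearMap

theorem evalFirst_cons (l : A →ₗ[K] K) {n : ℕ} (a : A) (y : ⨂[K]^n A) :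
    evalFirst l n (consEquiv K A n (a ⊗ₜ y)) = l a • y := by
  simp [evalFirst]

/-- The alternating evaluation of `l` on the factors of `A^{⊗ (n+1)}`:
`a₀ ⊗ ⋯ ⊗ aₙ ↦ ∑ᵢ (-1)ⁱ l(aᵢ) a₀ ⊗ ⋯ ⊗ aᵢ₋₁ ⊗ aᵢ₊₁ ⊗ ⋯ ⊗ aₙ`. -/
def deletion (l : A →ₗ[K] K) : (n : ℕ) → (⨂[K]^(n + 1) A) →ₗ[K] ⨂[K]^n A
  | 0 => evalFirst l 0
  | n + 1 => evalFirst l (n + 1) - restMap (deletion l n)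

theorem deletion_succ (l : A →ₗ[K] K) (n : ℕ) :
    deletion l (n + 1) = evalFirst l (n + 1) - restMap (deletion l n) := rfl

theorem evalFirst_restMap (l : A →ₗ[K] K) {m n : ℕ} (f : (⨂[K]^m A) →ₗ[K] ⨂[K]^n A) :
    evalFirst l n ∘ₗ restMap f = f ∘ₗ evalFirst l m :=
  hom_ext_cons fun a y => by simp [restMap_cons, evalFirst_cons]

theorem evalFirst_comulAt {l : A →ₗ[K] K} {D : A →ₗ[K] A}
    (hl : ∀ a, TensorProduct.lid K A (l.rTensor A (Coalgebra.comul a)) = D a) (n : ℕ) :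
    evalFirst l (n + 1) ∘ₗ comulAt K A (n + 1) 0 = firstMap n D := by
  refine hom_ext_cons fun a y => ?_
  simp only [LinearMap.comp_apply, comulAt_zero_cons, firstMap_cons, ← hl]
  generalize (Coalgebra.comul a : A ⊗[K] A) = u
  induction u with
  | zero => simp
  | add u u' hu hu' => simp only [TensorProduct.add_tmul, map_add, hu, hu']
  | tmul b c => simp [consTwo_tmul, evalFirst_cons, ← TensorProduct.smul_tmul']

theorem restMap_evalFirst_comulAt {l : A →ₗ[K] K} {D : A →ₗ[K] A}
    (hr : ∀ a, TensorProduct.rid K A (l.lTensor A (Coalgebra.comul a)) = D a) (n : ℕ) :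
    restMap (evalFirst l n) ∘ₗ comulAt K A (n + 1) 0 = firstMap n D := by
  refine hom_ext_cons fun a y => ?_
  simp only [LinearMap.comp_apply, comulAt_zero_cons, firstMap_cons, ← hr]
  generalize (Coalgebra.comul a : A ⊗[K] A) = u
  induction u with
  | zero => simp
  | add u u' hu hu' => simp only [TensorProduct.add_tmul, map_add, hu, hu']
  | tmul b c => simp [consTwo_tmul, evalFirst_cons, restMap_cons, ← TensorProduct.smul_tmul']

theorem deletion_homotopy_zero {l : A →ₗ[K] K} {D : A →ₗ[K] A} (hl1 : l 1 = 0)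
    (hr : ∀ a, TensorProduct.rid K A (l.lTensor A (Coalgebra.comul a)) = D a) :
    restMap (deletion l 0) ∘ₗ cobarRes 1 = firstMap 0 D := by
  have h : deletion l 0 ∘ₗ cobarRes 0 = (0 : (⨂[K]^0 A) →ₗ[K] _) :=
    LinearMap.ext fun y => by simp [cobarRes_zero, deletion, evalFirst_cons, hl1]
  rw [cobarRes_succ, LinearMap.comp_sub, restMap_comp, h, restMap_zero, sub_zero]
  exact restMap_evalFirst_comulAt hr 0

/-- If `D` is convolution with a functional `l` on either side and `l(1) = 0`, then `D` on the first
factor is null-homotopic on the cobar resolution. -/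
theorem deletion_homotopy_succ {l : A →ₗ[K] K} {D : A →ₗ[K] A} (hl1 : l 1 = 0)
    (hl : ∀ a, TensorProduct.lid K A (l.rTensor A (Coalgebra.comul a)) = D a)
    (hr : ∀ a, TensorProduct.rid K A (l.lTensor A (Coalgebra.comul a)) = D a) (n : ℕ) :
    cobarRes (n + 1) ∘ₗ restMap (deletion l n) +
      restMap (deletion l (n + 1)) ∘ₗ cobarRes (n + 2) = firstMap (n + 1) D := by
  -- As for `insertion`, anticommutation with the differential and the homotopy formula imply each
  -- other in turn.
  have key : ∀ n : ℕ, deletion l (n + 1) ∘ₗ cobarRes (n + 1) = - (cobarRes n ∘ₗ deletion l n) →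
      cobarRes (n + 1) ∘ₗ restMap (deletion l n) +
        restMap (deletion l (n + 1)) ∘ₗ cobarRes (n + 2) = firstMap (n + 1) D := by
    intro n hn
    have e : restMap (deletion l (n + 1)) ∘ₗ comulAt K A (n + 2) 0 =
        firstMap (n + 1) D - comulAt K A (n + 1) 0 ∘ₗ restMap (deletion l n) := by
      rw [deletion_succ, restMap_sub, LinearMap.sub_comp, restMap_evalFirst_comulAt hr,
        restMap_restMap_comulAt]
    have e' : restMap (-(cobarRes n ∘ₗ deletion l n)) =
        - (restMap (cobarRes n) ∘ₗ restMap (deletion l n)) := by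
      rw [← zero_sub, restMap_sub, restMap_zero, zero_sub, ← restMap_comp]
    rw [cobarRes_succ (n + 1), LinearMap.comp_sub, restMap_comp, hn, e, e', cobarRes_succ n,
      LinearMap.sub_comp]
    abel
  induction n with
  | zero =>
    refine key 0 ?_
    rw [deletion_succ, LinearMap.sub_comp, deletion_homotopy_zero hl1 hr, cobarRes_succ,
      LinearMap.comp_sub, evalFirst_comulAt hl, evalFirst_restMap]
    simp [deletion]
  | succ n ih =>
    refine key (n + 1) ?_
    rw [deletion_succ (n := n + 1), LinearMap.sub_comp, eq_sub_of_add_eq' ih,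
      cobarRes_succ (n + 1),
      LinearMap.comp_sub, evalFirst_comulAt hl, evalFirst_restMap,
      deletion_succ l n, LinearMap.comp_sub]
    abel

end Resolutions

/-! ### Cohomology of intersections of kernels of null-homotopic maps -/

section Koszul
universe u
variable {K : Type*} [Field K]

/-- Rank additivity in a short exact sequence of subquotients `Z₁/B₁ → Z₂/B₂ → Z₃/B₃`, stated in
terms of representatives. -/
theorem rank_subquotient {X₁ X₂ X₃ : Type u} [AddCommGroup X₁] [AddCommGroup X₂] [AddCommGroup X₃]
    [Module K X₁] [Module K X₂] [Module K X₃] {Z₁ B₁ : Submodule K X₁} {Z₂ B₂ : Submodule K X₂}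
    {Z₃ B₃ : Submodule K X₃} (f : X₁ →ₗ[K] X₂) (g : X₂ →ₗ[K] X₃)
    (hfZ : ∀ x ∈ Z₁, f x ∈ Z₂) (hfB : ∀ x ∈ B₁, f x ∈ B₂)
    (hgZ : ∀ x ∈ Z₂, g x ∈ Z₃) (hgB : ∀ x ∈ B₂, g x ∈ B₃)
    (inj : ∀ x ∈ Z₁, f x ∈ B₂ → x ∈ B₁)
    (surj : ∀ z ∈ Z₃, ∃ y ∈ Z₂, z - g y ∈ B₃)
    (comp : ∀ x ∈ Z₁, g (f x) ∈ B₃)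
    (exact : ∀ y ∈ Z₂, g y ∈ B₃ → ∃ x ∈ Z₁, y - f x ∈ B₂) :
    Module.rank K (Z₂ ⧸ B₂.submoduleOf Z₂) =
      Module.rank K (Z₁ ⧸ B₁.submoduleOf Z₁) + Module.rank K (Z₃ ⧸ B₃.submoduleOf Z₃) := by
  let F : (Z₁ ⧸ B₁.submoduleOf Z₁) →ₗ[K] Z₂ ⧸ B₂.submoduleOf Z₂ :=
    Submodule.mapQ _ _ (f.restrict hfZ) fun x hx => hfB _ hx
  let G : (Z₂ ⧸ B₂.submoduleOf Z₂) →ₗ[K] Z₃ ⧸ B₃.submoduleOf Z₃ :=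
    Submodule.mapQ _ _ (g.restrict hgZ) fun x hx => hgB _ hx
  have F_mk : ∀ x, F (Submodule.Quotient.mk x) = Submodule.Quotient.mk (f.restrict hfZ x) :=
    fun x => rfl
  have G_mk : ∀ x, G (Submodule.Quotient.mk x) = Submodule.Quotient.mk (g.restrict hgZ x) :=
    fun x => rfl
  have hF : Function.Injective F := by
    rw [injective_iff_map_eq_zero]
    intro x
    induction x using Submodule.Quotient.induction_on with
    | H x =>
      intro hx
      rw [F_mk, Submodule.Quotient.mk_eq_zero] at hx
      rw [Submodule.Quotient.mk_eq_zero]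
      exact inj x x.2 hx
  have hG : Function.Surjective G := by
    intro z
    induction z using Submodule.Quotient.induction_on with
    | H z =>
      obtain ⟨y, hy, h⟩ := surj z z.2
      refine ⟨Submodule.Quotient.mk ⟨y, hy⟩, ?_⟩
      rw [G_mk, eq_comm, Submodule.Quotient.eq]
      exact h
  have hFG : LinearMap.ker G = LinearMap.range F := by
    ext y
    induction y using Submodule.Quotient.induction_on with
    | H y =>
      rw [LinearMap.mem_ker, G_mk, Submodule.Quotient.mk_eq_zero]
      constructor
      · intro hy
        obtain ⟨x, hx, h⟩ := exact y y.2 hy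
        refine ⟨Submodule.Quotient.mk ⟨x, hx⟩, ?_⟩
        rw [F_mk, eq_comm, Submodule.Quotient.eq]
        exact h
      · rintro ⟨x, hx⟩
        induction x using Submodule.Quotient.induction_on with
        | H x =>
          rw [F_mk, eq_comm, Submodule.Quotient.eq] at hx
          have h1 := hgB _ hx
          have h2 := comp x x.2
          have h3 := add_mem h1 h2
          change g y ∈ B₃
          simpa using h3
  rw [← LinearMap.rank_range_add_rank_ker G, rank_range_of_surjective G hG, hFG,
    rank_range_of_injective F hF, add_comm]

variable {X : ℕ → Type u} [∀ n, AddCommGroup (X n)] [∀ n, Module K (X n)]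
  (d : ∀ n, X n →ₗ[K] X (n + 1))

/-- The coboundaries of the subcomplex `F` of `(X, d)`. -/
def subCoboundaries (F : ∀ n, Submodule K (X n)) : ∀ n, Submodule K (X n)
  | 0 => ⊥
  | n + 1 => (F n).map (d n)

/-- The cohomology of the subcomplex `F` of `(X, d)`. -/
abbrev SubCohomology (F : ∀ n, Submodule K (X n)) (n : ℕ) : Type u :=
  ↥(LinearMap.ker (d n) ⊓ F n) ⧸
    (subCoboundaries d F n).submoduleOf (LinearMap.ker (d n) ⊓ F n)

section Step

variable {d} {F : ∀ n, Submodule K (X n)} {φ σ : ∀ n, X n →ₗ[K] X n}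
  {s : ∀ n, X (n + 1) →ₗ[K] X n}

/-- The kernel of a split surjective null-homotopic chain endomorphism `φ` has
the cohomology of `X ⊕ X[-1]`; the connecting map is `d ∘ σ` for a splitting `σ` of `φ`. -/
theorem rank_subCohomology_ker (hdd : ∀ n x, d (n + 1) (d n x) = 0)
    (hFd : ∀ n, ∀ x ∈ F n, d n x ∈ F (n + 1))
    (hFφ : ∀ n, ∀ x ∈ F n, φ n x ∈ F n)
    (hFσ : ∀ n, ∀ x ∈ F n, σ n x ∈ F n)
    (hFs : ∀ n, ∀ x ∈ F (n + 1), s n x ∈ F n)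
    (hφσ : ∀ n x, φ n (σ n x) = x)
    (hφd : ∀ n x, φ (n + 1) (d n x) = d n (φ n x))
    (hs0 : ∀ x, φ 0 x = s 0 (d 0 x))
    (hs : ∀ n x, φ (n + 1) x = d n (s n x) + s (n + 1) (d (n + 1) x)) :
    Module.rank K (SubCohomology d (fun n => F n ⊓ LinearMap.ker (φ n)) 0) =
        Module.rank K (SubCohomology d F 0) ∧
      ∀ n, Module.rank K (SubCohomology d (fun n => F n ⊓ LinearMap.ker (φ n)) (n + 1)) =
        Module.rank K (SubCohomology d F n) + Module.rank K (SubCohomology d F (n + 1)) := by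
  constructor
  · have : LinearMap.ker (d 0) ⊓ (F 0 ⊓ LinearMap.ker (φ 0)) = LinearMap.ker (d 0) ⊓ F 0 := by
      ext x
      simp only [Submodule.mem_inf, LinearMap.mem_ker]
      refine ⟨fun h => ⟨h.1, h.2.1⟩, fun h => ⟨h.1, h.2, ?_⟩⟩
      rw [hs0, h.1, map_zero]
    simp only [SubCohomology, subCoboundaries]
    rw [this]
    rfl
  · intro n
    refine rank_subquotient (d n ∘ₗ σ n) LinearMap.id ?_ ?_ ?_ ?_ ?_ ?_ ?_ ?_
    · rintro x ⟨hx, hxF⟩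
      rw [SetLike.mem_coe, LinearMap.mem_ker] at hx
      refine ⟨by simp [hdd], hFd _ _ (hFσ _ _ hxF), ?_⟩
      simp [hφd, hφσ, hx]
    · cases n with
      | zero =>
        intro x hx
        rw [(Submodule.mem_bot K).1 hx, map_zero]
        exact zero_mem _
      | succ n =>
        rintro _ ⟨w, hw, rfl⟩
        refine ⟨σ _ (d n w) - d n (σ n w), ⟨sub_mem (hFσ _ _ (hFd _ _ hw))
          (hFd _ _ (hFσ _ _ hw)), ?_⟩, ?_⟩
        · simp [hφσ, hφd]
        · simp [hdd]
    · rintro x ⟨hx, hxF, -⟩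
      exact ⟨hx, hxF⟩
    · rintro _ ⟨w, hw, rfl⟩
      exact ⟨w, hw.1, rfl⟩
    · rintro x ⟨hx, hxF⟩ ⟨u, ⟨huF, hu⟩, h⟩
      rw [SetLike.mem_coe, LinearMap.mem_ker] at hu
      have hz : d n (σ n x - u) = 0 := by
        rw [map_sub, h]
        simp
      have hx' : x = φ n (σ n x - u) := by simp [hφσ, hu]
      cases n with
      | zero =>
        rw [hx', hs0, hz, map_zero]
        exact zero_mem _
      | succ n =>
        rw [hx', hs, hz, map_zero, add_zero]
        exact ⟨_, hFs _ _ (sub_mem (hFσ _ _ hxF) huF), rfl⟩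
    · rintro z ⟨hz, hzF⟩
      rw [SetLike.mem_coe, LinearMap.mem_ker] at hz
      refine ⟨z - d n (σ n (s n z)), ⟨by simp [hdd, hz], sub_mem hzF
        (hFd _ _ (hFσ _ _ (hFs _ _ hzF))), ?_⟩, ⟨σ n (s n z), hFσ _ _ (hFs _ _ hzF), by simp⟩⟩
      rw [SetLike.mem_coe, LinearMap.mem_ker, map_sub, hφd, hφσ, hs, hz, map_zero, add_zero,
        sub_self]
    · rintro x ⟨hx, hxF⟩
      exact ⟨σ n x, hFσ _ _ hxF, rfl⟩
    · rintro z ⟨hz, hzF, hzφ⟩ ⟨u, hu, rfl⟩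
      rw [SetLike.mem_coe, LinearMap.mem_ker] at hzφ
      refine ⟨φ n u, ⟨?_, hFφ _ _ hu⟩, u - σ n (φ n u), ⟨sub_mem hu (hFσ _ _ (hFφ _ _ hu)), ?_⟩, ?_⟩
      · rw [SetLike.mem_coe, LinearMap.mem_ker, ← hφd]
        exact hzφ
      · simp [hφσ]
      · simp

end Step

/-- A Koszul-type computation: if `(X, d)` has the cohomology of a point and `φ j`, `j ∈ J`, are
commuting null-homotopic chain endomorphisms with right inverses `σ j`, the right inverses and the
homotopies `s j` for `φ j` commuting with the other `φ i`, then the cohomology of `⋂ j, ker (φ j)`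
has the dimensions of an exterior algebra on `J`: each further kernel doubles the total dimension,
which is Pascal's rule for binomial coefficients. -/
theorem rank_subCohomology_iInf_ker {ι : Type*} [DecidableEq ι]
    {φ σ : ι → ∀ n, X n →ₗ[K] X n} {s : ι → ∀ n, X (n + 1) →ₗ[K] X n}
    (hdd : ∀ n x, d (n + 1) (d n x) = 0)
    (hφφ : ∀ i j n x, φ i n (φ j n x) = φ j n (φ i n x))
    (hφσ : ∀ i n x, φ i n (σ i n x) = x)
    (hφσ' : ∀ i j n x, i ≠ j → φ i n (σ j n x) = σ j n (φ i n x))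
    (hφd : ∀ i n x, φ i (n + 1) (d n x) = d n (φ i n x))
    (hs0 : ∀ i x, φ i 0 x = s i 0 (d 0 x))
    (hs : ∀ i n x, φ i (n + 1) x = d n (s i n x) + s i (n + 1) (d (n + 1) x))
    (hφs : ∀ i j n x, i ≠ j → φ i n (s j n x) = s j n (φ i (n + 1) x))
    (h0 : Module.rank K (SubCohomology d (fun _ => ⊤) 0) = 1)
    (h1 : ∀ n, Module.rank K (SubCohomology d (fun _ => ⊤) (n + 1)) = 0)
    (J : Finset ι) (n : ℕ) :
    Module.rank K (SubCohomology d (fun n => ⨅ j ∈ J, LinearMap.ker (φ j n)) n) =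
      (J.card.choose n : ℕ) := by
  induction J using Finset.induction_on generalizing n with
  | empty =>
    have hF : (fun n => ⨅ j ∈ (∅ : Finset ι), LinearMap.ker (φ j n)) = fun _ => ⊤ := by
      funext n
      simp
    rw [hF]
    cases n with
    | zero => simpa using h0
    | succ n => simpa using h1 n
  | insert j J hj ih =>
    have mem : ∀ n x, x ∈ (⨅ i ∈ J, LinearMap.ker (φ i n)) ↔ ∀ i ∈ J, φ i n x = 0 := by
      intro n x
      simp [Submodule.mem_iInf]
    have hne : ∀ i ∈ J, i ≠ j := fun i hi h => hj (h ▸ hi)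
    obtain ⟨e0, e1⟩ := rank_subCohomology_ker (d := d)
      (F := fun n => ⨅ i ∈ J, LinearMap.ker (φ i n)) (φ := φ j) (σ := σ j) (s := s j) hdd
      (fun n x hx => (mem _ _).2 fun i hi => by rw [hφd, (mem _ _).1 hx i hi, map_zero])
      (fun n x hx => (mem _ _).2 fun i hi => by rw [hφφ, (mem _ _).1 hx i hi, map_zero])
      (fun n x hx => (mem _ _).2 fun i hi => by
        rw [hφσ' i j n x (hne i hi), (mem _ _).1 hx i hi, map_zero])
      (fun n x hx => (mem _ _).2 fun i hi => by
        rw [hφs i j n x (hne i hi), (mem _ _).1 hx i hi, map_zero])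
      (hφσ j) (hφd j) (hs0 j) (hs j)
    have hF : (fun n => ⨅ i ∈ insert j J, LinearMap.ker (φ i n)) =
        fun n => (⨅ i ∈ J, LinearMap.ker (φ i n)) ⊓ LinearMap.ker (φ j n) := by
      funext n
      rw [Finset.iInf_insert, inf_comm]
    rw [hF]
    cases n with
    | zero => rw [e0, ih]; simp
    | succ n =>
      rw [e1, ih, ih, Finset.card_insert_of_notMem hj, Nat.choose_succ_succ]
      push_cast
      rfl

/-- An injective chain map identifies the cohomology of its source with that of its image. -/
theorem rank_subCohomology_range {Y : ℕ → Type u} [∀ n, AddCommGroup (Y n)] [∀ n, Module K (Y n)]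
    (e : ∀ n, Y n →ₗ[K] Y (n + 1)) (j : ∀ n, Y n →ₗ[K] X n)
    (hj : ∀ n, Function.Injective (j n)) (hjd : ∀ n y, d n (j n y) = j (n + 1) (e n y)) (n : ℕ) :
    Module.rank K (SubCohomology e (fun _ => ⊤) n) =
      Module.rank K (SubCohomology d (fun n => LinearMap.range (j n)) n) := by
  have h := rank_subquotient (K := K) (X₁ := Y n) (X₂ := X n) (X₃ := PUnit.{u + 1})
    (Z₁ := LinearMap.ker (e n) ⊓ ⊤) (B₁ := subCoboundaries e (fun _ => ⊤) n)
    (Z₂ := LinearMap.ker (d n) ⊓ LinearMap.range (j n))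
    (B₂ := subCoboundaries d (fun n => LinearMap.range (j n)) n) (Z₃ := ⊤) (B₃ := ⊤)
    (j n) 0 ?_ ?_ (by simp) (by simp) ?_ (fun z _ => ⟨0, zero_mem _, by simp⟩) (by simp) ?_
  · rw [h]
    simp [rank_subsingleton']
  · rintro y ⟨hy, -⟩
    refine ⟨?_, y, rfl⟩
    rw [SetLike.mem_coe, LinearMap.mem_ker] at hy ⊢
    rw [hjd, hy, map_zero]
  · cases n with
    | zero =>
      intro x hx
      rw [(Submodule.mem_bot K).1 hx, map_zero]
      exact zero_mem _
    | succ n =>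
      rintro _ ⟨w, -, rfl⟩
      exact ⟨j n w, ⟨w, rfl⟩, hjd n w⟩
  · rintro y - hy
    cases n with
    | zero =>
      have := (Submodule.mem_bot K).1 hy
      rw [← map_zero (j 0)] at this
      rw [hj 0 this]
      exact zero_mem _
    | succ n =>
      obtain ⟨_, ⟨w, rfl⟩, hw⟩ := hy
      rw [hjd] at hw
      exact ⟨w, trivial, hj _ hw⟩
  · rintro _ ⟨hy, y, rfl⟩ -
    rw [SetLike.mem_coe, LinearMap.mem_ker, hjd] at hy
    refine ⟨y, ⟨hj _ (by rw [hy, map_zero]), trivial⟩, ?_⟩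
    rw [sub_self]
    exact zero_mem _

end Koszul

/-! ### Splittings of complexes of vector spaces -/

section Splitting
universe u
variable {K : Type*} [Field K]

theorem exists_generalized_inverse {V W : Type*} [AddCommGroup V] [AddCommGroup W] [Module K V]
    [Module K W] (f : V →ₗ[K] W) : ∃ r : W →ₗ[K] V, ∀ x, f (r (f x)) = f x := by
  obtain ⟨g, hg⟩ := f.rangeRestrict.exists_rightInverse_of_surjective f.range_rangeRestrict
  obtain ⟨r, hr⟩ := g.exists_extend
  refine ⟨r, fun x => ?_⟩
  have h1 : r (f x) = g (f.rangeRestrict x) := LinearMap.congr_fun hr (f.rangeRestrict x)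
  have h2 := LinearMap.congr_fun hg (f.rangeRestrict x)
  rw [h1]
  exact congrArg Subtype.val h2

variable {X : ℕ → Type u} [∀ n, AddCommGroup (X n)] [∀ n, Module K (X n)]

/-- A splitting of a cochain complex of vector spaces: projections `π n` onto representatives of
the cohomology, and a homotopy `h` between the identity and `π`. -/
structure CochainSplitting (d : ∀ n, X n →ₗ[K] X (n + 1)) where
  /-- the projection onto representatives of cohomology classes -/
  π : ∀ n, X n →ₗ[K] X n
  /-- the homotopy between the identity and `π` -/
  h : ∀ n, X (n + 1) →ₗ[K] X n
  π_π : ∀ n x, π n (π n x) = π n x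
  d_π : ∀ n x, d n (π n x) = 0
  π_d : ∀ n x, π (n + 1) (d n x) = 0
  π_zero : ∀ x, π 0 x = x - h 0 (d 0 x)
  π_succ : ∀ n x, π (n + 1) x = x - d n (h n x) - h (n + 1) (d (n + 1) x)

/-- A splitting of a chain complex of vector spaces: projections `π n` onto representatives of
the homology, and a homotopy `h` between the identity and `π`. -/
structure ChainSplitting (d : ∀ n, X (n + 1) →ₗ[K] X n) where
  /-- the projection onto representatives of homology classes -/
  π : ∀ n, X n →ₗ[K] X n
  /-- the homotopy between the identity and `π` -/
  h : ∀ n, X n →ₗ[K] X (n + 1)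
  π_π : ∀ n x, π n (π n x) = π n x
  d_π : ∀ n x, d n (π (n + 1) x) = 0
  π_d : ∀ n x, π n (d n x) = 0
  π_zero : ∀ x, π 0 x = x - d 0 (h 0 x)
  π_succ : ∀ n x, π (n + 1) x = x - d (n + 1) (h (n + 1) x) - h n (d n x)

theorem nonempty_cochainSplitting (d : ∀ n, X n →ₗ[K] X (n + 1))
    (hdd : ∀ n x, d (n + 1) (d n x) = 0) : Nonempty (CochainSplitting d) := by
  choose r hr using fun n => exists_generalized_inverse (d n)
  -- the projection onto the coboundaries
  let q : ∀ n, X n →ₗ[K] X n := fun n => match n with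
    | 0 => 0
    | n + 1 => d n ∘ₗ r n
  have hq : ∀ n x, q (n + 1) x = d n (r n x) := fun n x => rfl
  have hqd : ∀ n x, q (n + 1) (d n x) = d n x := fun n x => hr n x
  have hdq : ∀ n x, d n (q n x) = 0 := by
    intro n x
    cases n with
    | zero => exact map_zero _
    | succ n => exact hdd _ _
  have hqq : ∀ n x, q n (q n x) = q n x := by
    intro n x
    cases n with
    | zero => rfl
    | succ n => exact hqd _ _
  let h : ∀ n, X (n + 1) →ₗ[K] X n := fun n => (LinearMap.id - q n) ∘ₗ r n ∘ₗ q (n + 1)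
  have hh : ∀ n x, h n x = r n (q (n + 1) x) - q n (r n (q (n + 1) x)) := fun n x => rfl
  have hdh : ∀ n x, d n (h n x) = q (n + 1) x := by
    intro n x
    rw [hh, map_sub, hdq, sub_zero, ← hq]
    exact hqq _ _
  have hqh : ∀ n x, q n (h n x) = 0 := by
    intro n x
    rw [hh, map_sub, hqq, sub_self]
  let π : ∀ n, X n →ₗ[K] X n := fun n => LinearMap.id - q n - h n ∘ₗ d n
  have hπ : ∀ n x, π n x = x - q n x - h n (d n x) := fun n x => rfl
  have hdπ : ∀ n x, d n (π n x) = 0 := by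
    intro n x
    rw [hπ, map_sub, map_sub, hdq, hdh, hqd]
    abel
  refine ⟨⟨π, h, ?_, hdπ, ?_, ?_, ?_⟩⟩
  · intro n x
    rw [hπ n (π n x), hdπ, map_zero, sub_zero, hπ, map_sub, map_sub, hqq, hqh]
    abel
  · intro n x
    rw [hπ, hqd, hdd, map_zero]
    abel
  · intro x
    rw [hπ]
    exact congrArg (· - _) (sub_zero x)
  · intro n x
    rw [hπ, hdh]

theorem nonempty_chainSplitting (d : ∀ n, X (n + 1) →ₗ[K] X n)
    (hdd : ∀ n x, d n (d (n + 1) x) = 0) : Nonempty (ChainSplitting d) := by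
  choose r hr using fun n => exists_generalized_inverse (d n)
  -- the projection onto the boundaries
  let q : ∀ n, X n →ₗ[K] X n := fun n => d n ∘ₗ r n
  have hq : ∀ n x, q n x = d n (r n x) := fun n x => rfl
  have hqd : ∀ n x, q n (d n x) = d n x := fun n x => hr n x
  have hdq : ∀ n x, d n (q (n + 1) x) = 0 := fun n x => hdd _ _
  have hqq : ∀ n x, q n (q n x) = q n x := fun n x => hqd _ _
  let h : ∀ n, X n →ₗ[K] X (n + 1) := fun n => (LinearMap.id - q (n + 1)) ∘ₗ r n ∘ₗ q n
  have hh : ∀ n x, h n x = r n (q n x) - q (n + 1) (r n (q n x)) := fun n x => rfl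
  have hdh : ∀ n x, d n (h n x) = q n x := by
    intro n x
    rw [hh, map_sub, hdq, sub_zero, ← hq, hqq]
  have hqh : ∀ n x, q (n + 1) (h n x) = 0 := by
    intro n x
    rw [hh, map_sub, hqq, sub_self]
  let π : ∀ n, X n →ₗ[K] X n := fun n => match n with
    | 0 => LinearMap.id - q 0
    | n + 1 => LinearMap.id - q (n + 1) - h n ∘ₗ d n
  have hπ0 : ∀ x, π 0 x = x - q 0 x := fun x => rfl
  have hπ : ∀ n x, π (n + 1) x = x - q (n + 1) x - h n (d n x) := fun n x => rfl
  have hdπ : ∀ n x, d n (π (n + 1) x) = 0 := by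
    intro n x
    rw [hπ, map_sub, map_sub, hdq, hdh, hqd]
    abel
  refine ⟨⟨π, h, ?_, hdπ, ?_, ?_, ?_⟩⟩
  · intro n x
    cases n with
    | zero =>
      rw [hπ0 (π 0 x), hπ0, map_sub, hqq]
      abel
    | succ n =>
      rw [hπ n (π (n + 1) x), hdπ, map_zero, sub_zero, hπ, map_sub, map_sub, hqq, hqh]
      abel
  · intro n x
    cases n with
    | zero => rw [hπ0, hqd, sub_self]
    | succ n =>
      rw [hπ, hqd, hdd, map_zero]
      abel
  · intro x
    rw [hπ0, hdh]
  · intro n x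
    rw [hπ, hdh]

/-- The cohomology of a split complex is the range of the projection. -/
theorem CochainSplitting.rank_eq {d : ∀ n, X n →ₗ[K] X (n + 1)} (S : CochainSplitting d)
    (n : ℕ) :
    Module.rank K (SubCohomology d (fun _ => ⊤) n) = Module.rank K (LinearMap.range (S.π n)) := by
  have h := rank_subquotient (K := K) (X₁ := LinearMap.range (S.π n)) (X₂ := X n)
    (X₃ := PUnit.{u + 1}) (Z₁ := ⊤) (B₁ := ⊥)
    (Z₂ := LinearMap.ker (d n) ⊓ ⊤) (B₂ := subCoboundaries d (fun _ => ⊤) n) (Z₃ := ⊤) (B₃ := ⊤)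
    (LinearMap.range (S.π n)).subtype 0 ?_ ?_ (by simp) (by simp) ?_
    (fun z _ => ⟨0, zero_mem _, by simp⟩) (by simp) ?_
  · rw [h, rank_subsingleton' K (_ ⧸ (⊤ : Submodule K PUnit.{u + 1}).submoduleOf ⊤), add_zero]
    exact LinearEquiv.rank_eq ((Submodule.quotEquivOfEqBot _ (by
      rw [Submodule.submoduleOf, Submodule.comap_bot, Submodule.ker_subtype])).trans
      Submodule.topEquiv)
  · rintro ⟨_, x, rfl⟩ -
    exact ⟨S.d_π n x, trivial⟩
  · intro x hx
    rw [(Submodule.mem_bot K).1 hx, map_zero]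
    exact zero_mem _
  · rintro ⟨_, x, rfl⟩ - hx
    rw [Submodule.mem_bot]
    ext
    cases n with
    | zero => exact (Submodule.mem_bot K).1 hx
    | succ n =>
      obtain ⟨w, -, hw⟩ := hx
      have h1 := S.π_d n w
      rw [hw] at h1
      change S.π (n + 1) (S.π (n + 1) x) = 0 at h1
      rwa [S.π_π] at h1
  · rintro z ⟨hz, -⟩ -
    rw [SetLike.mem_coe, LinearMap.mem_ker] at hz
    refine ⟨⟨_, z, rfl⟩, trivial, ?_⟩
    cases n with
    | zero =>
      change z - S.π 0 z ∈ _
      rw [S.π_zero, hz, map_zero, sub_zero, sub_self]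
      exact zero_mem _
    | succ n =>
      change z - S.π (n + 1) z ∈ _
      rw [S.π_succ, hz, map_zero, sub_zero, sub_sub_cancel]
      exact ⟨_, trivial, rfl⟩

/-- The dual of a split chain complex is split. -/
def ChainSplitting.dual {d : ∀ n, X (n + 1) →ₗ[K] X n} (S : ChainSplitting d) :
    CochainSplitting (X := fun n => Module.Dual K (X n)) fun n => (d n).dualMap where
  π n := (S.π n).dualMap
  h n := (S.h n).dualMap
  π_π n f := LinearMap.ext fun x => by simp [S.π_π]
  d_π n f := LinearMap.ext fun x => by simp [S.π_d]
  π_d n f := LinearMap.ext fun x => by simp [S.d_π]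
  π_zero f := LinearMap.ext fun x => by simp [S.π_zero]
  π_succ n f := LinearMap.ext fun x => by simp [S.π_succ]; abel

/-- The range of the transpose of `p` is isomorphic to the dual of the range of `p`. -/
theorem finrank_range_of_rank_range_dualMap {V : Type*} [AddCommGroup V] [Module K V]
    (p : V →ₗ[K] V) {n : ℕ} (h : Module.rank K (LinearMap.range p.dualMap) = n) :
    Module.Finite K (LinearMap.range p) ∧ Module.finrank K (LinearMap.range p) = n := by
  have h1 : LinearMap.range p.dualMap = LinearMap.range p.rangeRestrict.dualMap := by
    have e : p.dualMap = p.rangeRestrict.dualMap ∘ₗ (LinearMap.range p).subtype.dualMap := rfl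
    rw [e, LinearMap.range_comp_of_range_eq_top]
    exact LinearMap.range_eq_top.2
      (LinearMap.dualMap_surjective_of_injective (Submodule.subtype_injective _))
  have h2 : Function.Injective p.rangeRestrict.dualMap :=
    LinearMap.dualMap_injective_of_surjective p.surjective_rangeRestrict
  have e : Module.Dual K (LinearMap.range p) ≃ₗ[K] LinearMap.range p.dualMap :=
    (LinearEquiv.ofInjective _ h2).trans (LinearEquiv.ofEq _ _ h1.symm)
  have h4 : Module.Finite K (Module.Dual K (LinearMap.range p)) :=
    Module.rank_lt_aleph0_iff.1 (by rw [e.rank_eq, h]; exact Cardinal.natCast_lt_aleph0)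
  refine ⟨(Module.finite_dual_iff K).1 h4, ?_⟩
  rw [← Subspace.dual_finrank_eq, e.finrank_eq, Module.finrank_eq_of_rank_eq h]

end Splitting

/-! ### The total complex of a split double complex -/

section Total

variable {K A : Type*} [Field K] [CommRing A] [Bialgebra K A]

theorem proj_ext {k : ℕ} {Φ Ψ : Cochain K A k}
    (h : ∀ m n (hk : m + n = k), Cochain.proj K A k m n hk Φ = Cochain.proj K A k m n hk Ψ) :
    Φ = Ψ :=
  funext fun p => h p.1.1 p.1.2 (Finset.HasAntidiagonal.mem_antidiagonal.1 p.2)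

theorem proj_d {k m n : ℕ} (h : m + n = k + 1) (Ψ : Cochain K A k) :
    Cochain.proj K A (k + 1) m n h (d K A k Ψ) =
      component₁ K A k m n h Ψ + (-1 : K) ^ m • component₂ K A k m n h Ψ := rfl

/-- The cochain with components `f m n`. -/
def Cochain.mk {k : ℕ} (f : ∀ m n, m + n = k → ((⨂[K]^m A) →ₗ[K] ⨂[K]^n A)) : Cochain K A k :=
  fun p => f p.1.1 p.1.2 (Finset.HasAntidiagonal.mem_antidiagonal.1 p.2)

theorem proj_mk {k m n : ℕ} (h : m + n = k)
    (f : ∀ m n, m + n = k → ((⨂[K]^m A) →ₗ[K] ⨂[K]^n A)) :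
    Cochain.proj K A k m n h (Cochain.mk f) = f m n h := rfl

variable (K A) in
/-- Contractions of the rows and of the columns of the Gerstenhaber–Schack double complex onto
subspaces: commuting projections `P₁`, `P₂`, and homotopies `η₁`, `η₂` between them and the identity.
Everything in the direction of `d₁` commutes with everything in the direction of `d₂`, except that
`η₁` need not commute with `P₂` and `η₂`, nor `η₂` with `P₁`. -/
structure DoubleSplitting where
  /-- projection in the direction of `d₁` -/
  P₁ : ∀ m n, ((⨂[K]^m A) →ₗ[K] ⨂[K]^n A) →ₗ[K] ((⨂[K]^m A) →ₗ[K] ⨂[K]^n A)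
  /-- projection in the direction of `d₂` -/
  P₂ : ∀ m n, ((⨂[K]^m A) →ₗ[K] ⨂[K]^n A) →ₗ[K] ((⨂[K]^m A) →ₗ[K] ⨂[K]^n A)
  /-- homotopy in the direction of `d₁` -/
  η₁ : ∀ m n, ((⨂[K]^(m + 1) A) →ₗ[K] ⨂[K]^n A) →ₗ[K] ((⨂[K]^m A) →ₗ[K] ⨂[K]^n A)
  /-- homotopy in the direction of `d₂` -/
  η₂ : ∀ m n, ((⨂[K]^m A) →ₗ[K] ⨂[K]^(n + 1) A) →ₗ[K] ((⨂[K]^m A) →ₗ[K] ⨂[K]^n A)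
  P₁_P₁ : ∀ m n f, P₁ m n (P₁ m n f) = P₁ m n f
  P₂_P₂ : ∀ m n f, P₂ m n (P₂ m n f) = P₂ m n f
  P₁_P₂ : ∀ m n f, P₁ m n (P₂ m n f) = P₂ m n (P₁ m n f)
  d₁_P₁ : ∀ m n f, d₁ K A m n (P₁ m n f) = 0
  P₁_d₁ : ∀ m n f, P₁ (m + 1) n (d₁ K A m n f) = 0
  d₂_P₂ : ∀ m n f, d₂ K A m n (P₂ m n f) = 0
  P₂_d₂ : ∀ m n f, P₂ m (n + 1) (d₂ K A m n f) = 0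
  d₁_P₂ : ∀ m n f, d₁ K A m n (P₂ m n f) = P₂ (m + 1) n (d₁ K A m n f)
  d₂_P₁ : ∀ m n f, d₂ K A m n (P₁ m n f) = P₁ m (n + 1) (d₂ K A m n f)
  d₁_η₂ : ∀ m n f, d₁ K A m n (η₂ m n f) = η₂ (m + 1) n (d₁ K A m (n + 1) f)
  d₂_η₁ : ∀ m n f, d₂ K A m n (η₁ m n f) = η₁ m (n + 1) (d₂ K A (m + 1) n f)
  η₁_zero : ∀ n f, η₁ 0 n (d₁ K A 0 n f) = f - P₁ 0 n f
  η₁_succ : ∀ m n f, d₁ K A m n (η₁ m n f) + η₁ (m + 1) n (d₁ K A (m + 1) n f) =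
    f - P₁ (m + 1) n f
  η₂_zero : ∀ m f, η₂ m 0 (d₂ K A m 0 f) = f - P₂ m 0 f
  η₂_succ : ∀ m n f, d₂ K A m n (η₂ m n f) + η₂ m (n + 1) (d₂ K A m (n + 1) f) =
    f - P₂ m (n + 1) f

namespace DoubleSplitting

variable (S : DoubleSplitting K A)

/-- The homotopy `η₁ + (-1)^m η₂ P₁` of the total complex. -/
def homotopy (k : ℕ) (Ψ : Cochain K A (k + 1)) : Cochain K A k :=
  Cochain.mk fun m n h =>
    S.η₁ m n (Cochain.proj K A (k + 1) (m + 1) n (by omega) Ψ) +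
      (-1 : K) ^ m • S.η₂ m n (S.P₁ m (n + 1) (Cochain.proj K A (k + 1) m (n + 1) (by omega) Ψ))

theorem proj_homotopy {k m n : ℕ} (h : m + n = k) (Ψ : Cochain K A (k + 1)) :
    Cochain.proj K A k m n h (S.homotopy k Ψ) =
    S.η₁ m n (Cochain.proj K A (k + 1) (m + 1) n (by omega) Ψ) +
      (-1 : K) ^ m • S.η₂ m n
        (S.P₁ m (n + 1) (Cochain.proj K A (k + 1) m (n + 1) (by omega) Ψ)) := rfl

/-- The projection `P₂ P₁` of the total complex. -/
def total (k : ℕ) : Cochain K A k →ₗ[K] Cochain K A k where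
  toFun Ψ := Cochain.mk fun m n h => S.P₂ m n (S.P₁ m n (Cochain.proj K A k m n h Ψ))
  map_add' Φ Ψ := proj_ext fun m n h => by simp [proj_mk]
  map_smul' c Ψ := proj_ext fun m n h => by simp [proj_mk]

theorem proj_total {k m n : ℕ} (h : m + n = k) (Ψ : Cochain K A k) :
    Cochain.proj K A k m n h (S.total k Ψ) = S.P₂ m n (S.P₁ m n (Cochain.proj K A k m n h Ψ)) :=
  rfl

theorem neg_one_pow_mul_self (m : ℕ) : (-1 : K) ^ m * (-1 : K) ^ m = 1 := by
  rw [← mul_pow]; simp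

theorem homotopy_zero (Ψ : Cochain K A 0) :
    S.homotopy 0 (d K A 0 Ψ) = Ψ - S.total 0 Ψ := by
  refine proj_ext fun m n h => ?_
  obtain ⟨rfl, rfl⟩ : m = 0 ∧ n = 0 := by omega
  simp only [proj_homotopy, proj_d, map_sub, proj_total, component₁, component₂,
    LinearMap.comp_apply, LinearMap.zero_apply, smul_zero, add_zero, zero_add, pow_zero, one_smul,
    ← S.d₂_P₁, S.η₁_zero, S.η₂_zero]
  abel

/-- The terms `d₂ η₁` and `η₁ d₂` cancel because of the sign `(-1)^m` in the total differential,
and the terms with `d₁` and `η₂ P₁` vanish, since `d₁ P₁ = P₁ d₁ = 0`. -/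
theorem homotopy_succ {k : ℕ} (Ψ : Cochain K A (k + 1)) :
    d K A k (S.homotopy k Ψ) + S.homotopy (k + 1) (d K A (k + 1) Ψ) =
      Ψ - S.total (k + 1) Ψ := by
  refine proj_ext fun m n h => ?_
  simp only [map_add, map_sub, proj_d, proj_homotopy, proj_total]
  cases m with
  | zero =>
    cases n with
    | zero => omega
    | succ n =>
      have e1 := S.η₁_zero (n + 1) (Cochain.proj K A (k + 1) 0 (n + 1) h Ψ)
      have e2 := S.η₂_succ 0 n (S.P₁ 0 (n + 1) (Cochain.proj K A (k + 1) 0 (n + 1) h Ψ))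
      simp only [component₁, component₂, LinearMap.comp_apply, LinearMap.zero_apply, map_add,
        map_smul, proj_homotopy, zero_add, pow_zero, one_smul, pow_succ, one_mul,
        ← S.d₂_P₁, S.d₂_η₁, map_zero] at e1 e2 ⊢
      rw [e1, eq_sub_of_add_eq' e2]
      module
  | succ m =>
    cases n with
    | zero =>
      have e1 := S.η₁_succ m 0 (Cochain.proj K A (k + 1) (m + 1) 0 h Ψ)
      have e2 := S.η₂_zero (m + 1) (S.P₁ (m + 1) 0 (Cochain.proj K A (k + 1) (m + 1) 0 h Ψ))
      simp only [component₁, component₂, LinearMap.comp_apply, LinearMap.zero_apply, map_add,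
        map_smul, proj_homotopy, S.P₁_d₁, S.d₁_η₂, S.d₁_P₁,
        ← S.d₂_P₁, smul_zero, map_zero, add_zero, zero_add, smul_smul,
        neg_one_pow_mul_self, one_smul] at e1 e2 ⊢
      rw [e2, eq_sub_of_add_eq' e1]
      module
    | succ n =>
      have e1 := S.η₁_succ m (n + 1) (Cochain.proj K A (k + 1) (m + 1) (n + 1) h Ψ)
      have e2 := S.η₂_succ (m + 1) n
        (S.P₁ (m + 1) (n + 1) (Cochain.proj K A (k + 1) (m + 1) (n + 1) h Ψ))
      simp only [component₁, component₂, LinearMap.comp_apply, map_add,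
        map_smul, proj_homotopy, S.P₁_d₁, S.d₁_η₂, S.d₁_P₁,
        ← S.d₂_P₁, S.d₂_η₁, smul_zero, map_zero, add_zero, zero_add, smul_smul, smul_add,
        neg_one_pow_mul_self, one_smul, pow_succ, mul_neg, neg_mul, mul_one, neg_smul,
        neg_neg] at e1 e2 ⊢
      rw [eq_sub_of_add_eq' e2, eq_sub_of_add_eq' e1]
      module

theorem total_d {k : ℕ} (Ψ : Cochain K A k) : S.total (k + 1) (d K A k Ψ) = 0 := by
  refine proj_ext fun m n h => ?_
  rw [proj_total, proj_d, map_zero]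
  rcases m with _ | m <;> rcases n with _ | n <;>
  simp [component₁, component₂, S.P₁_d₁, ← S.d₂_P₁, S.P₂_d₂]

theorem d_total {k : ℕ} (Ψ : Cochain K A k) : d K A k (S.total k Ψ) = 0 := by
  refine proj_ext fun m n h => ?_
  rw [proj_d, map_zero]
  rcases m with _ | m <;> rcases n with _ | n <;>
  simp [component₁, component₂, S.d₁_P₁, S.d₂_P₂, S.d₁_P₂, proj_total]

theorem total_total {k : ℕ} (Ψ : Cochain K A k) : S.total k (S.total k Ψ) = S.total k Ψ := by
  refine proj_ext fun m n h => ?_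
  simp only [proj_total, S.P₁_P₂, S.P₁_P₁, S.P₂_P₂]

theorem homotopy_map_zero (k : ℕ) : S.homotopy k 0 = 0 :=
  proj_ext fun m n h => by simp [proj_homotopy]

theorem total_eq_zero_iff {k : ℕ} {Ψ : Cochain K A k} (hΨ : d K A k Ψ = 0) :
    S.total k Ψ = 0 ↔ Ψ ∈ coboundaries K A k := by
  constructor
  · intro h
    cases k with
    | zero =>
      have h3 := S.homotopy_zero Ψ
      rw [h, sub_zero, hΨ, homotopy_map_zero] at h3
      exact (Submodule.mem_bot K).2 h3.symm
    | succ k =>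
      have h3 := S.homotopy_succ Ψ
      rw [h, sub_zero, hΨ, homotopy_map_zero, add_zero] at h3
      exact ⟨_, h3⟩
  · intro h
    cases k with
    | zero => rw [(Submodule.mem_bot K).1 h, map_zero]
    | succ k =>
      obtain ⟨Φ, rfl⟩ := h
      exact S.total_d Φ

/-- The cohomology of the total complex is the range of the projection `P₂ P₁`. -/
def cohomologyEquivRange (k : ℕ) : Cohomology K A k ≃ₗ[K] LinearMap.range (S.total k) := by
  let F : LinearMap.ker (d K A k) →ₗ[K] LinearMap.range (S.total k) :=
    (S.total k).rangeRestrict ∘ₗ Submodule.subtype _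
  have hker : LinearMap.ker F = (coboundaries K A k).submoduleOf (LinearMap.ker (d K A k)) := by
    ext Ψ
    refine Iff.trans ?_ (S.total_eq_zero_iff Ψ.2)
    exact Subtype.ext_iff
  have hsurj : Function.Surjective F := by
    rintro ⟨_, Φ, rfl⟩
    exact ⟨⟨S.total k Φ, S.d_total Φ⟩, Subtype.ext (S.total_total Φ)⟩
  exact (Submodule.quotEquivOfEq _ _ hker.symm).trans (F.quotKerEquivOfSurjective hsurj)

/-- The range of `P₂ P₁` on the total complex is the direct sum of the ranges of its components. -/
def rangeTotalEquiv (k : ℕ) :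
    LinearMap.range (S.total k) ≃ₗ[K] ((p : Finset.HasAntidiagonal.antidiagonal k) →
      LinearMap.range (S.P₂ (p : ℕ × ℕ).1 (p : ℕ × ℕ).2 ∘ₗ S.P₁ (p : ℕ × ℕ).1 (p : ℕ × ℕ).2)) where
  toFun Ψ p := ⟨Ψ.1 p, by obtain ⟨_, Φ, rfl⟩ := Ψ; exact ⟨Φ p, rfl⟩⟩
  map_add' _ _ := rfl
  map_smul' _ _ := rfl
  invFun y := ⟨fun p => (y p).1, fun p => (y p).2.choose, funext fun p => (y p).2.choose_spec⟩
  left_inv _ := rfl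
  right_inv _ := rfl

end DoubleSplitting

end Total

/-! ### Calculus of polynomials -/

section Polynomial

open MvPolynomial

variable {K : Type*} [Field K] {ι : Type*}

/-- Linear maps out of a polynomial ring, prescribed on monomials. -/
def monomialLift {M : Type*} [AddCommGroup M] [Module K M] (f : (ι →₀ ℕ) → M) :
    MvPolynomial ι K →ₗ[K] M :=
  (basisMonomials ι K).constr K f

theorem monomialLift_monomial {M : Type*} [AddCommGroup M] [Module K M] (f : (ι →₀ ℕ) → M)
    (α : ι →₀ ℕ) (c : K) : monomialLift f (monomial α c) = c • f α := by
  have h : (monomial α c : MvPolynomial ι K) = c • basisMonomials ι K α := by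
    simp [smul_monomial]
  rw [h, map_smul, monomialLift, Module.Basis.constr_basis]

theorem monomial_ext {M : Type*} [AddCommGroup M] [Module K M] {f g : MvPolynomial ι K →ₗ[K] M}
    (h : ∀ α, f (monomial α 1) = g (monomial α 1)) : f = g :=
  (basisMonomials ι K).ext fun α => by simpa using h α

theorem X_mul_monomial (i : ι) (α : ι →₀ ℕ) (c : K) :
    X i * monomial α c = monomial (α + Finsupp.single i 1) c := by
  rw [X, monomial_mul, one_mul, add_comm]

/-- Division by a variable, discarding the remainder. -/
def divX (j : ι) : MvPolynomial ι K →ₗ[K] MvPolynomial ι K :=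
  monomialLift fun α => if α j = 0 then 0 else monomial (α - Finsupp.single j 1) 1

/-- Integration with respect to a variable. -/
def integral (j : ι) : MvPolynomial ι K →ₗ[K] MvPolynomial ι K :=
  monomialLift fun α => monomial (α + Finsupp.single j 1) ((α j : K) + 1)⁻¹

/-- Division of the degree `n` part by `n + 1`. -/
def divDegree [Fintype ι] : MvPolynomial ι K →ₗ[K] MvPolynomial ι K :=
  monomialLift fun α => monomial α (((∑ j, α j : ℕ) : K) + 1)⁻¹

theorem divX_X_mul (j : ι) (p : MvPolynomial ι K) : divX j (X j * p) = p := by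
  have : divX j ∘ₗ LinearMap.mulLeft K (X j) = (LinearMap.id : MvPolynomial ι K →ₗ[K] _) :=
    monomial_ext fun α => by
      simp [X_mul_monomial, divX, monomialLift_monomial]
  exact LinearMap.congr_fun this p

theorem single_sub_comm [DecidableEq ι] {i j : ι} (h : i ≠ j) (α : ι →₀ ℕ) :
    α + Finsupp.single i 1 - Finsupp.single j 1 = α - Finsupp.single j 1 + Finsupp.single i 1 := by
  ext k
  by_cases hj : j = k
  · subst hj
    simp [h]
  · simp [Finsupp.single_apply, hj]

theorem divX_X_mul_of_ne [DecidableEq ι] {i j : ι} (h : i ≠ j) (p : MvPolynomial ι K) :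
    divX j (X i * p) = X i * divX j p := by
  have : divX j ∘ₗ LinearMap.mulLeft K (X i) =
      LinearMap.mulLeft K (X i) ∘ₗ (divX j : MvPolynomial ι K →ₗ[K] _) :=
    monomial_ext fun α => by
      by_cases hα : α j = 0 <;>
      simp [X_mul_monomial, divX, monomialLift_monomial, h, hα,
        single_sub_comm h]
  exact LinearMap.congr_fun this p

theorem pderiv_integral [CharZero K] (j : ι) (p : MvPolynomial ι K) :
    pderiv j (integral j p) = p := by
  have : (pderiv j).toLinearMap ∘ₗ integral j = (LinearMap.id : MvPolynomial ι K →ₗ[K] _) :=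
    monomial_ext fun α => by
      have h : (α j : K) + 1 ≠ 0 := by exact_mod_cast Nat.succ_ne_zero (α j)
      simp [integral, monomialLift_monomial, pderiv_monomial, h]
  exact LinearMap.congr_fun this p

theorem pderiv_integral_of_ne [DecidableEq ι] {i j : ι} (h : i ≠ j) (p : MvPolynomial ι K) :
    pderiv i (integral j p) = integral j (pderiv i p) := by
  have : (pderiv i).toLinearMap ∘ₗ integral j =
      integral j ∘ₗ ((pderiv i).toLinearMap : MvPolynomial ι K →ₗ[K] _) :=
    monomial_ext fun α => by
      by_cases hα : α i = 0
      · simp [integral, monomialLift_monomial, pderiv_monomial, h.symm, hα]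
      · simp [integral, monomialLift_monomial, pderiv_monomial, h, h.symm,
          single_sub_comm h.symm, smul_monomial, mul_comm]
  exact LinearMap.congr_fun this p

theorem pderiv_comm [DecidableEq ι] (i j : ι) (p : MvPolynomial ι K) :
    pderiv i (pderiv j p) = pderiv j (pderiv i p) := by
  by_cases h : i = j
  · rw [h]
  have : (pderiv i).toLinearMap ∘ₗ (pderiv j).toLinearMap =
      (pderiv j).toLinearMap ∘ₗ ((pderiv i).toLinearMap : MvPolynomial ι K →ₗ[K] _) :=
    monomial_ext fun α => by
      simp [pderiv_monomial, h, Ne.symm h, tsub_right_comm, mul_comm]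
  exact LinearMap.congr_fun this p

/-- Euler's identity `∑ⱼ xⱼ ∂ⱼ p = deg p • p`, divided by the degree. A derivative has degree one
less, which is why `divDegree` divides by `n + 1` in degree `n`. -/
theorem sum_X_mul_divDegree_pderiv [Fintype ι] [DecidableEq ι] [CharZero K]
    (p : MvPolynomial ι K) :
    C (coeff 0 p) + ∑ j, X j * divDegree (pderiv j p) = p := by
  have h1 : ∀ (α : ι →₀ ℕ) (j : ι), X j * divDegree (pderiv j (monomial α (1 : K))) =
      monomial α ((α j : K) * ((∑ j, α j : ℕ) : K)⁻¹) := by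
    intro α j
    by_cases hα : α j = 0
    · simp [pderiv_monomial, hα]
    have h3 : α - Finsupp.single j 1 + Finsupp.single j 1 = α := by
      refine tsub_add_cancel_of_le ?_
      rw [Finsupp.single_le_iff]
      omega
    have h2 : (∑ k, (α - Finsupp.single j 1 : ι →₀ ℕ) k) + 1 = ∑ k, α k := by
      calc (∑ k, (α - Finsupp.single j 1 : ι →₀ ℕ) k) + 1
          = ∑ k, (α - Finsupp.single j 1 + Finsupp.single j 1 : ι →₀ ℕ) k := by
            simp [Finset.sum_add_distrib, Finsupp.single_apply]
        _ = ∑ k, α k := by rw [h3]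
    rw [pderiv_monomial, one_mul, divDegree, monomialLift_monomial, ← h2, mul_smul_comm,
      X_mul_monomial, h3, smul_monomial, smul_eq_mul]
    push_cast
    rfl
  have : Algebra.linearMap K _ ∘ₗ lcoeff K 0 +
      ∑ j, LinearMap.mulLeft K (X j) ∘ₗ divDegree ∘ₗ (pderiv j).toLinearMap =
      (LinearMap.id : MvPolynomial ι K →ₗ[K] _) := by
    refine monomial_ext fun α => ?_
    have h5 : (Algebra.linearMap K (MvPolynomial ι K) ∘ₗ lcoeff K 0 +
      ∑ j, LinearMap.mulLeft K (X j) ∘ₗ divDegree ∘ₗ (pderiv j).toLinearMap :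
        MvPolynomial ι K →ₗ[K] _) (monomial α 1) =
      C (coeff 0 (monomial α 1)) + ∑ j, X j * divDegree (pderiv j (monomial α (1 : K))) := by
      simp [algebraMap_eq, lcoeff, LinearMap.sum_apply]
    rw [h5]
    simp only [h1, ← map_sum, ← Finset.sum_mul, LinearMap.id_apply]
    by_cases hα : α = 0
    · subst hα
      simp
    · have h6 : ((∑ j, α j : ℕ) : K) ≠ 0 := by
        rw [Nat.cast_ne_zero]
        intro h
        apply hα
        ext j
        simpa using (Finset.sum_eq_zero_iff.1 h) j (Finset.mem_univ j)
      rw [coeff_monomial, if_neg hα, map_zero, zero_add, ← Nat.cast_sum, mul_inv_cancel₀ h6]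
  have h := LinearMap.congr_fun this p
  simpa [algebraMap_eq, lcoeff] using h

end Polynomial

/-! ### Polynomial coordinates on the symmetric algebra -/

section Coordinates

variable (K A : Type*) [Field K] [CommRing A] [Bialgebra K A] (ι : Type*) [Fintype ι]

/-- The structure of a polynomial ring on a bialgebra `A` used in the computation of the bar and
cobar complexes: coordinates `x i` vanishing at the counit, translation-invariant partial derivatives
`D i`, one-sided inverses of both, and Euler's identity. -/
structure PolynomialCoordinates where
  /-- the coordinates -/
  x : ι → A
  /-- division by a coordinate -/
  divX : ι → A →ₗ[K] A
  /-- partial derivatives -/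
  D : ι → A →ₗ[K] A
  /-- integration with respect to a coordinate -/
  I : ι → A →ₗ[K] A
  /-- division by the degree plus one, for use on derivatives in Euler's identity -/
  N : A →ₗ[K] A
  counit_x : ∀ i, Coalgebra.counit (R := K) (x i) = 0
  divX_mul : ∀ i a, divX i (x i * a) = a
  divX_mul_of_ne : ∀ i j a, i ≠ j → divX j (x i * a) = x i * divX j a
  D_comm : ∀ i j a, D i (D j a) = D j (D i a)
  D_I : ∀ i a, D i (I i a) = a
  D_I_of_ne : ∀ i j a, i ≠ j → D i (I j a) = I j (D i a)
  D_one : ∀ i, D i 1 = 0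
  comul_D : ∀ i a, Coalgebra.comul (R := K) (D i a) = (D i).rTensor A (Coalgebra.comul a)
  euler : ∀ a, algebraMap K A (Coalgebra.counit a) + ∑ i, x i * N (D i a) = a

end Coordinates

section Symmetric

variable {K V : Type*} [Field K] [AddCommGroup V] [Module K V] {ι : Type*} (b : Module.Basis ι K V)

/-- The endomorphism of `S(V)` which is `f` in the polynomial coordinates given by a basis. -/
def conjPoly (f : MvPolynomial ι K →ₗ[K] MvPolynomial ι K) :
    SymmetricAlgebra K V →ₗ[K] SymmetricAlgebra K V :=
  (SymmetricAlgebra.equivMvPolynomial b).symm.toLinearMap ∘ₗ f ∘ₗ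
    (SymmetricAlgebra.equivMvPolynomial b).toLinearMap

theorem conjPoly_apply (f : MvPolynomial ι K →ₗ[K] MvPolynomial ι K) (a : SymmetricAlgebra K V) :
    conjPoly b f a = (SymmetricAlgebra.equivMvPolynomial b).symm
      (f (SymmetricAlgebra.equivMvPolynomial b a)) := rfl

theorem counit_eq_coeff_zero (a : SymmetricAlgebra K V) :
    Coalgebra.counit (R := K) a =
      MvPolynomial.coeff 0 (SymmetricAlgebra.equivMvPolynomial b a) := by
  have h : Bialgebra.counitAlgHom K (SymmetricAlgebra K V) =
      (MvPolynomial.aeval (fun _ => (0 : K))).comp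
        (SymmetricAlgebra.equivMvPolynomial b).toAlgHom := by
    refine SymmetricAlgebra.algHom_ext (b.ext fun i => ?_)
    simp [SymmetricAlgebra.algebraMapInv_ι]
  have h' := DFunLike.congr_fun h a
  rw [← MvPolynomial.constantCoeff_eq]
  simpa [MvPolynomial.aeval_zero', -SymmetricAlgebra.counitAlgHom_eq] using h'

/-- Partial derivatives are translation invariant. -/
theorem comul_conjPoly_pderiv [DecidableEq ι] (j : ι) (a : SymmetricAlgebra K V) :
    Coalgebra.comul (R := K) (conjPoly b (MvPolynomial.pderiv j).toLinearMap a) =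
      (conjPoly b (MvPolynomial.pderiv j).toLinearMap).rTensor _ (Coalgebra.comul a) := by
  set D := conjPoly b (MvPolynomial.pderiv j).toLinearMap with hD
  have hmul : ∀ a c, D (a * c) = D a * c + a * D c := by
    intro a c
    simp only [hD, conjPoly_apply, map_mul, Derivation.coeFn_coe, MvPolynomial.pderiv_mul,
      map_add, AlgEquiv.symm_apply_apply]
  have hone : D 1 = 0 := by simp [hD, conjPoly_apply]
  have hT : ∀ u v : SymmetricAlgebra K V ⊗[K] SymmetricAlgebra K V,
      D.rTensor _ (u * v) = D.rTensor _ u * v + u * D.rTensor _ v := by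
    intro u v
    induction u with
    | zero => simp
    | add u u' hu hu' => simp only [add_mul, map_add, hu, hu']; abel
    | tmul a c =>
      induction v with
      | zero => simp
      | add v v' hv hv' => simp only [mul_add, map_add, hv, hv']; abel
      | tmul a' c' => simp [hmul, TensorProduct.add_tmul]
  have hι : ∀ v : V, ∃ r : K, D (SymmetricAlgebra.ι K V v) = algebraMap K _ r := by
    intro v
    refine ⟨b.repr v j, ?_⟩
    have : D ∘ₗ SymmetricAlgebra.ι K V =
        Algebra.linearMap K _ ∘ₗ Finsupp.lapply j ∘ₗ b.repr.toLinearMap := by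
      refine b.ext fun i => ?_
      by_cases h : i = j
      · subst h
        simp [hD, conjPoly_apply]
      · simp [hD, conjPoly_apply, h, MvPolynomial.pderiv_X_of_ne h]
    exact LinearMap.congr_fun this v
  induction a using SymmetricAlgebra.induction with
  | algebraMap r =>
    simp [Algebra.algebraMap_eq_smul_one, hone, Bialgebra.comul_one,
      Algebra.TensorProduct.one_def]
  | ι v =>
    obtain ⟨r, hr⟩ := hι v
    rw [hr]
    simp [Algebra.algebraMap_eq_smul_one, hone, hr, Bialgebra.comul_one,
      Algebra.TensorProduct.one_def, TensorProduct.smul_tmul']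
  | mul a c ha hc => rw [hmul, map_add, Bialgebra.comul_mul, Bialgebra.comul_mul, ha, hc,
      Bialgebra.comul_mul, hT]
  | add a c ha hc => rw [map_add, map_add, ha, hc, map_add, map_add]

/-- A basis of `V` gives polynomial coordinates on `S(V)`. -/
def symmetricCoordinates [CharZero K] [Fintype ι] [DecidableEq ι] :
    PolynomialCoordinates K (SymmetricAlgebra K V) ι where
  x i := SymmetricAlgebra.ι K V (b i)
  divX i := conjPoly b (divX i)
  D i := conjPoly b (MvPolynomial.pderiv i).toLinearMap
  I i := conjPoly b (integral i)
  N := conjPoly b divDegree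
  counit_x i := SymmetricAlgebra.counit_ι _ _ _
  divX_mul i a := by simp [conjPoly_apply, divX_X_mul]
  divX_mul_of_ne i j a h := by
    simp only [conjPoly_apply, map_mul, SymmetricAlgebra.equivMvPolynomial_ι_apply,
      divX_X_mul_of_ne h, SymmetricAlgebra.equivMvPolynomial_symm_X]
  D_comm i j a := by simp [conjPoly_apply, pderiv_comm i j]
  D_I i a := by simp [conjPoly_apply, pderiv_integral]
  D_I_of_ne i j a h := by simp [conjPoly_apply, pderiv_integral_of_ne h]
  D_one i := by simp [conjPoly_apply]
  comul_D i a := comul_conjPoly_pderiv b i a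
  euler a := by
    apply (SymmetricAlgebra.equivMvPolynomial b).injective
    conv_rhs => rw [← sum_X_mul_divDegree_pderiv (SymmetricAlgebra.equivMvPolynomial b a)]
    simp [conjPoly_apply, counit_eq_coeff_zero b, MvPolynomial.algebraMap_eq]

/-- The antipode of `S(V)`, `v ↦ -v`. -/
def symmetricAntipode (K V : Type*) [Field K] [AddCommGroup V] [Module K V] :
    SymmetricAlgebra K V →ₐ[K] SymmetricAlgebra K V :=
  SymmetricAlgebra.lift (-SymmetricAlgebra.ι K V)

theorem mul_lTensor_symmetricAntipode (a : SymmetricAlgebra K V) :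
    LinearMap.mul' K _ ((symmetricAntipode K V).toLinearMap.lTensor _ (Coalgebra.comul a)) =
      algebraMap K _ (Coalgebra.counit a) := by
  have h : (Algebra.TensorProduct.lift (AlgHom.id K (SymmetricAlgebra K V))
        (symmetricAntipode K V) fun _ _ => Commute.all _ _).comp
        (Bialgebra.comulAlgHom K (SymmetricAlgebra K V)) =
      (Algebra.ofId K _).comp (Bialgebra.counitAlgHom K (SymmetricAlgebra K V)) := by
    refine SymmetricAlgebra.algHom_ext (LinearMap.ext fun v => ?_)
    simp [symmetricAntipode, SymmetricAlgebra.algebraMapInv_ι]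
  have h' := DFunLike.congr_fun h a
  have e : ∀ u : SymmetricAlgebra K V ⊗[K] SymmetricAlgebra K V,
      LinearMap.mul' K _ ((symmetricAntipode K V).toLinearMap.lTensor _ u) =
      Algebra.TensorProduct.lift (AlgHom.id K (SymmetricAlgebra K V))
        (symmetricAntipode K V) (fun _ _ => Commute.all _ _) u := by
    intro u
    induction u with
    | zero => simp
    | add u u' hu hu' => simp only [map_add, hu, hu']
    | tmul a c => simp
  rw [e]
  exact h'

end Symmetric

/-! ### Cohomology of the bar and cobar complexes -/

section Acyclicity
universe u
variable {K : Type*} [Field K] {X : ℕ → Type u} [∀ n, AddCommGroup (X n)] [∀ n, Module K (X n)]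
  (d : ∀ n, X n →ₗ[K] X (n + 1))

theorem rank_subCohomology_top_zero {e₀ : X 0} (he : e₀ ≠ 0) (hd : d 0 e₀ = 0)
    (h : ∀ x, d 0 x = 0 → ∃ r : K, x = r • e₀) :
    Module.rank K (SubCohomology d (fun _ => ⊤) 0) = 1 := by
  have h1 : (subCoboundaries d (fun _ => ⊤) 0).submoduleOf (LinearMap.ker (d 0) ⊓ ⊤) = ⊥ := by
    rw [Submodule.submoduleOf, subCoboundaries, ← LinearMap.ker_eq_bot_of_injective
      (Submodule.subtype_injective (LinearMap.ker (d 0) ⊓ ⊤))]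
    rfl
  rw [(Submodule.quotEquivOfEqBot _ h1).rank_eq, rank_submodule_eq_one_iff]
  refine ⟨e₀, ⟨hd, trivial⟩, he, ?_⟩
  rintro x ⟨hx, -⟩
  obtain ⟨r, rfl⟩ := h x hx
  exact Submodule.smul_mem _ _ (Submodule.mem_span_singleton_self _)

theorem rank_subCohomology_top_succ {n : ℕ} (h : ∀ x, d (n + 1) x = 0 → ∃ y, d n y = x) :
    Module.rank K (SubCohomology d (fun _ => ⊤) (n + 1)) = 0 := by
  have h1 : (subCoboundaries d (fun _ => ⊤) (n + 1)).submoduleOf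
      (LinearMap.ker (d (n + 1)) ⊓ ⊤) = ⊤ := by
    rw [Submodule.submoduleOf_eq_top]
    rintro x ⟨hx, -⟩
    obtain ⟨y, rfl⟩ := h x hx
    exact ⟨y, trivial, rfl⟩
  have := Submodule.Quotient.subsingleton_iff.2 h1
  exact rank_subsingleton' _ _

end Acyclicity

section KoszulCohomology

variable {K A : Type*} [Field K] [CommRing A] [Bialgebra K A] {ι : Type*} [Fintype ι]

theorem augFirst_consOne_apply {m : ℕ} (y : ⨂[K]^m A) : augFirst m (consOne m y) = y :=
  LinearMap.congr_fun (augFirst_consOne m) y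

/-- The unit of `A^{⊗ 0}` is nonzero. -/
theorem isEmptyEquiv_one_ne_zero :
    PiTensorProduct.isEmptyEquiv (R := K) (s := fun _ : Fin 0 => A) (Fin 0) 1 ≠ 0 := by
  intro h
  have h1 : (1 : ⨂[K]^0 A) = 0 := (LinearEquiv.map_eq_zero_iff _).1 h
  have : Subsingleton (⨂[K]^0 A) := subsingleton_of_zero_eq_one h1.symm
  exact not_subsingleton K
    (PiTensorProduct.isEmptyEquiv (R := K) (s := fun _ : Fin 0 => A) (Fin 0)).symm.subsingleton

theorem cobar_comp_cobar (n : ℕ) :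
    cobar (n + 1) ∘ₗ cobar n = (0 : (⨂[K]^n A) →ₗ[K] ⨂[K]^(n + 2) A) := by
  have h : consOne (n + 2) ∘ₗ cobar (n + 1) ∘ₗ cobar n =
      (0 : (⨂[K]^n A) →ₗ[K] ⨂[K]^(n + 3) A) := by
    rw [← LinearMap.comp_assoc, ← cobarRes_consOne, LinearMap.comp_assoc, ← cobarRes_consOne,
      ← LinearMap.comp_assoc, cobarRes_comp_cobarRes, LinearMap.zero_comp]
  refine LinearMap.ext fun y => ?_
  have h1 := congrArg (augFirst (n + 2)) (LinearMap.congr_fun h y)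
  rw [LinearMap.comp_apply, augFirst_consOne_apply] at h1
  exact h1.trans (map_zero _)

theorem firstMap_firstMap {m : ℕ} {f g : A →ₗ[K] A} (h : ∀ a, f (g a) = g (f a))
    (z : ⨂[K]^(m + 1) A) : firstMap m f (firstMap m g z) = firstMap m g (firstMap m f z) := by
  have := LinearMap.congr_fun (firstMap_comp (m := m) f g) z
  have h2 := LinearMap.congr_fun (firstMap_comp (m := m) g f) z
  simp only [LinearMap.comp_apply] at this h2
  rw [this, h2]
  congr 2
  exact LinearMap.ext h

theorem firstMap_firstMap_id {m : ℕ} {f g : A →ₗ[K] A} (h : ∀ a, f (g a) = a)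
    (z : ⨂[K]^(m + 1) A) : firstMap m f (firstMap m g z) = z := by
  have := LinearMap.congr_fun (firstMap_comp (m := m) f g) z
  simp only [LinearMap.comp_apply] at this
  rw [this, show f ∘ₗ g = LinearMap.id from LinearMap.ext h, firstMap_id, LinearMap.id_apply]

theorem firstMap_restMap_apply {m n : ℕ} (g : A →ₗ[K] A) (f : (⨂[K]^m A) →ₗ[K] ⨂[K]^n A)
    (z : ⨂[K]^(m + 1) A) : firstMap n g (restMap f z) = restMap f (firstMap m g z) :=
  LinearMap.congr_fun (firstMap_restMap g f) z

/-- Euler's identity in the first tensor factor. -/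
theorem PolynomialCoordinates.euler_firstMap (C : PolynomialCoordinates K A ι) {m : ℕ}
    (z : ⨂[K]^(m + 1) A) :
    consOne m (augFirst m z) +
      ∑ i, firstMap m (LinearMap.mulLeft K (C.x i)) (firstMap m C.N (firstMap m (C.D i) z)) =
      z := by
  induction z using cons_induction with
  | zero => simp
  | add y y' hy hy' =>
    simp only [map_add, Finset.sum_add_distrib]
    conv_rhs => rw [← hy, ← hy']
    abel
  | cons a y =>
    simp only [augFirst_cons, consOne_apply, firstMap_cons, ← map_sum, ← TensorProduct.sum_tmul,
      ← TensorProduct.smul_tmul, ← map_add, ← TensorProduct.add_tmul,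
      LinearMap.mulLeft_apply, ← Algebra.algebraMap_eq_smul_one, C.euler]

/-- The cobar complex of a polynomial bialgebra has the cohomology of an exterior algebra. -/
theorem PolynomialCoordinates.rank_cobar (C : PolynomialCoordinates K A ι)
    [Coalgebra.IsCocomm K A] (n : ℕ) :
    Module.rank K (SubCohomology (fun n => cobar (K := K) (A := A) n) (fun _ => ⊤) n) =
      ((Fintype.card ι).choose n : ℕ) := by
  classical
  have hl : ∀ i a, TensorProduct.lid K A
      ((Coalgebra.counit (R := K) ∘ₗ C.D i).rTensor A (Coalgebra.comul a)) = C.D i a := by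
    intro i a
    rw [LinearMap.rTensor_comp_apply, ← C.comul_D, Coalgebra.rTensor_counit_comul]
    simp
  -- Cocommutativity turns convolution on one side into convolution on the other.
  have hr : ∀ i a, TensorProduct.rid K A
      ((Coalgebra.counit (R := K) ∘ₗ C.D i).lTensor A (Coalgebra.comul a)) = C.D i a := by
    intro i a
    have e : ∀ u : A ⊗[K] A, TensorProduct.rid K A ((Coalgebra.counit (R := K) ∘ₗ C.D i).lTensor A
        (TensorProduct.comm K A A u)) = TensorProduct.lid K A
          ((Coalgebra.counit (R := K) ∘ₗ C.D i).rTensor A u) := by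
      intro u
      induction u with
      | zero => simp
      | add u u' hu hu' => simp only [map_add, hu, hu']
      | tmul b c => simp
    rw [← Coalgebra.comm_comul K a, e, hl]
  have hl1 : ∀ i, (Coalgebra.counit (R := K) ∘ₗ C.D i) 1 = 0 := fun i => by simp [C.D_one]
  rw [rank_subCohomology_range (fun n => cobarRes (K := K) (A := A) (n + 1))
    (fun n => cobar (K := K) (A := A) n) (fun n => consOne n)
    (fun n => Function.LeftInverse.injective augFirst_consOne_apply)
    (fun n y => LinearMap.congr_fun cobarRes_consOne y)]
  -- By Euler's identity `1 ⊗ A^{⊗ n}` consists of the tensors killed by all derivatives of the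
  -- first factor.
  have hF : (fun n => LinearMap.range (consOne (K := K) (A := A) n)) =
      fun n => ⨅ j ∈ (Finset.univ : Finset ι), LinearMap.ker (firstMap n (C.D j)) := by
    funext n
    ext z
    simp only [Submodule.mem_iInf, Finset.mem_univ, true_implies, LinearMap.mem_ker]
    constructor
    · rintro ⟨y, rfl⟩ i
      simp [consOne_apply, firstMap_cons, C.D_one]
    · intro h
      refine ⟨augFirst n z, ?_⟩
      have := C.euler_firstMap z
      simpa [h] using this
  rw [hF]
  refine rank_subCohomology_iInf_ker (fun n => cobarRes (K := K) (A := A) (n + 1))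
    (φ := fun i n => firstMap n (C.D i)) (σ := fun i n => firstMap n (C.I i))
    (s := fun i n => restMap (deletion (Coalgebra.counit (R := K) ∘ₗ C.D i) n))
    (fun n x => LinearMap.congr_fun (cobarRes_comp_cobarRes (n + 1)) x)
    (fun i j n x => firstMap_firstMap (C.D_comm i j) x)
    (fun i n x => firstMap_firstMap_id (C.D_I i) x)
    (fun i j n x h => firstMap_firstMap (fun a => C.D_I_of_ne i j a h) x)
    (fun i n x => (LinearMap.congr_fun (cobarRes_firstMap (C.comul_D i)) x).symm)
    (fun i x => (LinearMap.congr_fun (deletion_homotopy_zero (hl1 i) (hr i)) x).symm)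
    (fun i n x => (LinearMap.congr_fun (deletion_homotopy_succ (hl1 i) (hl i) (hr i) n) x).symm)
    (fun i j n x _ => firstMap_restMap_apply _ _ _)
    ?_ ?_ Finset.univ n
  · have inj : Function.Injective (cobarRes (K := K) (A := A) 0) := by
      refine Function.LeftInverse.injective (g := augFirst 0) fun y => ?_
      simp [cobarRes_zero, augFirst_cons]
    have hone : (1 : ⨂[K]^0 A) ≠ 0 := fun h =>
      isEmptyEquiv_one_ne_zero (K := K) (A := A) (by rw [h, map_zero])
    refine rank_subCohomology_top_zero _ (e₀ := cobarRes 0 1)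
      (fun h => hone (inj (by rw [h, map_zero]))) ?_ ?_
    · exact LinearMap.congr_fun (cobarRes_comp_cobarRes 0) 1
    · intro z hz
      have h1 := LinearMap.congr_fun augFirst_cobarRes z
      obtain ⟨r, hr⟩ := exists_smul_one (augFirst 0 z)
      refine ⟨r, ?_⟩
      rw [← map_smul, ← hr]
      simp only [LinearMap.comp_apply, LinearMap.sub_apply, LinearMap.id_apply] at h1
      rw [hz, map_zero] at h1
      exact sub_eq_zero.1 h1.symm
  · intro n
    refine rank_subCohomology_top_succ _ fun z hz => ⟨augFirst (n + 1) z, ?_⟩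
    have h1 := LinearMap.congr_fun augFirst_cobarRes z
    simp only [LinearMap.comp_apply, LinearMap.sub_apply, LinearMap.id_apply] at h1
    rw [hz, map_zero] at h1
    exact (sub_eq_zero.1 h1.symm).symm

/-- The dual of the bar complex of a polynomial bialgebra has the cohomology of an exterior
algebra. -/
theorem PolynomialCoordinates.rank_dual_bar (C : PolynomialCoordinates K A ι) (m : ℕ) :
    Module.rank K (SubCohomology (X := fun m => Module.Dual K (⨂[K]^m A))
      (fun m => (bar (K := K) (A := A) m).dualMap) (fun _ => ⊤) m) =
      ((Fintype.card ι).choose m : ℕ) := by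
  classical
  have surj : ∀ m, Function.Surjective (augFirst (K := K) (A := A) m) := fun m =>
    Function.RightInverse.surjective augFirst_consOne_apply
  rw [rank_subCohomology_range (X := fun m => Module.Dual K (⨂[K]^(m + 1) A))
    (fun m => (barRes (K := K) (A := A) (m + 1)).dualMap)
    (fun m => (bar (K := K) (A := A) m).dualMap) (fun m => (augFirst m).dualMap)
    (fun m => LinearMap.dualMap_injective_of_surjective (surj m))
    (fun m f => LinearMap.ext fun z =>
      congrArg f (LinearMap.congr_fun (augFirst_barRes m) z))]
  -- By Euler's identity the kernel of the counit is the ideal generated by the coordinates.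
  have hF : (fun m => LinearMap.range (augFirst (K := K) (A := A) m).dualMap) =
      fun m => ⨅ j ∈ (Finset.univ : Finset ι),
        LinearMap.ker (firstMap m (LinearMap.mulLeft K (C.x j))).dualMap := by
    funext m
    ext f
    simp only [Submodule.mem_iInf, Finset.mem_univ, true_implies, LinearMap.mem_ker]
    constructor
    · rintro ⟨g, rfl⟩ i
      refine hom_ext_cons fun a y => ?_
      simp [LinearMap.dualMap_apply, firstMap_cons, augFirst_cons, C.counit_x]
    · intro h
      refine ⟨(consOne m).dualMap f, LinearMap.ext fun z => ?_⟩
      have h1 := congrArg f (C.euler_firstMap z)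
      have h2 : ∀ i z, f (firstMap m (LinearMap.mulLeft K (C.x i)) z) = 0 := fun i z =>
        LinearMap.congr_fun (h i) z
      rw [map_add, map_sum] at h1
      simpa [h2] using h1
  rw [hF]
  refine rank_subCohomology_iInf_ker (X := fun m => Module.Dual K (⨂[K]^(m + 1) A))
    (fun m => (barRes (K := K) (A := A) (m + 1)).dualMap)
    (φ := fun i m => (firstMap m (LinearMap.mulLeft K (C.x i))).dualMap)
    (σ := fun i m => (firstMap m (C.divX i)).dualMap)
    (s := fun i m => (restMap (insertion (C.x i) m)).dualMap)
    (fun m f => LinearMap.ext fun z => ?_)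
    (fun i j m f => LinearMap.ext fun z => ?_)
    (fun i m f => LinearMap.ext fun z => ?_)
    (fun i j m f h => LinearMap.ext fun z => ?_)
    (fun i m f => LinearMap.ext fun z => ?_)
    (fun i f => LinearMap.ext fun z => ?_)
    (fun i m f => LinearMap.ext fun z => ?_)
    (fun i j m f h => LinearMap.ext fun z => ?_)
    ?_ ?_ Finset.univ m
  · change f (barRes (m + 1) (barRes (m + 2) z)) = 0
    rw [show barRes (m + 1) (barRes (m + 2) z) = 0 from
      LinearMap.congr_fun (barRes_comp_barRes (m + 1)) z, map_zero]
  · exact congrArg f (firstMap_firstMap (fun a => mul_left_comm _ _ _) z)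
  · exact congrArg f (firstMap_firstMap_id (C.divX_mul i) z)
  · exact congrArg f (firstMap_firstMap (fun a => C.divX_mul_of_ne i j a h) z)
  · exact congrArg f (LinearMap.congr_fun (barRes_firstMap (C.x i)) z)
  · exact congrArg f (LinearMap.congr_fun (insertion_homotopy_zero (C.counit_x i)) z).symm
  · have := congrArg f (LinearMap.congr_fun (insertion_homotopy_succ (C.counit_x i) m) z)
    rw [LinearMap.add_apply, map_add, add_comm] at this
    exact this.symm
  · exact congrArg f (firstMap_restMap_apply _ _ _).symm
  · let e : (⨂[K]^0 A) ≃ₗ[K] K := PiTensorProduct.isEmptyEquiv (Fin 0)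
    have e_one : e 1 ≠ 0 := isEmptyEquiv_one_ne_zero
    refine rank_subCohomology_top_zero _ (e₀ := e.toLinearMap ∘ₗ barRes 0) ?_ ?_ ?_
    · intro h
      apply e_one
      have := LinearMap.congr_fun h (consEquiv K A 0 (1 ⊗ₜ 1))
      simpa [barRes_zero_cons] using this
    · refine LinearMap.ext fun z => ?_
      change e (barRes 0 (barRes 1 z)) = 0
      rw [show barRes 0 (barRes 1 z) = 0 from LinearMap.congr_fun (barRes_comp_barRes 0) z,
        map_zero]
    · intro f hf
      have h2 : ∀ z, f (barRes 1 z) = 0 := fun z => LinearMap.congr_fun hf z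
      refine ⟨(e 1)⁻¹ * f (consOne 0 1), LinearMap.ext fun z => ?_⟩
      have h1 := congrArg f (LinearMap.congr_fun barRes_consOne z)
      simp only [LinearMap.comp_apply, LinearMap.sub_apply, LinearMap.id_apply] at h1
      rw [h2, map_sub] at h1
      rw [sub_eq_zero.1 h1.symm]
      change _ = (e 1)⁻¹ * f (consOne 0 1) * e (barRes 0 z)
      obtain ⟨r, hr⟩ := exists_smul_one (barRes 0 z)
      rw [hr]
      simp only [map_smul, smul_eq_mul]
      field_simp
  · intro m
    refine rank_subCohomology_top_succ _ fun f hf => ⟨(consOne (m + 1)).dualMap f,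
      LinearMap.ext fun z => ?_⟩
    have h2 : ∀ z, f (barRes (m + 2) z) = 0 := fun z => LinearMap.congr_fun hf z
    have h1 := congrArg f (LinearMap.congr_fun barRes_consOne z)
    simp only [LinearMap.comp_apply, LinearMap.sub_apply, LinearMap.id_apply] at h1
    rw [h2, map_sub] at h1
    exact (sub_eq_zero.1 h1.symm).symm

end KoszulCohomology

/-! ### The Gerstenhaber–Schack cohomology of a polynomial bialgebra -/

section SplitComplex

variable {K A : Type*} [Field K] [CommRing A] [Bialgebra K A] [Coalgebra.IsCocomm K A]
  {S : A →ₗ[K] A}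

/-- Twisting by the iterated comultiplication, an automorphism of `Hom(A^{⊗ m}, A^{⊗ n})` in the
presence of an antipode. -/
def twistEquiv (hS : ∀ a, LinearMap.mul' K A (S.lTensor A (Coalgebra.comul a)) =
    algebraMap K A (Coalgebra.counit a)) (m n : ℕ) :
    ((⨂[K]^m A) →ₗ[K] ⨂[K]^n A) ≃ₗ[K] ((⨂[K]^m A) →ₗ[K] ⨂[K]^n A) :=
  LinearEquiv.ofLinearMap (twist m (iterComul K A n)) (twist m (iterComul K A n ∘ₗ S))
    (LinearMap.ext fun f =>
      (twist_twist_of_antipode S hS (iterComul_mul n) (iterComul_one n) f).1)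
    (LinearMap.ext fun f =>
      (twist_twist_of_antipode S hS (iterComul_mul n) (iterComul_one n) f).2)

theorem d₁_twistEquiv (hS : ∀ a, LinearMap.mul' K A (S.lTensor A (Coalgebra.comul a)) =
    algebraMap K A (Coalgebra.counit a)) {m n : ℕ} (f : (⨂[K]^m A) →ₗ[K] ⨂[K]^n A) :
    d₁ K A m n (twistEquiv hS m n f) = twistEquiv hS (m + 1) n (f ∘ₗ bar m) := d₁_twist f

theorem d₂_twistEquiv (hS : ∀ a, LinearMap.mul' K A (S.lTensor A (Coalgebra.comul a)) =
    algebraMap K A (Coalgebra.counit a)) {m n : ℕ} (f : (⨂[K]^m A) →ₗ[K] ⨂[K]^n A) :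
    d₂ K A m n (twistEquiv hS m n f) = twistEquiv hS m (n + 1) (cobar n ∘ₗ f) := d₂_twist f

/-- The map `f ↦ q ∘ f ∘ p`, transported along the twist. -/
def twistConj (hS : ∀ a, LinearMap.mul' K A (S.lTensor A (Coalgebra.comul a)) =
    algebraMap K A (Coalgebra.counit a)) {m n m' n' : ℕ} (p : (⨂[K]^m' A) →ₗ[K] ⨂[K]^m A)
    (q : (⨂[K]^n A) →ₗ[K] ⨂[K]^n' A) :
    ((⨂[K]^m A) →ₗ[K] ⨂[K]^n A) →ₗ[K] ((⨂[K]^m' A) →ₗ[K] ⨂[K]^n' A) :=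
  (twistEquiv hS m' n').toLinearMap ∘ₗ LinearMap.compRight K q ∘ₗ LinearMap.lcomp K _ p ∘ₗ
    (twistEquiv hS m n).symm.toLinearMap

theorem twistConj_twistEquiv (hS : ∀ a, LinearMap.mul' K A (S.lTensor A (Coalgebra.comul a)) =
    algebraMap K A (Coalgebra.counit a)) {m n m' n' : ℕ} (p : (⨂[K]^m' A) →ₗ[K] ⨂[K]^m A)
    (q : (⨂[K]^n A) →ₗ[K] ⨂[K]^n' A) (f : (⨂[K]^m A) →ₗ[K] ⨂[K]^n A) :
    twistConj hS p q (twistEquiv hS m n f) = twistEquiv hS m' n' (q ∘ₗ f ∘ₗ p) := by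
  simp only [twistConj, LinearMap.comp_apply, LinearEquiv.coe_coe, LinearEquiv.symm_apply_apply]
  rfl

/-- Splittings of the bar and of the cobar complex contract the rows and the columns of the
Gerstenhaber–Schack double complex. -/
def doubleSplitting (hS : ∀ a, LinearMap.mul' K A (S.lTensor A (Coalgebra.comul a)) =
    algebraMap K A (Coalgebra.counit a))
    (T : ChainSplitting (X := fun m => ⨂[K]^m A) fun m => bar (K := K) (A := A) m)
    (U : CochainSplitting (X := fun n => ⨂[K]^n A) fun n => cobar (K := K) (A := A) n) :
    DoubleSplitting K A where
  P₁ m n := twistConj hS (T.π m) LinearMap.id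
  P₂ m n := twistConj hS LinearMap.id (U.π n)
  η₁ m n := twistConj hS (T.h m) LinearMap.id
  η₂ m n := twistConj hS LinearMap.id (U.h n)
  P₁_P₁ m n f := by
    obtain ⟨f, rfl⟩ := (twistEquiv hS m n).surjective f
    simp only [twistConj_twistEquiv]
    exact congrArg _ (LinearMap.ext fun y => by simp [T.π_π])
  P₂_P₂ m n f := by
    obtain ⟨f, rfl⟩ := (twistEquiv hS m n).surjective f
    simp only [twistConj_twistEquiv]
    exact congrArg _ (LinearMap.ext fun y => by simp [U.π_π])
  P₁_P₂ m n f := by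
    obtain ⟨f, rfl⟩ := (twistEquiv hS m n).surjective f
    simp only [twistConj_twistEquiv]
    exact congrArg _ (LinearMap.ext fun y => rfl)
  d₁_P₁ m n f := by
    obtain ⟨f, rfl⟩ := (twistEquiv hS m n).surjective f
    simp only [twistConj_twistEquiv, d₁_twistEquiv]
    rw [LinearEquiv.map_eq_zero_iff]
    exact LinearMap.ext fun y => by simp [T.π_d]
  P₁_d₁ m n f := by
    obtain ⟨f, rfl⟩ := (twistEquiv hS m n).surjective f
    simp only [twistConj_twistEquiv, d₁_twistEquiv]
    rw [LinearEquiv.map_eq_zero_iff]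
    exact LinearMap.ext fun y => by simp [T.d_π]
  d₂_P₂ m n f := by
    obtain ⟨f, rfl⟩ := (twistEquiv hS m n).surjective f
    simp only [twistConj_twistEquiv, d₂_twistEquiv]
    rw [LinearEquiv.map_eq_zero_iff]
    exact LinearMap.ext fun y => by simp [U.d_π]
  P₂_d₂ m n f := by
    obtain ⟨f, rfl⟩ := (twistEquiv hS m n).surjective f
    simp only [twistConj_twistEquiv, d₂_twistEquiv]
    rw [LinearEquiv.map_eq_zero_iff]
    exact LinearMap.ext fun y => by simp [U.π_d]
  d₁_P₂ m n f := by
    obtain ⟨f, rfl⟩ := (twistEquiv hS m n).surjective f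
    simp only [twistConj_twistEquiv, d₁_twistEquiv]
    rfl
  d₂_P₁ m n f := by
    obtain ⟨f, rfl⟩ := (twistEquiv hS m n).surjective f
    simp only [twistConj_twistEquiv, d₂_twistEquiv]
    rfl
  d₁_η₂ m n f := by
    obtain ⟨f, rfl⟩ := (twistEquiv hS m (n + 1)).surjective f
    simp only [twistConj_twistEquiv, d₁_twistEquiv]
    rfl
  d₂_η₁ m n f := by
    obtain ⟨f, rfl⟩ := (twistEquiv hS (m + 1) n).surjective f
    simp only [twistConj_twistEquiv, d₂_twistEquiv]
    rfl
  η₁_zero n f := by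
    obtain ⟨f, rfl⟩ := (twistEquiv hS 0 n).surjective f
    simp only [twistConj_twistEquiv, d₁_twistEquiv, ← map_sub]
    exact congrArg _ (LinearMap.ext fun y => by simp [T.π_zero])
  η₁_succ m n f := by
    obtain ⟨f, rfl⟩ := (twistEquiv hS (m + 1) n).surjective f
    simp only [twistConj_twistEquiv, d₁_twistEquiv, ← map_sub, ← map_add]
    exact congrArg _ (LinearMap.ext fun y => by simp [T.π_succ]; abel)
  η₂_zero m f := by
    obtain ⟨f, rfl⟩ := (twistEquiv hS m 0).surjective f
    simp only [twistConj_twistEquiv, d₂_twistEquiv, ← map_sub]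
    exact congrArg _ (LinearMap.ext fun y => by simp [U.π_zero])
  η₂_succ m n f := by
    obtain ⟨f, rfl⟩ := (twistEquiv hS m (n + 1)).surjective f
    simp only [twistConj_twistEquiv, d₂_twistEquiv, ← map_sub, ← map_add]
    exact congrArg _ (LinearMap.ext fun y => by simp [U.π_succ]; abel)

/-- For idempotents `p` and `q`, the maps of the form `q ∘ f ∘ p` are the maps from the range of
`p` to the range of `q`. -/
def rangeCompEquiv {V W : Type*} [AddCommGroup V] [AddCommGroup W] [Module K V] [Module K W]
    (p : V →ₗ[K] V) (q : W →ₗ[K] W) (hp : ∀ x, p (p x) = p x) (hq : ∀ x, q (q x) = q x) :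
    LinearMap.range (LinearMap.compRight K q ∘ₗ LinearMap.lcomp K W p) ≃ₗ[K]
      (LinearMap.range p →ₗ[K] LinearMap.range q) where
  toFun f := q.rangeRestrict ∘ₗ f.1 ∘ₗ (LinearMap.range p).subtype
  map_add' f g := LinearMap.ext fun x => Subtype.ext (map_add q _ _)
  map_smul' r f := LinearMap.ext fun x => Subtype.ext (map_smul q _ _)
  invFun g := ⟨(LinearMap.range q).subtype ∘ₗ g ∘ₗ p.rangeRestrict,
    (LinearMap.range q).subtype ∘ₗ g ∘ₗ p.rangeRestrict, LinearMap.ext fun x => by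
      obtain ⟨y, hy⟩ := (g (p.rangeRestrict x)).2
      have h1 : p.rangeRestrict (p x) = p.rangeRestrict x := Subtype.ext (hp x)
      simp only [LinearMap.comp_apply, LinearMap.compRight_apply, LinearMap.lcomp_apply',
        Submodule.subtype_apply, h1, ← hy, hq]⟩
  left_inv f := by
    obtain ⟨_, f, rfl⟩ := f
    refine Subtype.ext (LinearMap.ext fun x => ?_)
    change q (q (f (p (p x)))) = q (f (p x))
    rw [hp, hq]
  right_inv g := by
    refine LinearMap.ext ?_
    rintro ⟨_, x, rfl⟩
    refine Subtype.ext ?_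
    obtain ⟨y, hy⟩ := (g (p.rangeRestrict x)).2
    have h1 : p.rangeRestrict (p x) = p.rangeRestrict x := Subtype.ext (hp x)
    change q (g (p.rangeRestrict (p x))).1 = (g (p.rangeRestrict x)).1
    rw [h1, ← hy, hq]

/-- Conjugate endomorphisms have isomorphic ranges. -/
def rangeConjEquiv {V W : Type*} [AddCommGroup V] [AddCommGroup W] [Module K V] [Module K W]
    (e : V ≃ₗ[K] W) {P : V →ₗ[K] V} {Q : W →ₗ[K] W} (h : ∀ x, Q (e x) = e (P x)) :
    LinearMap.range Q ≃ₗ[K] LinearMap.range P :=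
  have h1 : LinearMap.range Q = (LinearMap.range P).map e.toLinearMap := by
    rw [← LinearMap.range_comp, ← LinearMap.range_comp_of_range_eq_top _ (LinearEquiv.range e)]
    exact congrArg LinearMap.range (LinearMap.ext h)
  (LinearEquiv.ofEq _ _ h1).trans (e.submoduleMap _).symm

theorem doubleSplitting_P₂_P₁_twistEquiv
    (hS : ∀ a, LinearMap.mul' K A (S.lTensor A (Coalgebra.comul a)) =
      algebraMap K A (Coalgebra.counit a))
    (T : ChainSplitting (X := fun m => ⨂[K]^m A) fun m => bar (K := K) (A := A) m)
    (U : CochainSplitting (X := fun n => ⨂[K]^n A) fun n => cobar (K := K) (A := A) n)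
    (m n : ℕ) (f : (⨂[K]^m A) →ₗ[K] ⨂[K]^n A) :
    (doubleSplitting hS T U).P₂ m n ((doubleSplitting hS T U).P₁ m n (twistEquiv hS m n f)) =
      twistEquiv hS m n (U.π n ∘ₗ f ∘ₗ T.π m) := by
  change twistConj hS LinearMap.id (U.π n)
    (twistConj hS (T.π m) LinearMap.id (twistEquiv hS m n f)) = _
  rw [twistConj_twistEquiv, twistConj_twistEquiv]
  rfl

/-- The components of the cohomology of the split double complex are the spaces of maps from the
homology of the bar complex to the cohomology of the cobar complex. -/
def rangeDoubleSplittingEquiv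
    (hS : ∀ a, LinearMap.mul' K A (S.lTensor A (Coalgebra.comul a)) =
      algebraMap K A (Coalgebra.counit a))
    (T : ChainSplitting (X := fun m => ⨂[K]^m A) fun m => bar (K := K) (A := A) m)
    (U : CochainSplitting (X := fun n => ⨂[K]^n A) fun n => cobar (K := K) (A := A) n)
    (m n : ℕ) :
    LinearMap.range ((doubleSplitting hS T U).P₂ m n ∘ₗ (doubleSplitting hS T U).P₁ m n) ≃ₗ[K]
      (LinearMap.range (T.π m) →ₗ[K] LinearMap.range (U.π n)) :=
  (rangeConjEquiv (twistEquiv hS m n) (doubleSplitting_P₂_P₁_twistEquiv hS T U m n)).trans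
    (rangeCompEquiv (T.π m) (U.π n) (T.π_π m) (U.π_π n))

theorem finrank_pi_linearMap {κ : Type*} [Fintype κ] (M N : κ → Type*)
    [∀ i, AddCommGroup (M i)] [∀ i, AddCommGroup (N i)] [∀ i, Module K (M i)]
    [∀ i, Module K (N i)] (hM : ∀ i, Module.Finite K (M i)) (hN : ∀ i, Module.Finite K (N i)) :
    Module.Finite K (∀ i, M i →ₗ[K] N i) ∧ Module.finrank K (∀ i, M i →ₗ[K] N i) =
      ∑ i, Module.finrank K (M i) * Module.finrank K (N i) := by
  refine ⟨inferInstance, ?_⟩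
  rw [Module.finrank_pi_fintype]
  exact Finset.sum_congr rfl fun i _ => Module.finrank_linearMap ..

theorem PolynomialCoordinates.finrank_cohomology {ι : Type*} [Fintype ι]
    (C : PolynomialCoordinates K A ι)
    (hS : ∀ a, LinearMap.mul' K A (S.lTensor A (Coalgebra.comul a)) =
      algebraMap K A (Coalgebra.counit a)) (k : ℕ) :
    Module.Finite K (Cohomology K A k) ∧ Module.finrank K (Cohomology K A k) =
      ∑ p : Finset.HasAntidiagonal.antidiagonal k,
        (Fintype.card ι).choose (p : ℕ × ℕ).1 * (Fintype.card ι).choose (p : ℕ × ℕ).2 := by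
  obtain ⟨T⟩ := nonempty_chainSplitting (X := fun m => ⨂[K]^m A)
    (fun m => bar (K := K) (A := A) m) fun m x => LinearMap.congr_fun (bar_comp_bar m) x
  obtain ⟨U⟩ := nonempty_cochainSplitting (X := fun n => ⨂[K]^n A)
    (fun n => cobar (K := K) (A := A) n) fun n x => LinearMap.congr_fun (cobar_comp_cobar n) x
  have hT : ∀ m, Module.Finite K (LinearMap.range (T.π m)) ∧
      Module.finrank K (LinearMap.range (T.π m)) = (Fintype.card ι).choose m := fun m =>
    finrank_range_of_rank_range_dualMap _ ((T.dual.rank_eq m).symm.trans (C.rank_dual_bar m))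
  have hU : ∀ n, Module.rank K (LinearMap.range (U.π n)) = ((Fintype.card ι).choose n : ℕ) :=
    fun n => (U.rank_eq n).symm.trans (C.rank_cobar n)
  have hT1 := fun m => (hT m).1
  have hU1 : ∀ n, Module.Finite K (LinearMap.range (U.π n)) := fun n =>
    Module.rank_lt_aleph0_iff.1 (by rw [hU n]; exact Cardinal.natCast_lt_aleph0)
  let e : Cohomology K A k ≃ₗ[K] ((p : Finset.HasAntidiagonal.antidiagonal k) →
      (LinearMap.range (T.π (p : ℕ × ℕ).1) →ₗ[K] LinearMap.range (U.π (p : ℕ × ℕ).2))) :=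
    ((doubleSplitting hS T U).cohomologyEquivRange k).trans
      (((doubleSplitting hS T U).rangeTotalEquiv k).trans
        (LinearEquiv.piCongrRight fun p => rangeDoubleSplittingEquiv hS T U _ _))
  obtain ⟨h1, h2⟩ := finrank_pi_linearMap (K := K)
    (fun p : Finset.HasAntidiagonal.antidiagonal k => LinearMap.range (T.π (p : ℕ × ℕ).1))
    (fun p => LinearMap.range (U.π (p : ℕ × ℕ).2)) (fun p => hT1 _) (fun p => hU1 _)
  refine ⟨Module.Finite.equiv e.symm, ?_⟩
  rw [e.finrank_eq, h2]
  refine Finset.sum_congr rfl fun p _ => ?_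
  rw [(hT _).2, Module.finrank_eq_of_rank_eq (hU _)]

end SplitComplex

end

end GerstenhaberSchack

theorem proposition3p11 {K : Type*} [Field K] [CharZero K]
    {V : Type*} [AddCommGroup V] [Module K V] [FiniteDimensional K V] (k : ℕ) :
    Nonempty (GerstenhaberSchack.Cohomology K (SymmetricAlgebra K V) k ≃ₗ[K]
      DirectSum (Finset.HasAntidiagonal.antidiagonal k) fun p =>
        (⋀[K]^(p : ℕ × ℕ).1 V) ⊗[K] (⋀[K]^(p : ℕ × ℕ).2 (Module.Dual K V))) := by
  obtain ⟨h1, h2⟩ := (GerstenhaberSchack.symmetricCoordinates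
    (Module.finBasis K V)).finrank_cohomology
      GerstenhaberSchack.mul_lTensor_symmetricAntipode k
  refine ⟨LinearEquiv.ofFinrankEq _ _ ?_⟩
  rw [h2, Module.finrank_directSum]
  refine Finset.sum_congr rfl fun p _ => ?_
  rw [Module.finrank_tensorProduct, exteriorPower.finrank_eq, exteriorPower.finrank_eq,
    Subspace.dual_finrank_eq, Fintype.card_fin]
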